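/- Let $\Omega=(a,b)\subset\mathbb R$ be a bounded open interval, $n\in(0,3)$, and let $u_{in}\in H^1(\Omega)$ be non-negative with $\int_\Omega u_{in}\,dx=1$. For each $\varepsilon\in(0,1)$ let $u^\varepsilon\ge 0$, continuous on $[0,\infty)\times\overline\Omega$ with $u^\varepsilon(t,\cdot)\in H^1(\Omega)$ for all $t\ge0$, be a weak solution of $$|\ln\varepsilon|^{-1}\partial_t u+\partial_x\big((\varepsilon^{3-n}u^n+u^3)\,\partial_{xxx}u\big)=0\quad\text{in }(0,\infty)\times\Omega,$$ with the null-flux condition $(\varepsilon^{3-n}u^n+u^3)\partial_{xxx}u=0$ and $u_x=0$ on $\partial\Omega$ (for a.e. $t$ the function $u^\varepsilon(t,\cdot)$ being $C^1$ up to the boundary), and $u^\varepsilon(0,\cdot)=u_{in}$. Here $u^\varepsilon_{xx},u^\varepsilon_{xxx}$ are weak derivatives on $\{u^\varepsilon>0\}$, and products containing them are set to $0$ on $\{u^\varepsilon=0\}$. Let $$B(s)=\int_0^s\int_r^\infty\frac{dv\,dr}{v^{n-1}+v^2},\qquad B^\varepsilon(s)=\frac{B(s/\varepsilon)}{|\ln\varepsilon|},\qquad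 \rho^\varepsilon=B^\varepsilon(u^\varepsilon).$$ Assume, as part of the notion of solution, that for all $t>0$ one has $\int_\Omega u^\varepsilon(t)\,dx=\int_\Omega u_{in}\,dx$, the energy inequality $$\int_\Omega \tfrac12|u^\varepsilon_x(t)|^2dx+\int_0^t\!\!\int_{\{u^\varepsilon>0\}}|\ln\varepsilon|\,(\varepsilon^{3-n}(u^\varepsilon)^n+(u^\varepsilon)^3)|u^\varepsilon_{xxx}|^2dx\,ds\le\int_\Omega\tfrac12|\partial_xu_{in}|^2dx,$$ and the entropy inequality $$\int_\Omega\rho^\varepsilon(t)\,dx\ge\int_0^t\!\!\int_\Omega u^\varepsilon|u^\varepsilon_{xx}|^2dx\,ds+\int_\Omega\rho^\varepsilon(0)\,dx,$$ and that $\partial_t\rho^\varepsilon=T^\varepsilon+\partial_xR^\varepsilon$ in the sense of distributions on $(0,\infty)\times\Omega$, where $R^\varepsilon=-|\ln\varepsilon|\,(B^{\varepsilon})'(u^\varepsilon)\,(\varepsilon^{3-n}(u^\varepsilon)^{n}+(u^\varepsilon)^3)\,u^\varepsilon_{xxx}$, and $T^\varepsilon=-u^\varepsilon u^\varepsilon_xu^\varepsilon_{xxx}$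 is integrable on $(0,S)\times\Omega$ for every $S>0$ and satisfies, for a.e. $t$ and all $\varphi\in C^\infty(\overline\Omega)$, $$\int_\Omega T^\varepsilon\varphi\,dx=\int_\Omega u^\varepsilon(u^\varepsilon_{xx})^2\varphi\,dx-\tfrac56\int_\Omega (u^\varepsilon_x)^3\varphi'\,dx-\tfrac12\int_\Omega u^\varepsilon(u^\varepsilon_x)^2\varphi''\,dx.$$ Then, for every $t>0$, the family $\{u^\varepsilon(t,\cdot)\}_{\varepsilon\in(0,1)}$ is bounded in $H^1(\Omega)$ and relatively compact in $C^0(\overline\Omega)$. Furthermore, let $p\in[1,\infty)$, $\varepsilon_k\in(0,1)$ with $\varepsilon_k\to0$, and let $\rho$ be a function, integrable on $(0,S)\times\Omega$ for every $S>0$, such that $\rho^{\varepsilon_k}\to\rho$ strongly in $L^p(0,S;W^{-1,1}(\Omega))$ for every $S>0$. Set $$\Sigma(t)=\Big\{x\in\Omega:\ \exists r>0,\ \int_{B_r(x)\cap\Omega}[1-\rho(t,y)]\,dy=0\Big\}.$$ Then there is a subsequence $\varepsilon_k'$ of $\varepsilon_k$ such that for a.e. $t>0$ every accumulation point $v$ of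 $\{u^{\varepsilon_k'}(t,\cdot)\}_k$ with respect to uniform convergence on $\overline\Omega$ belongs to $C^0(\overline\Omega)\cap H^1(\Omega)$ and satisfies $$v'''=0\ \text{in }\{v>0\},\qquad\int_\Omega v\,dx=1,\qquad \{v>0\}\subset\Sigma(t),\qquad \partial\{v>0\}\cap\Sigma(t)=\emptyset,$$ where $\{v>0\}=\{x\in\Omega: v(x)>0\}$. -/

import Mathlib

open Set Filter Topology MeasureTheory
open scoped ENNReal ContDiff

namespace ThinFilm

noncomputable section

/-! ### Sobolev notions on an open subset of the line -/

/-- Test functions on an open set `U` of the line: elements of `C_c^∞(U)`. -/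
structure IsTest (U : Set ℝ) (φ : ℝ → ℝ) : Prop where
  smooth : ContDiff ℝ ∞ φ
  compact : HasCompactSupport φ
  supp : tsupport φ ⊆ U

/-- `g` is the weak derivative of order `k` of `f` on the open set `U`. -/
def HasWeakDeriv (k : ℕ) (U : Set ℝ) (f g : ℝ → ℝ) : Prop :=
  LocallyIntegrableOn f U ∧ LocallyIntegrableOn g U ∧
    ∀ φ : ℝ → ℝ, IsTest U φ →
      ∫ x in U, f x * iteratedDeriv k φ x = (-1) ^ k * ∫ x in U, g x * φ x

/-- `f ∈ H¹(a, b)`. -/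
def MemH1 (a b : ℝ) (f : ℝ → ℝ) : Prop :=
  ∃ g : ℝ → ℝ, HasWeakDeriv 1 (Ioo a b) f g ∧
    MemLp f 2 (volume.restrict (Ioo a b)) ∧ MemLp g 2 (volume.restrict (Ioo a b))

/-- `f ∈ H¹(a, b)` with `‖f‖_{L²}² + ‖f'‖_{L²}² ≤ C²`. -/
def H1NormLE (a b : ℝ) (f : ℝ → ℝ) (C : ℝ) : Prop :=
  ∃ g : ℝ → ℝ, HasWeakDeriv 1 (Ioo a b) f g ∧
    MemLp f 2 (volume.restrict (Ioo a b)) ∧ MemLp g 2 (volume.restrict (Ioo a b)) ∧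
    eLpNorm f 2 (volume.restrict (Ioo a b)) ^ 2 + eLpNorm g 2 (volume.restrict (Ioo a b)) ^ 2
      ≤ ENNReal.ofReal (C ^ 2)

/-- The `W^{-1,1}(a, b)` norm of an integrable function `f`, as the norm dual to
`max (‖φ‖_∞) (‖φ'‖_∞)` on test functions. On integrable functions it coincides with
`inf {‖f₀‖_{L¹} + ‖f₁‖_{L¹} : f = f₀ + ∂ₓ f₁}`. -/
def negSobolevNorm (a b : ℝ) (f : ℝ → ℝ) : ℝ≥0∞ :=
  ⨆ φ ∈ {φ : ℝ → ℝ | IsTest (Ioo a b) φ ∧ ∀ x, |φ x| ≤ 1 ∧ |deriv φ x| ≤ 1},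
    ENNReal.ofReal |∫ x in Ioo a b, f x * φ x|

/-- Positivity set of a profile in the open interval. -/
def posSet (a b : ℝ) (w : ℝ → ℝ) : Set ℝ := {x | x ∈ Ioo a b ∧ 0 < w x}

/-! ### The functions `B` and `B^ε` -/

/-- `B'(r) = ∫_r^∞ dv / (v^{n-1} + v²)`. -/
def dB (n r : ℝ) : ℝ := ∫ v in Ioi r, 1 / (v ^ (n - 1) + v ^ 2)

/-- `B(s) = ∫_0^s ∫_r^∞ dv / (v^{n-1} + v²) dr`. -/
def B (n s : ℝ) : ℝ := ∫ r in (0 : ℝ)..s, dB n r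

/-- `B^ε(s) = |ln ε|⁻¹ B(s / ε)`. -/
def Beps (n ε s : ℝ) : ℝ := |Real.log ε|⁻¹ * B n (s / ε)

/-- The derivative of `B^ε` on `(0, ∞)`. -/
def dBeps (n ε s : ℝ) : ℝ := |Real.log ε|⁻¹ * (ε⁻¹ * dB n (s / ε))

/-- The mobility `ε^{3-n} u^n + u³`. -/
def mobility (n ε s : ℝ) : ℝ := ε ^ (3 - n) * s ^ n + s ^ 3

/-! ### The quantities `T^ε` and `R^ε` -/

/-- `T = - u u_x u_xxx` on `{u > 0}`, and `0` elsewhere. -/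
def Tterm (a b : ℝ) (u ux uxxx : ℝ → ℝ → ℝ) (t x : ℝ) : ℝ :=
  (posSet a b (u t)).indicator (fun y => - (u t y * ux t y * uxxx t y)) x

/-- `R = - |ln ε| (B^ε)'(u) (ε^{3-n} u^n + u³) u_xxx` on `{u > 0}`, and `0` elsewhere. -/
def Rterm (a b n ε : ℝ) (u uxxx : ℝ → ℝ → ℝ) (t x : ℝ) : ℝ :=
  (posSet a b (u t)).indicator
    (fun y => - (|Real.log ε| * dBeps n ε (u t y) * mobility n ε (u t y) * uxxx t y)) x

/-! ### Weak solutions of the rescaled thin film equation -/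

/-- `u` is a non-negative weak solution on `(0, ∞) × (a, b)` of
`|ln ε|⁻¹ u_t + ((ε^{3-n} u^n + u³) u_xxx)_x = 0` with null flux, `u_x = 0` at `a` and `b`, and
initial datum `uin`, which conserves mass and satisfies the energy and entropy inequalities and
the equation for `B^ε(u)`. Here `ux` is the weak derivative of `u` in `x`, while `uxx` and `uxxx`
are the weak derivatives of order two and three in `x` on `{u > 0}`. -/
structure IsSolutionWith (a b n ε : ℝ) (uin : ℝ → ℝ) (u ux uxx uxxx : ℝ → ℝ → ℝ) : Prop where
  /-- `u` denotes the continuous representative. -/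
  continuous : ContinuousOn (Function.uncurry u) (Ici 0 ×ˢ Icc a b)
  nonneg : ∀ t, 0 ≤ t → ∀ x ∈ Icc a b, 0 ≤ u t x
  initial : ∀ x ∈ Icc a b, u 0 x = uin x
  meas_ux : Measurable (Function.uncurry ux)
  meas_uxx : Measurable (Function.uncurry uxx)
  meas_uxxx : Measurable (Function.uncurry uxxx)
  /-- `u(t) ∈ H¹(a, b)`; uniform boundedness in time follows from the mass and energy laws. -/
  deriv_one : ∀ t, 0 ≤ t → HasWeakDeriv 1 (Ioo a b) (u t) (ux t) ∧
    MemLp (ux t) 2 (volume.restrict (Ioo a b))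
  deriv_two : ∀ᵐ t ∂(volume.restrict (Ioi (0 : ℝ))),
    HasWeakDeriv 2 (posSet a b (u t)) (u t) (uxx t)
  deriv_three : ∀ᵐ t ∂(volume.restrict (Ioi (0 : ℝ))),
    HasWeakDeriv 3 (posSet a b (u t)) (u t) (uxxx t)
  /-- The contact angle condition at the walls: for a.e. `t` the function `u(t)` is `C¹` up to the
  boundary, with `u_x = 0` there. -/
  neumann : ∀ᵐ t ∂(volume.restrict (Ioi (0 : ℝ))),
    ContinuousOn (ux t) (Icc a b) ∧ ux t a = 0 ∧ ux t b = 0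
  /-- The equation in weak form; the test functions need not vanish at `a` and `b`, which encodes
  the null flux condition. -/
  equation : ∀ ψ : ℝ → ℝ → ℝ, ContDiff ℝ ∞ (Function.uncurry ψ) →
    HasCompactSupport (Function.uncurry ψ) →
    tsupport (Function.uncurry ψ) ⊆ Ioi 0 ×ˢ univ →
    (∫ t in Ioi (0 : ℝ), ∫ x in Ioo a b, |Real.log ε|⁻¹ * u t x * deriv (fun s => ψ s x) t) +
      (∫ t in Ioi (0 : ℝ), ∫ x in posSet a b (u t),
        mobility n ε (u t x) * uxxx t x * deriv (fun y => ψ t y) x) = 0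
  /-- Conservation of mass. -/
  mass : ∀ t, 0 < t → ∫ x in Ioo a b, u t x = ∫ x in Ioo a b, uin x
  /-- The energy inequality. -/
  energy : ∀ t, 0 < t →
    (∫⁻ x in Ioo a b, ENNReal.ofReal (1 / 2 * ux t x ^ 2)) +
      (∫⁻ s in Ioo 0 t, ∫⁻ x in posSet a b (u s),
        ENNReal.ofReal (|Real.log ε| * mobility n ε (u s x) * uxxx s x ^ 2))
      ≤ ∫⁻ x in Ioo a b, ENNReal.ofReal (1 / 2 * ux 0 x ^ 2)
  /-- The entropy inequality. -/
  entropy : ∀ t, 0 < t →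
    (∫⁻ s in Ioo 0 t, ∫⁻ x in posSet a b (u s), ENNReal.ofReal (u s x * uxx s x ^ 2)) +
      ENNReal.ofReal (∫ x in Ioo a b, Beps n ε (u 0 x))
      ≤ ENNReal.ofReal (∫ x in Ioo a b, Beps n ε (u t x))
  /-- `T` is integrable on `(0, S) × (a, b)` for every `S`. -/
  T_mem : ∀ S, 0 < S →
    ∫⁻ t in Ioo 0 S, ∫⁻ x in Ioo a b, ENNReal.ofReal |Tterm a b u ux uxxx t x| < ⊤
  /-- `∂_t (B^ε(u)) = T + ∂_x R` in the sense of distributions on `(0, ∞) × (a, b)`. -/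
  rho_equation : ∀ ψ : ℝ → ℝ → ℝ, ContDiff ℝ ∞ (Function.uncurry ψ) →
    HasCompactSupport (Function.uncurry ψ) →
    tsupport (Function.uncurry ψ) ⊆ Ioi 0 ×ˢ Ioo a b →
    - (∫ t in Ioi (0 : ℝ), ∫ x in Ioo a b, Beps n ε (u t x) * deriv (fun s => ψ s x) t) =
      (∫ t in Ioi (0 : ℝ), ∫ x in Ioo a b, Tterm a b u ux uxxx t x * ψ t x) -
      (∫ t in Ioi (0 : ℝ), ∫ x in Ioo a b,
        Rterm a b n ε u uxxx t x * deriv (fun y => ψ t y) x)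
  /-- `⟨T, φ⟩ = ∫ u u_xx² φ - (5/6) ∫ u_x³ φ' - (1/2) ∫ u u_x² φ''` for `φ` smooth up to the
  boundary. -/
  T_formula : ∀ᵐ t ∂(volume.restrict (Ioi (0 : ℝ))), ∀ φ : ℝ → ℝ, ContDiff ℝ ∞ φ →
    ∫ x in Ioo a b, Tterm a b u ux uxxx t x * φ x =
      (∫ x in posSet a b (u t), u t x * uxx t x ^ 2 * φ x) -
      5 / 6 * (∫ x in Ioo a b, ux t x ^ 3 * deriv φ x) -
      1 / 2 * (∫ x in Ioo a b, u t x * ux t x ^ 2 * iteratedDeriv 2 φ x)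

/-- Weak solutions, see `IsSolutionWith`. -/
def IsSolution (a b n ε : ℝ) (uin : ℝ → ℝ) (u : ℝ → ℝ → ℝ) : Prop :=
  ∃ ux uxx uxxx : ℝ → ℝ → ℝ, IsSolutionWith a b n ε uin u ux uxx uxxx

/-! ### Limits -/

/-- `Σ = {x ∈ (a, b) : ∃ r > 0, ∫_{B_r(x) ∩ (a, b)} (1 - ρ) = 0}`. -/
def SigmaSet (a b : ℝ) (ρ : ℝ → ℝ) : Set ℝ :=
  {x | x ∈ Ioo a b ∧ ∃ r > 0, ∫ y in Metric.ball x r ∩ Ioo a b, (1 - ρ y) = 0}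

/-- `v` is an accumulation point of the sequence `w` for uniform convergence on `[a, b]`. -/
def IsAccPoint (a b : ℝ) (w : ℕ → ℝ → ℝ) (v : ℝ → ℝ) : Prop :=
  ∃ τ : ℕ → ℕ, StrictMono τ ∧ TendstoUniformlyOn (fun j => w (τ j)) v atTop (Icc a b)

/-- `fε k → f` strongly in `L^p((0, S); W^{-1,1}(a, b))` for every `S > 0`. -/
def TendstoLpNegSobolev (a b : ℝ) (p : ℝ≥0∞) (fε : ℕ → ℝ → ℝ → ℝ) (f : ℝ → ℝ → ℝ) : Prop :=
  ∀ S, 0 < S → Tendsto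
    (fun k => eLpNorm (fun t => negSobolevNorm a b (fun x => fε k t x - f t x)) p
      (volume.restrict (Ioo 0 S))) atTop (𝓝 0)

end

end ThinFilm

namespace ThinFilm

/-! ### Weak derivatives on intervals -/

/-! The density `ρ^ε = B^ε(u^ε)` is close to an indicator of wetness. Since `B(s) = log s + O(1)`
for large `s`, it is at most `1 + O(1/|ln ε|)` and tends to one wherever `u^ε` stays away from zero
(`Beps_le`, `Beps_ge`). A limit density is therefore at most one when tested against non-negative
functions, and it equals one where an accumulation point `v` is positive; this gives `{v > 0} ⊂
Σ(t)`.

The factor `|ln ε|` in the energy inequality makes the dissipation `∫ mobility · u_xxx²` of order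
`1/|ln ε|` in `L¹` in time. Along a subsequence it vanishes at almost every time. On compact parts
of `{v > 0}` the second derivatives then become constant, so `v` is a quadratic polynomial on each
component of `{v > 0}`, flat where it touches a wall (`exists_quadratic_limit`). Such a piece must
meet the zero set inside the domain with a non-zero slope (`LocallyQuadratic.left_slope`).

The separation of `∂{v > 0}` from `Σ(t)` comes from `∂_t ρ = T + ∂_x R`. The flux `R` tends to zero
in `L¹`, because `(B')²` times the mobility grows at most linearly and the dissipation is small
(`flux_le`). The production `T`, tested with a weight `φ = ψ⁴`, is non-negative up to a small error
(`Slice.production_lower`): with a concave truncation `cap δ` the film height is split as `w = (w -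
cap δ w) + cap δ w`; the first part is controlled by the dissipation, and integrating the second by
parts leaves the non-negative term `-(1/3) ∫ (cap δ)''(w) w_x⁴ φ`, another non-negative term and
small remainders. Hence `∫ ρ φ` is non-decreasing in the limit, and bounded by `∫ φ`. Where it
equals `∫ φ` it cannot grow any more, so `⟨T, φ⟩ → 0` in `L¹` on a time interval around almost every
such time (`ae_exists_rat_tendsto`).

At a contact point with slope `s` the opposite happens: each low level of the profile is crossed
with slope near `s`, and the quartic term contributes at least a fixed multiple of `s³ φ`
(`Slice.level_set_lower`). A contact point in `Σ(t)` would make the production both vanish and stay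
positive.

Countably many bump functions and time intervals with rational ends suffice, which keeps the
exceptional times in a null set and lets a single subsequence serve for all times and all
accumulation points. -/

theorem IsTest.continuous {U : Set ℝ} {φ : ℝ → ℝ} (h : IsTest U φ) : Continuous φ :=
  h.smooth.continuous

theorem IsTest.differentiable {U : Set ℝ} {φ : ℝ → ℝ} (h : IsTest U φ) : Differentiable ℝ φ :=
  h.smooth.differentiable (by simp)

theorem IsTest.eq_zero {U : Set ℝ} {φ : ℝ → ℝ} (h : IsTest U φ) {x : ℝ} (hx : x ∉ U) : φ x = 0 :=
  image_eq_zero_of_notMem_tsupport fun hx' => hx (h.supp hx')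

theorem IsTest.mono {U V : Set ℝ} {φ : ℝ → ℝ} (h : IsTest U φ) (hUV : U ⊆ V) : IsTest V φ :=
  ⟨h.smooth, h.compact, h.supp.trans hUV⟩

theorem IsTest.derivative {U : Set ℝ} {φ : ℝ → ℝ} (h : IsTest U φ) : IsTest U (deriv φ) :=
  ⟨((contDiff_infty_iff_deriv (𝕜 := ℝ)).1 h.smooth).2, h.compact.deriv,
    (tsupport_deriv_subset (𝕜 := ℝ) (f := φ)).trans h.supp⟩

theorem IsTest.add {U : Set ℝ} {φ ψ : ℝ → ℝ} (h : IsTest U φ) (h' : IsTest U ψ) :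
    IsTest U (fun x => φ x + ψ x) :=
  ⟨h.smooth.add h'.smooth, h.compact.add h'.compact,
    (tsupport_add φ ψ).trans (union_subset h.supp h'.supp)⟩

theorem IsTest.const_mul {U : Set ℝ} {φ : ℝ → ℝ} (h : IsTest U φ) (c : ℝ) :
    IsTest U (fun x => c * φ x) :=
  ⟨contDiff_const.mul h.smooth, h.compact.mul_left,
    (tsupport_mul_subset_right (f := fun _ => c) (g := φ)).trans h.supp⟩

theorem IsTest.sub {U : Set ℝ} {φ ψ : ℝ → ℝ} (h : IsTest U φ) (h' : IsTest U ψ) :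
    IsTest U (fun x => φ x - ψ x) := by
  simpa [sub_eq_add_neg] using h.add (h'.const_mul (-1))

theorem IsTest.mul {U : Set ℝ} {φ ψ : ℝ → ℝ} (h : IsTest U φ) (h' : ContDiff ℝ ∞ ψ) :
    IsTest U (fun x => φ x * ψ x) :=
  ⟨h.smooth.mul h', h.compact.mul_right, (tsupport_mul_subset_left (f := φ) (g := ψ)).trans h.supp⟩

/-- A test function on an interval vanishes off a compact subinterval. -/
theorem IsTest.exists_Icc {c d : ℝ} (hcd : c < d) {φ : ℝ → ℝ} (h : IsTest (Ioo c d) φ) :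
    ∃ l r, c < l ∧ l < r ∧ r < d ∧ ∀ x, x ∉ Ioo l r → φ x = 0 := by
  rcases (tsupport φ).eq_empty_or_nonempty with h0 | hne
  · obtain ⟨l, hl, hl'⟩ := exists_between hcd
    obtain ⟨r, hr, hr'⟩ := exists_between hl'
    exact ⟨l, r, hl, hr, hr', fun x _ => image_eq_zero_of_notMem_tsupport (by simp [h0])⟩
  · have hc : IsCompact (tsupport φ) := h.compact
    obtain ⟨x, hx, hxm⟩ := hc.exists_isLeast hne
    obtain ⟨y, hy, hym⟩ := hc.exists_isGreatest hne
    obtain ⟨l, hl, hl'⟩ := exists_between (h.supp hx).1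
    obtain ⟨r, hr, hr'⟩ := exists_between (h.supp hy).2
    refine ⟨l, r, hl, lt_trans (lt_of_lt_of_le hl' (hxm hy)) hr, hr', fun z hz => ?_⟩
    refine image_eq_zero_of_notMem_tsupport fun hz' => hz ⟨hl'.trans_le (hxm hz'), ?_⟩
    exact (hym hz').trans_lt hr

theorem setIntegral_eq_intervalIntegral_of_eq_zero {c d l r : ℝ} (hcl : c < l) (hlr : l < r)
    (hrd : r < d) {F : ℝ → ℝ} (hF : ∀ x, x ∉ Ioo l r → F x = 0) :
    ∫ x in Ioo c d, F x = ∫ x in l..r, F x := by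
  rw [intervalIntegral.integral_of_le hlr.le, integral_Ioc_eq_integral_Ioo]
  exact setIntegral_eq_of_subset_of_forall_sdiff_eq_zero measurableSet_Ioo
    (Ioo_subset_Ioo hcl.le hrd.le) fun x hx => hF x hx.2

theorem locallyIntegrableOn_intervalIntegrable {c d l r : ℝ} {g : ℝ → ℝ}
    (hg : LocallyIntegrableOn g (Ioo c d)) (hl : l ∈ Ioo c d) (hr : r ∈ Ioo c d) :
    IntervalIntegrable g volume l r := by
  have : uIcc l r ⊆ Ioo c d := (ordConnected_Ioo).uIcc_subset hl hr
  exact (hg.integrableOn_compact_subset this isCompact_uIcc).intervalIntegrable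

/-- The primitive of a locally integrable function is integrated by parts against test functions. -/
theorem integral_primitive_mul_deriv {c d x₀ : ℝ} (hx₀ : x₀ ∈ Ioo c d) {g φ : ℝ → ℝ}
    (hg : LocallyIntegrableOn g (Ioo c d)) (hφ : IsTest (Ioo c d) φ) :
    ∫ x in Ioo c d, (∫ y in x₀..x, g y) * deriv φ x = - ∫ x in Ioo c d, g x * φ x := by
  have hcd : c < d := hx₀.1.trans hx₀.2
  obtain ⟨l, r, hcl, hlr, hrd, h0⟩ := hφ.exists_Icc hcd
  obtain ⟨l', r', hcl', hlr', hrd', h0'⟩ := hφ.derivative.exists_Icc hcd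
  -- The supports of `φ` and `φ'` are enclosed separately, and the interval is widened to contain
  -- the base point `x₀`, so that the primitive is absolutely continuous on all of `[L, R]`.
  set L := min (min l l') x₀ with hL
  set R := max (max r r') x₀ with hR
  have hLl : L ≤ l := (min_le_left _ _).trans (min_le_left _ _)
  have hLl' : L ≤ l' := (min_le_left _ _).trans (min_le_right _ _)
  have hRr : r ≤ R := (le_max_left _ _).trans (le_max_left _ _)
  have hRr' : r' ≤ R := (le_max_right _ _).trans (le_max_left _ _)
  have hLx : L ≤ x₀ := min_le_right _ _
  have hRx : x₀ ≤ R := le_max_right _ _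
  have hLc : c < L := lt_min (lt_min hcl hcl') hx₀.1
  have hRd : R < d := max_lt (max_lt hrd hrd') hx₀.2
  have hLR : L < R := hLl.trans_lt (hlr.trans_le hRr)
  have hLI : L ∈ Ioo c d := ⟨hLc, hLR.trans hRd⟩
  have hRI : R ∈ Ioo c d := ⟨hLc.trans hLR, hRd⟩
  have hφ0 : ∀ x, x ∉ Ioo L R → φ x = 0 := fun x hx =>
    h0 x fun hx' => hx ⟨hLl.trans_lt hx'.1, hx'.2.trans_le hRr⟩
  have hφ0' : ∀ x, x ∉ Ioo L R → deriv φ x = 0 := fun x hx =>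
    h0' x fun hx' => hx ⟨hLl'.trans_lt hx'.1, hx'.2.trans_le hRr'⟩
  rw [setIntegral_eq_intervalIntegral_of_eq_zero hLc hLR hRd (fun x hx => by simp [hφ0' x hx]),
    setIntegral_eq_intervalIntegral_of_eq_zero hLc hLR hRd (fun x hx => by simp [hφ0 x hx])]
  have hgi : IntervalIntegrable g volume L R := locallyIntegrableOn_intervalIntegrable hg hLI hRI
  have hxm : x₀ ∈ uIcc L R := by rw [uIcc_of_le hLR.le]; exact ⟨hLx, hRx⟩
  have hG := hgi.absolutelyContinuousOnInterval_intervalIntegral hxm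
  have hφac : AbsolutelyContinuousOnInterval φ L R :=
    (hφ.smooth.of_le (by simp)).contDiffOn.absolutelyContinuousOnInterval
  rw [hG.integral_mul_deriv_eq_deriv_mul hφac, hφ0 L (by simp), hφ0 R (by simp)]
  simp only [mul_zero, sub_zero, zero_sub, neg_inj]
  refine intervalIntegral.integral_congr_ae ?_
  filter_upwards [hgi.ae_hasDerivAt_integral] with x hx hxI
  rw [(hx (uIoc_subset_uIcc hxI) x₀ hxm).deriv]

/-- A test function with vanishing mean is the derivative of a test function. -/
theorem IsTest.exists_primitive {c d : ℝ} (hcd : c < d) {ζ : ℝ → ℝ} (h : IsTest (Ioo c d) ζ)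
    (h0 : ∫ x in Ioo c d, ζ x = 0) : ∃ θ, IsTest (Ioo c d) θ ∧ deriv θ = ζ := by
  obtain ⟨l, r, hcl, hlr, hrd, hz⟩ := h.exists_Icc hcd
  rw [setIntegral_eq_intervalIntegral_of_eq_zero hcl hlr hrd hz] at h0
  have hd : ∀ x, HasDerivAt (fun x => ∫ y in l..x, ζ y) (ζ x) x := fun x =>
    intervalIntegral.integral_hasDerivAt_right (h.continuous.intervalIntegrable _ _)
      h.continuous.stronglyMeasurable.stronglyMeasurableAtFilter h.continuous.continuousAt
  have hder : deriv (fun x => ∫ y in l..x, ζ y) = ζ := funext fun x => (hd x).deriv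
  -- Vanishing mean is what makes the primitive return to zero at `r`.
  have hzero : ∀ x, x ∉ Icc l r → (∫ y in l..x, ζ y) = 0 := by
    intro x hx
    rcases lt_or_ge x l with hxl | hxl
    · rw [intervalIntegral.integral_congr (g := fun _ => 0), intervalIntegral.integral_zero]
      intro y hy
      rw [uIcc_of_ge hxl.le] at hy
      exact hz y fun hy' => absurd hy'.1 (not_lt.2 hy.2)
    · have hxr : r < x := by
        by_contra hcon
        exact hx ⟨hxl, not_lt.1 hcon⟩
      rw [← intervalIntegral.integral_add_adjacent_intervals
        (h.continuous.intervalIntegrable l r) (h.continuous.intervalIntegrable r x), h0, zero_add]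
      rw [intervalIntegral.integral_congr (g := fun _ => 0), intervalIntegral.integral_zero]
      intro y hy
      rw [uIcc_of_le hxr.le] at hy
      exact hz y fun hy' => absurd hy'.2 (not_lt.2 hy.1)
  have hts : tsupport (fun x => ∫ y in l..x, ζ y) ⊆ Icc l r := by
    refine closure_minimal (fun x hx => ?_) isClosed_Icc
    by_contra hcon
    exact hx (hzero x hcon)
  refine ⟨_, ⟨?_, ?_, hts.trans (Icc_subset_Ioo hcl hrd)⟩, hder⟩
  · rw [contDiff_infty_iff_deriv, hder]
    exact ⟨fun x => (hd x).differentiableAt, h.smooth⟩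
  · exact HasCompactSupport.of_support_subset_isCompact isCompact_Icc
      ((subset_tsupport _).trans hts)

theorem exists_isTest_integral_eq_one {c d : ℝ} (hcd : c < d) :
    ∃ χ, IsTest (Ioo c d) χ ∧ ∫ x in Ioo c d, χ x = 1 := by
  let f : ContDiffBump ((c + d) / 2) := ⟨(d - c) / 8, (d - c) / 4, by linarith, by linarith⟩
  have hts : tsupport (f.normed volume) ⊆ Ioo c d := by
    rw [f.tsupport_normed_eq, Real.closedBall_eq_Icc]
    refine Icc_subset_Ioo ?_ ?_ <;> simp only [f] <;> linarith
  refine ⟨f.normed volume, ⟨f.contDiff_normed, f.hasCompactSupport_normed, hts⟩, ?_⟩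
  rw [setIntegral_eq_integral_of_forall_compl_eq_zero, f.integral_normed]
  exact fun x hx => image_eq_zero_of_notMem_tsupport fun hx' => hx (hts hx')

theorem IsTest.mul_integrableOn {c d : ℝ} {f φ : ℝ → ℝ} (hcd : c < d)
    (hf : LocallyIntegrableOn f (Ioo c d)) (hφ : IsTest (Ioo c d) φ) :
    IntegrableOn (fun x => f x * φ x) (Ioo c d) := by
  obtain ⟨l, r, hcl, hlr, hrd, h0⟩ := hφ.exists_Icc hcd
  have h1 : IntegrableOn (fun x => f x * φ x) (Icc l r) :=
    (hf.integrableOn_compact_subset (Icc_subset_Ioo hcl hrd) isCompact_Icc).mul_continuousOn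
      hφ.continuous.continuousOn isCompact_Icc
  refine h1.of_forall_sdiff_eq_zero measurableSet_Ioo fun x hx => ?_
  rw [h0 x fun hx' => hx.2 (Ioo_subset_Icc_self hx'), mul_zero]

/-- Lemma of du Bois-Reymond. -/
theorem ae_eq_const_of_integral_mul_deriv_eq_zero {c d : ℝ} (hcd : c < d) {f : ℝ → ℝ}
    (hf : LocallyIntegrableOn f (Ioo c d))
    (h : ∀ φ, IsTest (Ioo c d) φ → ∫ x in Ioo c d, f x * deriv φ x = 0) :
    ∃ C, ∀ᵐ x, x ∈ Ioo c d → f x = C := by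
  obtain ⟨χ, hχ, hχ1⟩ := exists_isTest_integral_eq_one hcd
  refine ⟨∫ x in Ioo c d, f x * χ x, ?_⟩
  set C := ∫ x in Ioo c d, f x * χ x with hC
  have hcst : LocallyIntegrableOn (fun _ : ℝ => C) (Ioo c d) :=
    continuousOn_const.locallyIntegrableOn measurableSet_Ioo
  have key := isOpen_Ioo.ae_eq_zero_of_integral_contDiff_smul_eq_zero
    (μ := volume) (f := fun x => f x - C) (U := Ioo c d) (hf.sub hcst) ?_
  · filter_upwards [key] with x hx hxI
    linarith [hx hxI]
  · intro φ hφs hφc hφt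
    have hφ : IsTest (Ioo c d) φ := ⟨hφs, hφc, hφt⟩
    have hφi : IntegrableOn φ (Ioo c d) := by
      simpa using hφ.mul_integrableOn hcd
        (continuousOn_const.locallyIntegrableOn measurableSet_Ioo (f := fun _ => (1 : ℝ)))
    have hχi : IntegrableOn χ (Ioo c d) := by
      simpa using hχ.mul_integrableOn hcd
        (continuousOn_const.locallyIntegrableOn measurableSet_Ioo (f := fun _ => (1 : ℝ)))
    set m := ∫ x in Ioo c d, φ x with hm
    -- Subtracting `m χ` removes the mean of `φ`, so `φ - m χ` is an admissible derivative; the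
    -- hypothesis then reads `∫ f φ = m ∫ f χ`, which identifies the constant as `∫ f χ`.
    obtain ⟨θ, hθ, hθd⟩ := (hφ.sub (hχ.const_mul m)).exists_primitive hcd (by
      rw [integral_sub hφi (hχi.const_mul m), integral_const_mul, hχ1]; simp [hm])
    have h1 := h θ hθ
    rw [hθd] at h1
    have e1 : ∫ x, φ x • (f x - C) = ∫ x in Ioo c d, φ x • (f x - C) := by
      rw [setIntegral_eq_integral_of_forall_compl_eq_zero]
      exact fun x hx => by simp [hφ.eq_zero hx]
    have i1 := hφ.mul_integrableOn hcd hf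
    have i2 := hχ.mul_integrableOn hcd hf
    rw [e1]
    have e2 : ∫ x in Ioo c d, φ x • (f x - C)
        = (∫ x in Ioo c d, f x * φ x) - C * m := by
      rw [hm, ← integral_const_mul, ← integral_sub i1 (hφi.const_mul C)]
      exact integral_congr_ae (Eventually.of_forall fun x => by simp only [smul_eq_mul]; ring)
    have e3 : ∫ x in Ioo c d, f x * (φ x - m * χ x)
        = (∫ x in Ioo c d, f x * φ x) - m * C := by
      rw [hC, ← integral_const_mul, ← integral_sub i1 (i2.const_mul m)]
      exact integral_congr_ae (Eventually.of_forall fun x => by ring)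
    rw [e2, mul_comm C m, ← e3, h1]

/-- A function with a weak derivative is a primitive of it. -/
theorem ae_eq_primitive {c d x₀ : ℝ} (hx₀ : x₀ ∈ Ioo c d) {f g : ℝ → ℝ}
    (hf : LocallyIntegrableOn f (Ioo c d)) (hg : LocallyIntegrableOn g (Ioo c d))
    (h : ∀ φ, IsTest (Ioo c d) φ →
      ∫ x in Ioo c d, f x * deriv φ x = - ∫ x in Ioo c d, g x * φ x) :
    ∃ C, ∀ᵐ x, x ∈ Ioo c d → f x = C + ∫ y in x₀..x, g y := by
  have hcd : c < d := hx₀.1.trans hx₀.2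
  have hcont : ContinuousOn (fun x => ∫ y in x₀..x, g y) (Ioo c d) := by
    intro x hx
    obtain ⟨l, hl, hl'⟩ := exists_between (lt_min hx.1 hx₀.1)
    obtain ⟨r, hr, hr'⟩ := exists_between (max_lt hx.2 hx₀.2)
    have hlx := hl'.trans_le (min_le_left _ _)
    have hlx0 := hl'.trans_le (min_le_right _ _)
    have hrx := (le_max_left _ _).trans_lt hr
    have hrx0 := (le_max_right _ _).trans_lt hr
    have hi : IntervalIntegrable g volume l r :=
      locallyIntegrableOn_intervalIntegrable hg ⟨hl, hlx.trans hx.2⟩ ⟨hx.1.trans hrx, hr'⟩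
    have := (hi.absolutelyContinuousOnInterval_intervalIntegral (c := x₀)
      (by rw [uIcc_of_le (hlx.trans hrx).le]; exact ⟨hlx0.le, hrx0.le⟩)).continuousOn
    rw [uIcc_of_le (hlx.trans hrx).le] at this
    exact (this.continuousAt (Icc_mem_nhds hlx hrx)).continuousWithinAt
  have hloc := hcont.locallyIntegrableOn (μ := volume) measurableSet_Ioo
  obtain ⟨C, hC⟩ := ae_eq_const_of_integral_mul_deriv_eq_zero hcd (hf.sub hloc) (fun φ hφ => by
    have i1 := hφ.derivative.mul_integrableOn hcd hf
    have i2 := hφ.derivative.mul_integrableOn hcd hloc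
    have := h φ hφ
    have h2 := integral_primitive_mul_deriv hx₀ hg hφ
    calc ∫ x in Ioo c d, (f - fun x => ∫ y in x₀..x, g y) x * deriv φ x
        = ∫ x in Ioo c d, (f x * deriv φ x
          - (∫ y in x₀..x, g y) * deriv φ x) := by
          simp only [Pi.sub_apply, sub_mul]
      _ = 0 := by rw [integral_sub i1 i2, this, h2, sub_self])
  refine ⟨C, ?_⟩
  filter_upwards [hC] with x hx hxI
  have := hx hxI
  simp only [Pi.sub_apply] at this
  linarith

end ThinFilm

namespace ThinFilm

/-! ### Regular profiles -/

/-- A non-negative `C¹` profile `w` on `[a, b]` with `w' = p`, `p = 0` at the walls, `p' = q` and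
`q' = z` (in the sense of primitives) on `{w > 0}`, and finite weighted norms of `q` and `z`. -/
structure Slice (a b : ℝ) (w p q z : ℝ → ℝ) : Prop where
  w_cont : ContinuousOn w (Icc a b)
  nonneg : ∀ x ∈ Icc a b, 0 ≤ w x
  w_deriv : ∀ x ∈ Ioo a b, HasDerivAt w (p x) x
  p_cont : ContinuousOn p (Icc a b)
  p_left : p a = 0
  p_right : p b = 0
  p_deriv : ∀ x ∈ posSet a b w, HasDerivAt p (q x) x
  q_cont : ContinuousOn q (posSet a b w)
  q_zero : ∀ x, x ∉ posSet a b w → q x = 0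
  z_zero : ∀ x, x ∉ posSet a b w → z x = 0
  z_meas : AEStronglyMeasurable z (volume.restrict (Ioo a b))
  z_int : ∀ c d, uIcc c d ⊆ posSet a b w → IntervalIntegrable z volume c d
  q_eq : ∀ c d, uIcc c d ⊆ posSet a b w → q d - q c = ∫ x in c..d, z x
  wq_int : IntegrableOn (fun x => w x * q x ^ 2) (Ioo a b)
  wz_int : IntegrableOn (fun x => w x ^ 3 * z x ^ 2) (Ioo a b)

theorem isOpen_posSet {a b : ℝ} {w : ℝ → ℝ} (hw : ContinuousOn w (Icc a b)) :
    IsOpen (posSet a b w) := by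
  have : posSet a b w = Ioo a b ∩ w ⁻¹' Ioi 0 := rfl
  rw [this]
  exact (hw.mono Ioo_subset_Icc_self).isOpen_inter_preimage isOpen_Ioo isOpen_Ioi

theorem ContinuousOn.integrableOn_Ioo {a b : ℝ} {F : ℝ → ℝ} (h : ContinuousOn F (Icc a b)) :
    IntegrableOn F (Ioo a b) :=
  (h.integrableOn_compact isCompact_Icc).mono_set Ioo_subset_Icc_self

theorem aestronglyMeasurable_of_continuousOn {a b : ℝ} {F : ℝ → ℝ}
    (h : ContinuousOn F (Icc a b)) : AEStronglyMeasurable F (volume.restrict (Ioo a b)) :=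
  (ContinuousOn.integrableOn_Ioo h).aestronglyMeasurable

/-- Product rule in integrated form for primitives of integrable functions. -/
theorem integral_primitive_mul_primitive {x y : ℝ} {A A' Q z : ℝ → ℝ}
    (hA' : IntervalIntegrable A' volume x y) (hz : IntervalIntegrable z volume x y)
    (hA : ∀ s ∈ uIcc x y, A s = A x + ∫ r in x..s, A' r)
    (hQ : ∀ s ∈ uIcc x y, Q s = Q x + ∫ r in x..s, z r) :
    ∫ s in x..y, (A' s * Q s + A s * z s) = A y * Q y - A x * Q x := by
  have hc : ∀ c : ℝ, AbsolutelyContinuousOnInterval (fun _ : ℝ => c) x y := fun c =>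
    (contDiff_const (n := 1)).contDiffOn.absolutelyContinuousOnInterval
  have h1 := (hc (A x)).add (hA'.absolutelyContinuousOnInterval_intervalIntegral left_mem_uIcc)
  have h2 := (hc (Q x)).add (hz.absolutelyContinuousOnInterval_intervalIntegral left_mem_uIcc)
  have := h1.integral_deriv_mul_eq_sub h2
  simp only [Pi.add_apply] at this
  rw [← hA y right_mem_uIcc, ← hQ y right_mem_uIcc, intervalIntegral.integral_same,
    intervalIntegral.integral_same, add_zero, add_zero] at this
  rw [← this]
  refine intervalIntegral.integral_congr_ae ?_
  filter_upwards [hA'.ae_hasDerivAt_integral, hz.ae_hasDerivAt_integral] with s hs1 hs2 hs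
  have hs' := uIoc_subset_uIcc hs
  have e1 : deriv ((fun _ : ℝ => A x) + fun s => ∫ r in x..s, A' r) s = A' s := by
    simpa using ((hasDerivAt_const s (A x)).add (hs1 hs' x left_mem_uIcc)).deriv
  have e2 : deriv ((fun _ : ℝ => Q x) + fun s => ∫ r in x..s, z r) s = z s := by
    simpa using ((hasDerivAt_const s (Q x)).add (hs2 hs' x left_mem_uIcc)).deriv
  rw [e1, e2, ← hA s hs', ← hQ s hs']

namespace Slice

variable {a b : ℝ} {w p q z : ℝ → ℝ}

theorem isOpen (S : Slice a b w p q z) : IsOpen (posSet a b w) := isOpen_posSet S.w_cont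

/-- An interior zero of a non-negative function is a minimum. This is why the contact line gives no
boundary term in `Slice.integral_h`, whatever the one-sided slopes of a limit of such profiles may
be. -/
theorem p_eq_zero (S : Slice a b w p q z) {x : ℝ} (hx : x ∈ Ioo a b) (h0 : w x = 0) : p x = 0 := by
  have hmin : IsLocalMin w x := by
    filter_upwards [Ioo_mem_nhds hx.1 hx.2] with y hy
    rw [h0]
    exact S.nonneg y (Ioo_subset_Icc_self hy)
  exact hmin.hasDerivAt_eq_zero (S.w_deriv x hx)

theorem pos_or_zero (S : Slice a b w p q z) {x : ℝ} (hx : x ∈ Ioo a b) :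
    x ∈ posSet a b w ∨ (w x = 0 ∧ p x = 0 ∧ q x = 0 ∧ z x = 0) := by
  rcases (S.nonneg x (Ioo_subset_Icc_self hx)).eq_or_lt with h | h
  · have hn : x ∉ posSet a b w := fun h' => absurd h'.2 (by simp [← h])
    exact Or.inr ⟨h.symm, S.p_eq_zero hx h.symm, S.q_zero x hn, S.z_zero x hn⟩
  · exact Or.inl ⟨hx, h⟩

theorem q_meas (S : Slice a b w p q z) : AEStronglyMeasurable q (volume.restrict (Ioo a b)) := by
  have h1 : AEStronglyMeasurable q (volume.restrict (posSet a b w)) :=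
    S.q_cont.aestronglyMeasurable S.isOpen.measurableSet
  have h2 := (aestronglyMeasurable_indicator_iff (μ := volume) S.isOpen.measurableSet).2 h1
  rw [indicator_eq_self.2 fun x hx => by_contra fun h => hx (S.q_zero x h)] at h2
  exact h2.restrict

theorem comp_cont (S : Slice a b w p q z) {h : ℝ → ℝ} (hh : Continuous h) :
    ContinuousOn (fun x => h (w x)) (Icc a b) := hh.comp_continuousOn S.w_cont

/-- Functions dominated by `w q²`, `w³ z²` and a constant are integrable. -/
theorem integrableOn_of_le (S : Slice a b w p q z) {F : ℝ → ℝ} {C : ℝ}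
    (hF : AEStronglyMeasurable F (volume.restrict (Ioo a b)))
    (h : ∀ x ∈ Ioo a b, |F x| ≤ C * (1 + w x * q x ^ 2 + w x ^ 3 * z x ^ 2)) :
    IntegrableOn F (Ioo a b) := by
  have h1 : IntegrableOn (fun x => C * (1 + w x * q x ^ 2 + w x ^ 3 * z x ^ 2)) (Ioo a b) :=
    (((integrableOn_const (by simp)).add S.wq_int).add S.wz_int).const_mul C
  refine Integrable.mono' h1 hF ?_
  exact (ae_restrict_mem measurableSet_Ioo).mono fun x hx => h x hx

/-- `q` alone need not be integrable near `{w = 0}`; the factor `|h(w)| ≤ w` lets `w |q| ≤ w + w q²`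
do the job. -/
theorem integrableOn_mul_q (S : Slice a b w p q z) {h G : ℝ → ℝ} (hh : Continuous h)
    (hle : ∀ s, 0 ≤ s → |h s| ≤ s) (hG : ContinuousOn G (Icc a b)) :
    IntegrableOn (fun x => h (w x) * q x * G x) (Ioo a b) := by
  obtain ⟨C, hC⟩ := isCompact_Icc.exists_bound_of_continuousOn hG
  obtain ⟨M, hM⟩ := isCompact_Icc.exists_bound_of_continuousOn S.w_cont
  refine S.integrableOn_of_le (C := |C| * (1 + |M|))
    (((aestronglyMeasurable_of_continuousOn (S.comp_cont hh)).mul S.q_meas).mul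
      (aestronglyMeasurable_of_continuousOn hG)) fun x hx => ?_
  have hx' := Ioo_subset_Icc_self hx
  have hw := S.nonneg x hx'
  have h1 : |G x| ≤ |C| := (hC x hx').trans (le_abs_self _)
  have h2 : w x ≤ |M| := (le_abs_self _).trans ((hM x hx').trans (le_abs_self _))
  have h3 := hle (w x) hw
  have h4 : |h (w x)| * |q x| ≤ w x + w x * q x ^ 2 := by
    have : |q x| ≤ 1 + q x ^ 2 := by nlinarith [sq_abs (q x), sq_nonneg (|q x| - 1)]
    calc |h (w x)| * |q x| ≤ w x * (1 + q x ^ 2) := by gcongr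
      _ = _ := by ring
  have h5 : 0 ≤ w x ^ 3 * z x ^ 2 := by positivity
  have h6 : 0 ≤ w x * q x ^ 2 := by positivity
  rw [abs_mul, abs_mul]
  calc |h (w x)| * |q x| * |G x| ≤ (w x + w x * q x ^ 2) * |C| := by gcongr
    _ ≤ ((1 + |M|) * (1 + w x * q x ^ 2 + w x ^ 3 * z x ^ 2)) * |C| := by
        gcongr
        nlinarith [abs_nonneg M]
    _ = _ := by ring

theorem integrableOn_mul_q_sq (S : Slice a b w p q z) {h G : ℝ → ℝ} (hh : Continuous h)
    (hle : ∀ s, 0 ≤ s → |h s| ≤ s) (hG : ContinuousOn G (Icc a b)) :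
    IntegrableOn (fun x => h (w x) * q x ^ 2 * G x) (Ioo a b) := by
  obtain ⟨C, hC⟩ := isCompact_Icc.exists_bound_of_continuousOn hG
  refine S.integrableOn_of_le (C := |C|)
    (((aestronglyMeasurable_of_continuousOn (S.comp_cont hh)).mul (S.q_meas.pow 2)).mul
      (aestronglyMeasurable_of_continuousOn hG)) fun x hx => ?_
  have hx' := Ioo_subset_Icc_self hx
  have hw := S.nonneg x hx'
  have h1 : |G x| ≤ |C| := (hC x hx').trans (le_abs_self _)
  have h3 := hle (w x) hw
  have h5 : 0 ≤ w x ^ 3 * z x ^ 2 := by positivity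
  rw [abs_mul, abs_mul, abs_of_nonneg (sq_nonneg (q x))]
  calc |h (w x)| * q x ^ 2 * |G x| ≤ w x * q x ^ 2 * |C| := by gcongr
    _ ≤ (1 + w x * q x ^ 2 + w x ^ 3 * z x ^ 2) * |C| := by gcongr; linarith
    _ = _ := by ring

/-- Only `w³ z²` is integrable, so the cutoff below height `e` is needed: on `{w > e}` one has `w²
z² ≤ e⁻¹ w³ z²`. -/
theorem integrableOn_mul_z (S : Slice a b w p q z) {k G : ℝ → ℝ} {e : ℝ} (he : 0 < e)
    (hk : Continuous k) (hle : ∀ s, 0 ≤ s → |k s| ≤ s) (hk0 : ∀ s ≤ e, k s = 0)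
    (hG : ContinuousOn G (Icc a b)) :
    IntegrableOn (fun x => k (w x) * z x * G x) (Ioo a b) := by
  obtain ⟨C, hC⟩ := isCompact_Icc.exists_bound_of_continuousOn hG
  refine S.integrableOn_of_le (C := |C| * (1 + e⁻¹))
    (((aestronglyMeasurable_of_continuousOn (S.comp_cont hk)).mul S.z_meas).mul
      (aestronglyMeasurable_of_continuousOn hG)) fun x hx => ?_
  have hx' := Ioo_subset_Icc_self hx
  have hw := S.nonneg x hx'
  have h1 : |G x| ≤ |C| := (hC x hx').trans (le_abs_self _)
  have h3 := hle (w x) hw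
  have h5 : 0 ≤ w x ^ 3 * z x ^ 2 := by positivity
  have h6 : 0 ≤ w x * q x ^ 2 := by positivity
  have h7 : 0 < e⁻¹ := inv_pos.2 he
  have h8 : |k (w x)| * |z x| ≤ 1 + e⁻¹ * (w x ^ 3 * z x ^ 2) := by
    rcases le_or_gt (w x) e with hwe | hwe
    · rw [hk0 _ hwe]
      simp only [abs_zero, zero_mul]
      positivity
    · have e1 : |k (w x)| * |z x| ≤ w x * |z x| := by gcongr
      have e2 : w x * |z x| ≤ 1 + (w x * |z x|) ^ 2 := by nlinarith [sq_nonneg (w x * |z x| - 1)]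
      have e3 : (w x * |z x|) ^ 2 ≤ e⁻¹ * (w x ^ 3 * z x ^ 2) := by
        rw [mul_pow, sq_abs, inv_mul_eq_div, le_div_iff₀ he]
        have : 0 ≤ w x ^ 2 * z x ^ 2 := by positivity
        nlinarith
      linarith
  rw [abs_mul, abs_mul]
  calc |k (w x)| * |z x| * |G x| ≤ (1 + e⁻¹ * (w x ^ 3 * z x ^ 2)) * |C| := by gcongr
    _ ≤ ((1 + e⁻¹) * (1 + w x * q x ^ 2 + w x ^ 3 * z x ^ 2)) * |C| := by
        gcongr
        nlinarith
    _ = _ := by ring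

/-- Integration by parts of `h(w) p³ φ`, with no boundary contribution from `∂{w > 0}`. -/
theorem integral_h (S : Slice a b w p q z) (hab : a < b) {φ h h' : ℝ → ℝ}
    (hφ : IsTest (Ioo a b) φ) (hh : ∀ s, HasDerivAt h (h' s) s) (hh' : Continuous h')
    (h0 : h 0 = 0) (hle : ∀ s, 0 ≤ s → |h s| ≤ s) :
    (∫ x in Ioo a b, h' (w x) * p x ^ 4 * φ x) + 3 * (∫ x in Ioo a b, h (w x) * q x * (p x ^ 2 * φ x))
      + (∫ x in Ioo a b, h (w x) * p x ^ 3 * deriv φ x) = 0 := by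
  have hhc : Continuous h := continuous_iff_continuousAt.2 fun s => (hh s).continuousAt
  have hφc := hφ.continuous.continuousOn (s := Icc a b)
  have hφd := hφ.derivative.continuous.continuousOn (s := Icc a b)
  have i1 : IntegrableOn (fun x => h' (w x) * p x ^ 4 * φ x) (Ioo a b) :=
    ContinuousOn.integrableOn_Ioo (((S.comp_cont hh').mul (S.p_cont.pow 4)).mul hφc)
  have i2 : IntegrableOn (fun x => h (w x) * q x * (p x ^ 2 * φ x)) (Ioo a b) :=
    S.integrableOn_mul_q hhc hle ((S.p_cont.pow 2).mul hφc)
  have i3 : IntegrableOn (fun x => h (w x) * p x ^ 3 * deriv φ x) (Ioo a b) :=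
    ContinuousOn.integrableOn_Ioo (((S.comp_cont hhc).mul (S.p_cont.pow 3)).mul hφd)
  have hder : ∀ x ∈ Ioo a b, HasDerivAt (fun x => h (w x) * (p x ^ 3 * φ x))
      (h' (w x) * p x ^ 4 * φ x + 3 * (h (w x) * q x * (p x ^ 2 * φ x))
        + h (w x) * p x ^ 3 * deriv φ x) x := by
    intro x hx
    have hw := S.w_deriv x hx
    have hhw : HasDerivAt (fun y => h (w y)) (h' (w x) * p x) x := (hh (w x)).comp x hw
    rcases S.pos_or_zero hx with hpos | ⟨hw0, hp0, hq0, -⟩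
    · have := hhw.mul (((S.p_deriv x hpos).pow 3).mul (hφ.differentiable x).hasDerivAt)
      exact this.congr_deriv (by simp only [Pi.mul_apply, Pi.pow_apply]; push_cast; ring)
    -- At a zero of `w` the function `p` need not be differentiable. But `h ∘ w` has value and
    -- derivative zero there, and `p³ φ` is bounded, so the product still has derivative zero. The
    -- antiderivative is thus differentiable everywhere, with integrable derivative.
    · have hz : h (w x) = 0 := by rw [hw0, h0]
      rw [hp0, mul_zero] at hhw
      have hbd : (fun y => p y ^ 3 * φ y) =O[𝓝 x] fun _ => (1 : ℝ) := by
        have : ContinuousAt (fun y => p y ^ 3 * φ y) x :=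
          ((S.p_cont.continuousAt (Icc_mem_nhds hx.1 hx.2)).pow 3).mul hφ.continuous.continuousAt
        exact this.tendsto.isBigO_one ℝ
      have hlit := hasDerivAt_iff_isLittleO.1 hhw
      simp only [hz, smul_zero, sub_zero] at hlit
      have := hlit.mul_isBigO hbd
      rw [hasDerivAt_iff_isLittleO]
      simpa [hz, hp0] using this
  have key := intervalIntegral.integral_eq_sub_of_hasDerivAt_of_le hab.le
    ((S.comp_cont hhc).mul ((S.p_cont.pow 3).mul hφc)) hder
    ((intervalIntegrable_iff_integrableOn_Ioo_of_le hab.le).2 ((i1.add (i2.const_mul 3)).add i3))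
  simp only [Pi.mul_apply] at key
  rw [hφ.eq_zero (x := a) (by simp), hφ.eq_zero (x := b) (by simp),
    intervalIntegral.integral_of_le hab.le, integral_Ioc_eq_integral_Ioo] at key
  have e1 := integral_add (i1.add (i2.const_mul 3)) i3
  have e2 := integral_add i1 (i2.const_mul 3)
  simp only [Pi.add_apply] at e1 e2
  rw [e1, e2, integral_const_mul] at key
  simpa using key

/-- Integration by parts away from the zero set of `w`, up to the third derivative. -/
theorem integral_k (S : Slice a b w p q z) (hab : a < b) {φ k k' k'' : ℝ → ℝ} {e : ℝ} (he : 0 < e)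
    (hφ : IsTest (Ioo a b) φ) (hk : ∀ s, HasDerivAt k (k' s) s)
    (hk' : ∀ s, HasDerivAt k' (k'' s) s) (hk'' : Continuous k'')
    (hle : ∀ s, 0 ≤ s → |k s| ≤ s) (hk0 : ∀ s ≤ e, k s = 0) :
    (∫ x in Ioo a b, k (w x) * q x ^ 2 * φ x) + (∫ x in Ioo a b, k (w x) * z x * (p x * φ x))
      - 1 / 3 * (∫ x in Ioo a b, k'' (w x) * p x ^ 4 * φ x)
      - 5 / 6 * (∫ x in Ioo a b, k' (w x) * p x ^ 3 * deriv φ x)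
      - 1 / 2 * (∫ x in Ioo a b, k (w x) * p x ^ 2 * deriv (deriv φ) x) = 0 := by
  have hkc : Continuous k := continuous_iff_continuousAt.2 fun s => (hk s).continuousAt
  have hkc' : Continuous k' := continuous_iff_continuousAt.2 fun s => (hk' s).continuousAt
  have hφc := hφ.continuous.continuousOn (s := Icc a b)
  have hφd := hφ.derivative.continuous.continuousOn (s := Icc a b)
  have hφdd := hφ.derivative.derivative.continuous.continuousOn (s := Icc a b)
  have i1 : IntegrableOn (fun x => k (w x) * q x ^ 2 * φ x) (Ioo a b) :=
    S.integrableOn_mul_q_sq hkc hle hφc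
  have i2 : IntegrableOn (fun x => k (w x) * z x * (p x * φ x)) (Ioo a b) :=
    S.integrableOn_mul_z he hkc hle hk0 (S.p_cont.mul hφc)
  have i3 : IntegrableOn (fun x => k'' (w x) * p x ^ 4 * φ x) (Ioo a b) :=
    ContinuousOn.integrableOn_Ioo (((S.comp_cont hk'').mul (S.p_cont.pow 4)).mul hφc)
  have i4 : IntegrableOn (fun x => k' (w x) * p x ^ 3 * deriv φ x) (Ioo a b) :=
    ContinuousOn.integrableOn_Ioo (((S.comp_cont hkc').mul (S.p_cont.pow 3)).mul hφd)
  have i5 : IntegrableOn (fun x => k (w x) * p x ^ 2 * deriv (deriv φ) x) (Ioo a b) :=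
    ContinuousOn.integrableOn_Ioo (((S.comp_cont hkc).mul (S.p_cont.pow 2)).mul hφdd)
  have hk0' : ∀ s < e, k' s = 0 := fun s hs => by
    have h1 : HasDerivAt k 0 s := (hasDerivAt_const s (0 : ℝ)).congr_of_eventuallyEq
      (by filter_upwards [Iio_mem_nhds hs] with r hr using hk0 r (le_of_lt hr))
    exact (hk s).unique h1
  have hk0'' : ∀ s < e, k'' s = 0 := fun s hs => by
    have h1 : HasDerivAt k' 0 s := (hasDerivAt_const s (0 : ℝ)).congr_of_eventuallyEq
      (by filter_upwards [Iio_mem_nhds hs] with r hr using hk0' r hr)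
    exact (hk' s).unique h1
  set g : ℝ → ℝ := fun x => k (w x) * q x ^ 2 * φ x + k (w x) * z x * (p x * φ x)
      - 1 / 3 * (k'' (w x) * p x ^ 4 * φ x) - 5 / 6 * (k' (w x) * p x ^ 3 * deriv φ x)
      - 1 / 2 * (k (w x) * p x ^ 2 * deriv (deriv φ) x) with hg
  -- Formally `F' = g`. The coefficient `5/6` of `k' p³ φ'` is `1/3 + 1/2`, one share from each of
  -- the last two terms of `F`.
  set F : ℝ → ℝ := fun x => k (w x) * (p x * φ x) * q x - 1 / 3 * (p x ^ 3 * (k' (w x) * φ x))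
      - 1 / 2 * (p x ^ 2 * (k (w x) * deriv φ x)) with hF
  have hgi : IntegrableOn g (Ioo a b) :=
    (((i1.add i2).sub (i3.const_mul _)).sub (i4.const_mul _)).sub (i5.const_mul _)
  have hsum : ∫ x in Ioo a b, g x =
      (∫ x in Ioo a b, k (w x) * q x ^ 2 * φ x) + (∫ x in Ioo a b, k (w x) * z x * (p x * φ x))
      - 1 / 3 * (∫ x in Ioo a b, k'' (w x) * p x ^ 4 * φ x)
      - 5 / 6 * (∫ x in Ioo a b, k' (w x) * p x ^ 3 * deriv φ x)
      - 1 / 2 * (∫ x in Ioo a b, k (w x) * p x ^ 2 * deriv (deriv φ) x) := by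
    have e1 := integral_add i1 i2
    have e2 := integral_sub (i1.add i2) (i3.const_mul (1 / 3))
    have e3 := integral_sub ((i1.add i2).sub (i3.const_mul (1 / 3))) (i4.const_mul (5 / 6))
    have e4 := integral_sub (((i1.add i2).sub (i3.const_mul (1 / 3))).sub (i4.const_mul (5 / 6)))
      (i5.const_mul (1 / 2))
    simp only [Pi.add_apply, Pi.sub_apply, integral_const_mul] at e1 e2 e3 e4
    rw [hg, e4, e3, e2, e1]
  rw [← hsum]
  -- local identity
  have hloc : ∀ x ∈ Ioo a b, ∀ᶠ y in 𝓝 x, ∫ s in x..y, g s = F y - F x := by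
    intro x hx
    rcases lt_or_ge (w x) e with hlt | hge
    -- Below height `e` the function `k` and its derivatives vanish, so both sides are zero near
    -- `x`.
    · have hev : ∀ᶠ y in 𝓝 x, y ∈ Ioo a b ∧ w y < e :=
        (eventually_mem_set.2 (Ioo_mem_nhds hx.1 hx.2)).and
          ((S.w_cont.continuousAt (Icc_mem_nhds hx.1 hx.2)).eventually (gt_mem_nhds hlt))
      obtain ⟨r, hr, hball⟩ := Metric.eventually_nhds_iff_ball.1 hev
      filter_upwards [Metric.ball_mem_nhds x hr] with y hy
      have hsub : uIcc x y ⊆ Metric.ball x r := by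
        rw [Real.ball_eq_Ioo] at hy ⊢
        exact ordConnected_Ioo.uIcc_subset ⟨by linarith, by linarith⟩ hy
      have hF0 : ∀ s ∈ Metric.ball x r, F s = 0 := fun s hs => by
        have := (hball s hs).2
        simp only [hF, hk0 _ this.le, hk0' _ this]
        ring
      rw [hF0 y hy, hF0 x (Metric.mem_ball_self hr), sub_zero]
      rw [intervalIntegral.integral_congr (g := fun _ => 0), intervalIntegral.integral_zero]
      intro s hs
      have := (hball s (hsub hs)).2
      simp only [hg, hk0 _ this.le, hk0' _ this, hk0'' _ this]
      ring
    · have hxp : x ∈ posSet a b w := ⟨hx, he.trans_le hge⟩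
      obtain ⟨r, hr, hball⟩ := Metric.isOpen_iff.1 S.isOpen x hxp
      filter_upwards [Metric.ball_mem_nhds x hr] with y hy
      have hsub : uIcc x y ⊆ Metric.ball x r := by
        rw [Real.ball_eq_Ioo] at hy ⊢
        exact ordConnected_Ioo.uIcc_subset ⟨by linarith, by linarith⟩ hy
      have hpos : uIcc x y ⊆ posSet a b w := hsub.trans hball
      have hIcc : uIcc x y ⊆ Icc a b := fun s hs => Ioo_subset_Icc_self (hpos hs).1
      have cw := S.w_cont.mono hIcc
      have cp := S.p_cont.mono hIcc
      have cq := S.q_cont.mono hpos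
      have ck := hkc.comp_continuousOn cw
      have ck' := hkc'.comp_continuousOn cw
      have ck'' := hk''.comp_continuousOn cw
      have cφ := hφ.continuous.continuousOn (s := uIcc x y)
      have cφ' := hφ.derivative.continuous.continuousOn (s := uIcc x y)
      have cφ'' := hφ.derivative.derivative.continuous.continuousOn (s := uIcc x y)
      -- `q` is only a primitive of the integrable function `z`, so the product `A q` is handled by
      -- `integral_primitive_mul_primitive`; the remaining part `B` of `F` has a classical
      -- derivative.
      set A : ℝ → ℝ := fun s => k (w s) * (p s * φ s) with hA
      set A' : ℝ → ℝ := fun s => k' (w s) * p s * (p s * φ s) +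
        k (w s) * (q s * φ s + p s * deriv φ s) with hA'
      set B : ℝ → ℝ := fun s => 1 / 3 * (p s ^ 3 * (k' (w s) * φ s)) +
        1 / 2 * (p s ^ 2 * (k (w s) * deriv φ s)) with hB
      set B' : ℝ → ℝ := fun s => 1 / 3 * (3 * p s ^ 2 * q s * (k' (w s) * φ s) + p s ^ 3 *
        (k'' (w s) * p s * φ s + k' (w s) * deriv φ s)) + 1 / 2 * (2 * p s * q s *
        (k (w s) * deriv φ s) + p s ^ 2 * (k' (w s) * p s * deriv φ s +
          k (w s) * deriv (deriv φ) s)) with hB'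
      have hdk : ∀ s ∈ uIcc x y, HasDerivAt (fun s => k (w s)) (k' (w s) * p s) s := fun s hs =>
        (hk (w s)).comp s (S.w_deriv s (hpos hs).1)
      have hdk' : ∀ s ∈ uIcc x y, HasDerivAt (fun s => k' (w s)) (k'' (w s) * p s) s :=
        fun s hs => (hk' (w s)).comp s (S.w_deriv s (hpos hs).1)
      have hdφ : ∀ s, HasDerivAt φ (deriv φ s) s := fun s => (hφ.differentiable s).hasDerivAt
      have hdφ' : ∀ s, HasDerivAt (deriv φ) (deriv (deriv φ) s) s := fun s =>
        (hφ.derivative.differentiable s).hasDerivAt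
      have hdA : ∀ s ∈ uIcc x y, HasDerivAt A (A' s) s := fun s hs =>
        (hdk s hs).mul ((S.p_deriv s (hpos hs)).mul (hdφ s))
      have hdB : ∀ s ∈ uIcc x y, HasDerivAt B (B' s) s := fun s hs => by
        have hp := S.p_deriv s (hpos hs)
        exact (((((hp.pow 3).mul ((hdk' s hs).mul (hdφ s))).const_mul (1 / 3)).add
          (((hp.pow 2).mul ((hdk s hs).mul (hdφ' s))).const_mul (1 / 2)))).congr_deriv (by
            simp only [hB', Pi.mul_apply, Pi.pow_apply]; push_cast; ring)
      have cA' : ContinuousOn A' (uIcc x y) :=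
        ((ck'.mul cp).mul (cp.mul cφ)).add (ck.mul ((cq.mul cφ).add (cp.mul cφ')))
      have cB' : ContinuousOn B' (uIcc x y) := by
        refine (continuousOn_const.mul ((((continuousOn_const.mul (cp.pow 2)).mul cq).mul
          (ck'.mul cφ)).add ((cp.pow 3).mul (((ck''.mul cp).mul cφ).add (ck'.mul cφ'))))).add
          (continuousOn_const.mul ((((continuousOn_const.mul cp).mul cq).mul (ck.mul cφ')).add
          ((cp.pow 2).mul (((ck'.mul cp).mul cφ').add (ck.mul cφ'')))))
      have hz := S.z_int x y hpos
      have hAprim : ∀ s ∈ uIcc x y, A s = A x + ∫ r in x..s, A' r := fun s hs => by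
        have hss : uIcc x s ⊆ uIcc x y := uIcc_subset_uIcc left_mem_uIcc hs
        rw [intervalIntegral.integral_eq_sub_of_hasDerivAt (fun r hr => hdA r (hss hr))
          (cA'.mono hss).intervalIntegrable]
        ring
      have hQprim : ∀ s ∈ uIcc x y, q s = q x + ∫ r in x..s, z r := fun s hs => by
        have hss : uIcc x s ⊆ uIcc x y := uIcc_subset_uIcc left_mem_uIcc hs
        rw [← S.q_eq x s (hss.trans hpos)]
        ring
      have h1 := integral_primitive_mul_primitive cA'.intervalIntegrable hz hAprim hQprim
      have h2 := intervalIntegral.integral_eq_sub_of_hasDerivAt hdB cB'.intervalIntegrable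
      have cA : ContinuousOn A (uIcc x y) := fun s hs => (hdA s hs).continuousAt.continuousWithinAt
      have h3 := intervalIntegral.integral_sub
        (((cA'.mul cq).intervalIntegrable).add (hz.continuousOn_mul cA)) cB'.intervalIntegrable
      simp only [Pi.mul_apply] at h3
      rw [h1, h2] at h3
      have h4 : F y - F x = A y * q y - A x * q x - (B y - B x) := by
        simp only [hF, hA, hB]; ring
      rw [h4, ← h3]
      refine intervalIntegral.integral_congr fun s _ => ?_
      simp only [hg, hA, hA', hB']
      ring
  -- globalisation
  obtain ⟨l, r, hal, hlr, hrb, hz0⟩ := hφ.exists_Icc hab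
  obtain ⟨l', hal', hl'⟩ := exists_between hal
  obtain ⟨r', hr', hrb'⟩ := exists_between hrb
  have hφ0 : ∀ x, x ∉ Icc l r → φ x = 0 ∧ deriv φ x = 0 ∧ deriv (deriv φ) x = 0 := by
    have h1 : ∀ f : ℝ → ℝ, (∀ x, x ∉ Icc l r → f x = 0) → ∀ x, x ∉ Icc l r → deriv f x = 0 := by
      intro f hf x hx
      have : f =ᶠ[𝓝 x] fun _ => 0 := by
        filter_upwards [isClosed_Icc.isOpen_compl.mem_nhds hx] with y hy using hf y hy
      rw [this.deriv_eq, deriv_const]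
    have h0 : ∀ x, x ∉ Icc l r → φ x = 0 := fun x hx => hz0 x fun h => hx (Ioo_subset_Icc_self h)
    exact fun x hx => ⟨h0 x hx, h1 _ h0 x hx, h1 _ (h1 _ h0) x hx⟩
  have hlr' : l' < r' := hl'.trans (hlr.trans hr')
  rw [setIntegral_eq_intervalIntegral_of_eq_zero hal' hlr' hrb' fun x hx => by
    obtain ⟨h1, h2, h3⟩ := hφ0 x fun h => hx ⟨hl'.trans_le h.1, h.2.trans_lt hr'⟩
    simp only [hg, h1, h2, h3]; ring]
  have hsub : Icc l' r' ⊆ Ioo a b := Icc_subset_Ioo hal' hrb'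
  have hgl : ∀ x ∈ Icc l' r', IntervalIntegrable g volume l' x := fun x hx =>
    (hgi.mono_set (by
      rw [uIcc_of_le hx.1]
      exact (Icc_subset_Icc_right hx.2).trans hsub)).intervalIntegrable
  -- The local identities say that `∫ g - F` is locally constant. Passing through a zero derivative
  -- requires no uniform size of the neighbourhoods, so infinitely many components of `{w > 0}` are
  -- harmless.
  have hder : ∀ x ∈ Icc l' r', HasDerivAt (fun x => (∫ s in l'..x, g s) - F x) 0 x := by
    intro x hx
    have hxI := hsub hx
    refine (hasDerivAt_const x ((∫ s in l'..x, g s) - F x)).congr_of_eventuallyEq ?_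
    filter_upwards [hloc x hxI, Ioo_mem_nhds hxI.1 hxI.2] with y hy hyI
    have hxy : IntervalIntegrable g volume x y :=
      (hgi.mono_set (ordConnected_Ioo.uIcc_subset hxI hyI)).intervalIntegrable
    rw [← intervalIntegral.integral_add_adjacent_intervals (hgl x hx) hxy, hy]
    ring
  have hconst := constant_of_has_deriv_right_zero
    (f := fun x => (∫ s in l'..x, g s) - F x) (a := l') (b := r')
    (fun x hx => (hder x hx).continuousAt.continuousWithinAt)
    (fun x hx => (hder x (Ico_subset_Icc_self hx)).hasDerivWithinAt) r' (right_mem_Icc.2 hlr'.le)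
  have hFl : F l' = 0 := by
    obtain ⟨h1, h2, -⟩ := hφ0 l' fun h => absurd h.1 (not_le.2 hl')
    simp only [hF, h1, h2]; ring
  have hFr : F r' = 0 := by
    obtain ⟨h1, h2, -⟩ := hφ0 r' fun h => absurd h.2 (not_le.2 hr')
    simp only [hF, h1, h2]; ring
  simpa [hFl, hFr] using hconst

end Slice
end ThinFilm

namespace ThinFilm

/-! ### A smooth concave truncation -/

/-- The derivative of `cap δ`. -/
noncomputable def dcap (δ s : ℝ) : ℝ := Real.smoothTransition (2 - 2 * s / δ)

/-- A smooth concave function, equal to `s` for `s ≤ δ / 2` and constant for `s ≥ δ`. -/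
noncomputable def cap (δ s : ℝ) : ℝ := ∫ r in (0 : ℝ)..s, dcap δ r

theorem dcap_contDiff (δ : ℝ) : ContDiff ℝ ∞ (dcap δ) :=
  Real.smoothTransition.contDiff.comp (by fun_prop)

theorem dcap_continuous (δ : ℝ) : Continuous (dcap δ) := (dcap_contDiff δ).continuous

theorem hasDerivAt_cap (δ s : ℝ) : HasDerivAt (cap δ) (dcap δ s) s :=
  intervalIntegral.integral_hasDerivAt_right ((dcap_continuous δ).intervalIntegrable _ _)
    (dcap_continuous δ).stronglyMeasurable.stronglyMeasurableAtFilter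
    (dcap_continuous δ).continuousAt

theorem hasDerivAt_dcap (δ s : ℝ) : HasDerivAt (dcap δ) (deriv (dcap δ) s) s :=
  ((dcap_contDiff δ).differentiable (by simp) s).hasDerivAt

theorem continuous_deriv_dcap (δ : ℝ) : Continuous (deriv (dcap δ)) :=
  (dcap_contDiff δ).continuous_deriv (by simp)

theorem cap_continuous (δ : ℝ) : Continuous (cap δ) :=
  continuous_iff_continuousAt.2 fun s => (hasDerivAt_cap δ s).continuousAt

theorem dcap_nonneg (δ s : ℝ) : 0 ≤ dcap δ s := Real.smoothTransition.nonneg _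

theorem dcap_le_one (δ s : ℝ) : dcap δ s ≤ 1 := Real.smoothTransition.le_one _

theorem dcap_eq_one {δ s : ℝ} (hδ : 0 < δ) (hs : s ≤ δ / 2) : dcap δ s = 1 :=
  Real.smoothTransition.one_of_one_le (by
    have : 2 * s / δ ≤ 1 := by rw [div_le_one hδ]; linarith
    linarith)

theorem dcap_eq_zero {δ s : ℝ} (hδ : 0 < δ) (hs : δ ≤ s) : dcap δ s = 0 :=
  Real.smoothTransition.zero_of_nonpos (by
    have : 2 ≤ 2 * s / δ := by rw [le_div_iff₀ hδ]; linarith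
    linarith)

/-- Concavity of `cap δ` gives the quartic term in `Slice.production_eq` its favourable sign. -/
theorem deriv_dcap_nonpos {δ : ℝ} (hδ : 0 < δ) (s : ℝ) : deriv (dcap δ) s ≤ 0 := by
  have : Antitone (dcap δ) := fun x y hxy => Real.smoothTransition.monotone (by gcongr)
  exact this.deriv_nonpos

theorem cap_zero (δ : ℝ) : cap δ 0 = 0 := intervalIntegral.integral_same

theorem cap_eq_self {δ s : ℝ} (hδ : 0 < δ) (hs : s ≤ δ / 2) : cap δ s = s := by
  rw [cap, intervalIntegral.integral_congr (g := fun _ => 1)]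
  · simp
  · intro r hr
    rcases le_total 0 s with h | h
    · rw [uIcc_of_le h] at hr
      exact dcap_eq_one hδ (hr.2.trans hs)
    · rw [uIcc_of_ge h] at hr
      exact dcap_eq_one hδ (hr.2.trans (by positivity))

theorem cap_nonneg (δ : ℝ) {s : ℝ} (hs : 0 ≤ s) : 0 ≤ cap δ s :=
  intervalIntegral.integral_nonneg hs fun r _ => dcap_nonneg δ r

theorem cap_le_self (δ : ℝ) {s : ℝ} (hs : 0 ≤ s) : cap δ s ≤ s := by
  have := intervalIntegral.integral_mono_on hs ((dcap_continuous δ).intervalIntegrable _ _)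
    (continuous_const.intervalIntegrable (μ := volume) _ _) fun r _ => dcap_le_one δ r
  simpa [cap] using this

theorem cap_le {δ s : ℝ} (hδ : 0 < δ) (hs : 0 ≤ s) : cap δ s ≤ δ := by
  rcases le_total s δ with h | h
  · exact (cap_le_self δ hs).trans h
  · have h1 : cap δ s = cap δ δ := by
      have h2 : ∫ r in δ..s, dcap δ r = 0 := by
        rw [intervalIntegral.integral_congr (g := fun _ => 0), intervalIntegral.integral_zero]
        intro r hr
        rw [uIcc_of_le h] at hr
        exact dcap_eq_zero hδ hr.1
      rw [cap, cap, ← intervalIntegral.integral_add_adjacent_intervals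
        ((dcap_continuous δ).intervalIntegrable 0 δ) ((dcap_continuous δ).intervalIntegrable δ s),
        h2, add_zero]
    rw [h1]
    exact cap_le_self δ hδ.le

/-! ### The entropy production of a regular profile -/

/-- The distribution `T` of a profile, tested with `φ`. -/
noncomputable def production (a b : ℝ) (w p q φ : ℝ → ℝ) : ℝ :=
  (∫ x in Ioo a b, w x * q x ^ 2 * φ x) - 5 / 6 * (∫ x in Ioo a b, p x ^ 3 * deriv φ x)
    - 1 / 2 * (∫ x in Ioo a b, w x * p x ^ 2 * deriv (deriv φ) x)

/-- Non-negative test functions with `|φ'| ≲ φ^{3/4}`. -/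
structure Weight (a b K : ℝ) (φ : ℝ → ℝ) : Prop where
  test : IsTest (Ioo a b) φ
  one_le : 1 ≤ K
  nonneg : ∀ x, 0 ≤ φ x
  le : ∀ x, φ x ≤ K
  deriv2_le : ∀ x, |deriv (deriv φ) x| ≤ K
  young : ∀ μ, 0 < μ → ∀ x y, |y| ^ 3 * |deriv φ x| ≤ K * (μ * y ^ 2 + y ^ 4 * φ x / μ)

theorem IsTest.exists_bound {U : Set ℝ} {φ : ℝ → ℝ} (h : IsTest U φ) : ∃ C, ∀ x, |φ x| ≤ C :=
  h.compact.exists_bound_of_continuous h.continuous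

/-- Fourth powers of test functions are weights. -/
theorem IsTest.exists_weight {a b : ℝ} {ψ : ℝ → ℝ} (h : IsTest (Ioo a b) ψ) :
    ∃ K, Weight a b K (fun x => ψ x ^ 4) := by
  have ht : IsTest (Ioo a b) (fun x => ψ x ^ 4) := by
    have := h.mul (h.smooth.pow 3)
    simpa [← pow_succ'] using this
  obtain ⟨c, hc⟩ := h.exists_bound
  obtain ⟨c', hc'⟩ := h.derivative.exists_bound
  obtain ⟨C0, hC0⟩ := ht.exists_bound
  obtain ⟨C2, hC2⟩ := ht.derivative.derivative.exists_bound
  have hcn : 0 ≤ c := (abs_nonneg _).trans (hc 0)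
  have hcn' : 0 ≤ c' := (abs_nonneg _).trans (hc' 0)
  have hd : ∀ x, deriv (fun x => ψ x ^ 4) x = 4 * ψ x ^ 3 * deriv ψ x := fun x => by
    simpa using ((h.differentiable x).hasDerivAt.fun_pow 4).deriv
  refine ⟨max 1 (max C0 (max C2 (2 * c' * (1 + c ^ 2)))), ht, le_max_left _ _,
    fun x => by positivity, ?_, ?_, ?_⟩
  · exact fun x => ((le_abs_self _).trans (hC0 x)).trans
      ((le_max_left _ _).trans (le_max_right _ _))
  · exact fun x => (hC2 x).trans
      ((le_max_left _ _).trans ((le_max_right _ _).trans (le_max_right _ _)))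
  · intro μ hμ x y
    have hK : 2 * c' * (1 + c ^ 2) ≤ max 1 (max C0 (max C2 (2 * c' * (1 + c ^ 2)))) :=
      (le_max_right _ _).trans ((le_max_right _ _).trans (le_max_right _ _))
    -- Since `(ψ⁴)' = 4 ψ³ ψ'`, the left side is `4 t³ |ψ'|`, and `t³` is interpolated between `t²`,
    -- bounded by a multiple of `y²`, and `t⁴ = y⁴ ψ⁴`. The fourth power of `ψ` is chosen for this.
    set t := |y * ψ x| with ht
    have htn : 0 ≤ t := abs_nonneg _
    have h1 : |y| ^ 3 * |deriv (fun x => ψ x ^ 4) x| = 4 * t ^ 3 * |deriv ψ x| := by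
      rw [hd, ht, abs_mul, abs_mul, abs_pow, abs_mul]
      simp only [Nat.abs_ofNat]
      ring
    have h2 : t ^ 3 ≤ (μ * t ^ 2 + t ^ 4 / μ) / 2 := by
      have : (μ * t ^ 2 + t ^ 4 / μ) / 2 - t ^ 3 = t ^ 2 * (μ - t) ^ 2 / (2 * μ) := by
        field_simp
        ring
      have h3 : 0 ≤ t ^ 2 * (μ - t) ^ 2 / (2 * μ) := by positivity
      linarith
    have h4 : t ^ 2 ≤ (1 + c ^ 2) * y ^ 2 := by
      rw [ht, sq_abs, mul_pow]
      have : ψ x ^ 2 ≤ c ^ 2 := sq_le_sq' (by linarith [neg_abs_le (ψ x), hc x])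
        ((le_abs_self _).trans (hc x))
      nlinarith [sq_nonneg y]
    have h5 : t ^ 4 = y ^ 4 * ψ x ^ 4 := by
      rw [ht, ← mul_pow]
      exact (by decide : Even 4).pow_abs _
    have h6 : t ^ 4 / μ ≤ (1 + c ^ 2) * (y ^ 4 * ψ x ^ 4 / μ) := by
      rw [h5]
      have : 0 ≤ y ^ 4 * ψ x ^ 4 / μ := by positivity
      nlinarith [sq_nonneg c]
    rw [h1]
    calc 4 * t ^ 3 * |deriv ψ x| ≤ 4 * ((μ * t ^ 2 + t ^ 4 / μ) / 2) * c' := by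
          gcongr
          exact hc' x
      _ ≤ 4 * ((μ * ((1 + c ^ 2) * y ^ 2) + (1 + c ^ 2) * (y ^ 4 * ψ x ^ 4 / μ)) / 2) * c' := by
          gcongr
      _ = 2 * c' * (1 + c ^ 2) * (μ * y ^ 2 + y ^ 4 * ψ x ^ 4 / μ) := by ring
      _ ≤ _ := by gcongr

namespace Slice

variable {a b : ℝ} {w p q z : ℝ → ℝ}

/-- Apply `Slice.integral_k` to `k(s) = s - cap δ s` and subtract from the definition of
`production`. The integral with `z` lives where `w > δ / 2` and is left to the dissipation; for `φ ≥
0` the next two terms are non-negative, and the last two are small with `δ`. -/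
theorem production_eq (S : Slice a b w p q z) (hab : a < b) {φ : ℝ → ℝ}
    (hφ : IsTest (Ioo a b) φ) {δ : ℝ} (hδ : 0 < δ) :
    production a b w p q φ = - (∫ x in Ioo a b, (w x - cap δ (w x)) * z x * (p x * φ x))
      + (∫ x in Ioo a b, cap δ (w x) * q x ^ 2 * φ x)
      - 1 / 3 * (∫ x in Ioo a b, deriv (dcap δ) (w x) * p x ^ 4 * φ x)
      - 5 / 6 * (∫ x in Ioo a b, dcap δ (w x) * p x ^ 3 * deriv φ x)
      - 1 / 2 * (∫ x in Ioo a b, cap δ (w x) * p x ^ 2 * deriv (deriv φ) x) := by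
  have hφc := hφ.continuous.continuousOn (s := Icc a b)
  have hφd := hφ.derivative.continuous.continuousOn (s := Icc a b)
  have hφdd := hφ.derivative.derivative.continuous.continuousOn (s := Icc a b)
  have hle : ∀ s, 0 ≤ s → |s - cap δ s| ≤ s := fun s hs => by
    rw [abs_of_nonneg (by linarith [cap_le_self δ hs])]
    linarith [cap_nonneg δ hs]
  have hle' : ∀ s, 0 ≤ s → |cap δ s| ≤ s := fun s hs => by
    rw [abs_of_nonneg (cap_nonneg δ hs)]
    exact cap_le_self δ hs
  have key := S.integral_k hab (k := fun s => s - cap δ s) (k' := fun s => 1 - dcap δ s)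
    (k'' := fun s => - deriv (dcap δ) s) (e := δ / 2) (by positivity) hφ
    (fun s => (hasDerivAt_id s).sub (hasDerivAt_cap δ s))
    (fun s => by simpa using (hasDerivAt_dcap δ s).const_sub 1)
    (continuous_deriv_dcap δ).neg hle (fun s hs => by rw [cap_eq_self hδ hs, sub_self])
  have e1 : ∫ x in Ioo a b, (w x - cap δ (w x)) * q x ^ 2 * φ x =
      (∫ x in Ioo a b, w x * q x ^ 2 * φ x) - ∫ x in Ioo a b, cap δ (w x) * q x ^ 2 * φ x := by
    have i1 : IntegrableOn (fun x => w x * q x ^ 2 * φ x) (Ioo a b) :=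
      S.integrableOn_mul_q_sq continuous_id (fun s hs => by simp [abs_of_nonneg hs]) hφc
    rw [← integral_sub i1 (S.integrableOn_mul_q_sq (cap_continuous δ) hle' hφc)]
    exact integral_congr_ae (Eventually.of_forall fun x => by ring)
  have e2 : ∫ x in Ioo a b, - deriv (dcap δ) (w x) * p x ^ 4 * φ x =
      - ∫ x in Ioo a b, deriv (dcap δ) (w x) * p x ^ 4 * φ x := by
    rw [← integral_neg]
    exact integral_congr_ae (Eventually.of_forall fun x => by ring)
  have e3 : ∫ x in Ioo a b, (1 - dcap δ (w x)) * p x ^ 3 * deriv φ x =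
      (∫ x in Ioo a b, p x ^ 3 * deriv φ x)
        - ∫ x in Ioo a b, dcap δ (w x) * p x ^ 3 * deriv φ x := by
    have i1 : IntegrableOn (fun x => p x ^ 3 * deriv φ x) (Ioo a b) :=
      ContinuousOn.integrableOn_Ioo ((S.p_cont.pow 3).mul hφd)
    have i2 : IntegrableOn (fun x => dcap δ (w x) * p x ^ 3 * deriv φ x) (Ioo a b) :=
      ContinuousOn.integrableOn_Ioo
        (((S.comp_cont (dcap_continuous δ)).mul (S.p_cont.pow 3)).mul hφd)
    rw [← integral_sub i1 i2]
    exact integral_congr_ae (Eventually.of_forall fun x => by ring)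
  have e4 : ∫ x in Ioo a b, (w x - cap δ (w x)) * p x ^ 2 * deriv (deriv φ) x =
      (∫ x in Ioo a b, w x * p x ^ 2 * deriv (deriv φ) x)
        - ∫ x in Ioo a b, cap δ (w x) * p x ^ 2 * deriv (deriv φ) x := by
    have i1 : IntegrableOn (fun x => w x * p x ^ 2 * deriv (deriv φ) x) (Ioo a b) :=
      ContinuousOn.integrableOn_Ioo ((S.w_cont.mul (S.p_cont.pow 2)).mul hφdd)
    have i2 : IntegrableOn (fun x => cap δ (w x) * p x ^ 2 * deriv (deriv φ) x) (Ioo a b) :=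
      ContinuousOn.integrableOn_Ioo
        (((S.comp_cont (cap_continuous δ)).mul (S.p_cont.pow 2)).mul hφdd)
    rw [← integral_sub i1 i2]
    exact integral_congr_ae (Eventually.of_forall fun x => by ring)
  rw [e1, e2, e3, e4] at key
  rw [production]
  linarith

/-- Weighted norms controlled by the production. -/
theorem weighted_bounds (S : Slice a b w p q z) (hab : a < b) {φ : ℝ → ℝ} {K M E : ℝ}
    (hφ : Weight a b K φ) (hM : 1 ≤ M) (hwM : ∀ x ∈ Icc a b, w x ≤ M)
    (hE : ∫ x in Ioo a b, p x ^ 2 ≤ E) (hT : production a b w p q φ ≤ 1) :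
    (∫ x in Ioo a b, w x * q x ^ 2 * φ x) ≤ 2 + 100 * M ^ 2 * K ^ 2 * E ∧
    (∫ x in Ioo a b, p x ^ 4 * φ x) ≤ 18 * M * (2 + 101 * M ^ 2 * K ^ 2 * E) := by
  have hφc := hφ.test.continuous.continuousOn (s := Icc a b)
  have hφd := hφ.test.derivative.continuous.continuousOn (s := Icc a b)
  have hφdd := hφ.test.derivative.derivative.continuous.continuousOn (s := Icc a b)
  have hK := hφ.one_le
  have hM0 : 0 < M := by linarith
  have hK0 : 0 < K := by linarith
  set Y := ∫ x in Ioo a b, w x * q x ^ 2 * φ x with hY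
  set X := ∫ x in Ioo a b, p x ^ 4 * φ x with hX
  set P := ∫ x in Ioo a b, p x ^ 2 with hP
  have hP0 : 0 ≤ P := integral_nonneg fun x => sq_nonneg _
  have hid : ∀ s : ℝ, 0 ≤ s → |id s| ≤ s := fun s hs => by simp [abs_of_nonneg hs]
  have iY : IntegrableOn (fun x => w x * q x ^ 2 * φ x) (Ioo a b) :=
    S.integrableOn_mul_q_sq continuous_id hid hφc
  have iX : IntegrableOn (fun x => p x ^ 4 * φ x) (Ioo a b) :=
    ContinuousOn.integrableOn_Ioo ((S.p_cont.pow 4).mul hφc)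
  have iP : IntegrableOn (fun x => p x ^ 2) (Ioo a b) :=
    ContinuousOn.integrableOn_Ioo (S.p_cont.pow 2)
  have iA : IntegrableOn (fun x => w x * q x * (p x ^ 2 * φ x)) (Ioo a b) :=
    S.integrableOn_mul_q continuous_id hid ((S.p_cont.pow 2).mul hφc)
  have iB : IntegrableOn (fun x => w x * p x ^ 3 * deriv φ x) (Ioo a b) :=
    ContinuousOn.integrableOn_Ioo ((S.w_cont.mul (S.p_cont.pow 3)).mul hφd)
  have iC : IntegrableOn (fun x => p x ^ 3 * deriv φ x) (Ioo a b) :=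
    ContinuousOn.integrableOn_Ioo ((S.p_cont.pow 3).mul hφd)
  have iD : IntegrableOn (fun x => w x * p x ^ 2 * deriv (deriv φ) x) (Ioo a b) :=
    ContinuousOn.integrableOn_Ioo ((S.w_cont.mul (S.p_cont.pow 2)).mul hφdd)
  -- With `h = id` this identity trades `∫ p⁴ φ` for `∫ w q p² φ` and a term in `φ'`; the first is
  -- absorbed by Young's inequality into `∫ p⁴ φ` and `∫ w q² φ`.
  have id1 := S.integral_h hab hφ.test (h := id) (h' := fun _ => 1) (fun s => hasDerivAt_id s)
    continuous_const rfl hid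
  simp only [one_mul, id] at id1
  have cube : ∀ x, |p x ^ 3 * deriv φ x| = |p x| ^ 3 * |deriv φ x| := fun x => by
    rw [abs_mul, abs_pow]
  -- the two bounds
  have hXb : X ≤ 18 * M * Y + 8 * M ^ 2 * K ^ 2 * P := by
    have hA : -(3 * ∫ x in Ioo a b, w x * q x * (p x ^ 2 * φ x)) ≤ 1 / 4 * X + 9 * M * Y := by
      rw [hX, hY, ← integral_const_mul, ← integral_neg, ← integral_const_mul, ← integral_const_mul,
        ← integral_add (iX.const_mul _) (iY.const_mul _)]
      refine setIntegral_mono_on (iA.const_mul 3).neg ((iX.const_mul _).add (iY.const_mul _))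
        measurableSet_Ioo fun x hx => ?_
      have hx' := Ioo_subset_Icc_self hx
      have h1 := hφ.nonneg x
      have h2 := S.nonneg x hx'
      have h3 := hwM x hx'
      have h4 : -(3 * (w x * q x * p x ^ 2)) ≤ 1 / 4 * p x ^ 4 + 9 * (w x * (w x * q x ^ 2)) := by
        nlinarith [sq_nonneg (p x ^ 2 / 2 + 3 * (w x * q x))]
      have h5 : w x * (w x * q x ^ 2) ≤ M * (w x * q x ^ 2) := by gcongr
      have h6 : -(3 * (w x * q x * p x ^ 2)) * φ x
          ≤ (1 / 4 * p x ^ 4 + 9 * (M * (w x * q x ^ 2))) * φ x :=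
        mul_le_mul_of_nonneg_right (by linarith) h1
      linarith
    have hB : -(∫ x in Ioo a b, w x * p x ^ 3 * deriv φ x) ≤ 4 * M ^ 2 * K ^ 2 * P + 1 / 4 * X := by
      rw [hX, hP, ← integral_neg, ← integral_const_mul, ← integral_const_mul,
        ← integral_add (iP.const_mul _) (iX.const_mul _)]
      refine setIntegral_mono_on iB.neg ((iP.const_mul _).add (iX.const_mul _))
        measurableSet_Ioo fun x hx => ?_
      have hx' := Ioo_subset_Icc_self hx
      have h2 := S.nonneg x hx'
      have h3 := hwM x hx'
      have h4 := hφ.young (4 * M * K) (by positivity) x (p x)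
      calc -(w x * p x ^ 3 * deriv φ x) ≤ |w x * (p x ^ 3 * deriv φ x)| := by
            rw [← mul_assoc]; exact neg_le_abs _
        _ = w x * (|p x| ^ 3 * |deriv φ x|) := by rw [abs_mul, abs_of_nonneg h2, cube]
        _ ≤ M * (K * (4 * M * K * p x ^ 2 + p x ^ 4 * φ x / (4 * M * K))) := by gcongr
        _ = _ := by field_simp
    linarith
  -- The Young parameter `36 M K` leaves `X / (36 M)`, which by `hXb` costs at most half of `Y` and
  -- can be absorbed. The leading `1` is the hypothesis on the production.
  have hYb : Y ≤ 1 + K * (36 * M * K * P) + X / (36 * M) + M * K * P := by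
    have hC : 5 / 6 * (∫ x in Ioo a b, p x ^ 3 * deriv φ x)
        ≤ K * (36 * M * K * P) + X / (36 * M) := by
      have h0 : ∫ x in Ioo a b, |p x ^ 3 * deriv φ x|
          ≤ K * (36 * M * K) * P + 1 / (36 * M) * X := by
        rw [hX, hP, ← integral_const_mul, ← integral_const_mul,
          ← integral_add (iP.const_mul _) (iX.const_mul _)]
        refine setIntegral_mono_on iC.abs ((iP.const_mul _).add (iX.const_mul _))
          measurableSet_Ioo fun x hx => ?_
        rw [cube]
        refine (hφ.young (36 * M * K) (by positivity) x (p x)).trans_eq ?_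
        field_simp
      have h1 : ∫ x in Ioo a b, p x ^ 3 * deriv φ x ≤ ∫ x in Ioo a b, |p x ^ 3 * deriv φ x| :=
        integral_mono iC iC.abs fun x => le_abs_self _
      have h2 : 0 ≤ ∫ x in Ioo a b, |p x ^ 3 * deriv φ x| := integral_nonneg fun x => abs_nonneg _
      have h3 : 1 / (36 * M) * X = X / (36 * M) := by ring
      linarith
    have hD : 1 / 2 * (∫ x in Ioo a b, w x * p x ^ 2 * deriv (deriv φ) x) ≤ M * K * P := by
      have h0 : ∫ x in Ioo a b, w x * p x ^ 2 * deriv (deriv φ) x ≤ M * K * P := by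
        rw [hP, ← integral_const_mul]
        refine setIntegral_mono_on iD (iP.const_mul _) measurableSet_Ioo fun x hx => ?_
        have hx' := Ioo_subset_Icc_self hx
        have h2 := S.nonneg x hx'
        have h3 := hwM x hx'
        calc w x * p x ^ 2 * deriv (deriv φ) x ≤ w x * p x ^ 2 * |deriv (deriv φ) x| := by
              gcongr; exact le_abs_self _
          _ ≤ M * p x ^ 2 * K := by
              gcongr; exact hφ.deriv2_le x
          _ = _ := by ring
      have : 0 ≤ M * K * P := by positivity
      linarith
    have hT' := hT
    rw [production] at hT'
    linarith
  have hXM : X / (36 * M) ≤ Y / 2 + 8 * M * K ^ 2 * P / 36 := by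
    rw [div_le_iff₀ (by positivity)]
    calc X ≤ 18 * M * Y + 8 * M ^ 2 * K ^ 2 * P := hXb
      _ = _ := by ring
  have hPE : M ^ 2 * K ^ 2 * P ≤ M ^ 2 * K ^ 2 * E := by gcongr
  have hc1 : M * K ^ 2 * P ≤ M ^ 2 * K ^ 2 * P := by
    gcongr
    nlinarith
  have hc2 : M * K * P ≤ M ^ 2 * K ^ 2 * P := by
    gcongr <;> nlinarith
  have hc0 : 0 ≤ M ^ 2 * K ^ 2 * P := by positivity
  have hYf : Y ≤ 2 + 100 * M ^ 2 * K ^ 2 * E := by nlinarith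
  refine ⟨hYf, ?_⟩
  have hc3 : M ^ 2 * K ^ 2 * P ≤ M * (M ^ 2 * K ^ 2 * E) := by nlinarith
  have : 18 * M * Y ≤ 18 * M * (2 + 100 * M ^ 2 * K ^ 2 * E) := by gcongr
  nlinarith

end Slice
end ThinFilm

namespace ThinFilm

namespace Slice

/-- The production is bounded below by the part of it carried by the level sets of `w` below
`d ^ 4`, up to a small error and a multiple of the dissipation. -/
theorem production_lower {a b K M E : ℝ} (hab : a < b) (hM : 1 ≤ M) :
    ∃ C, 0 ≤ C ∧ ∀ w p q z φ : ℝ → ℝ, Slice a b w p q z → Weight a b K φ →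
      (∀ x ∈ Icc a b, w x ≤ M) → ∫ x in Ioo a b, p x ^ 2 ≤ E → production a b w p q φ ≤ 1 →
      ∀ d, 0 < d → d ≤ 1 →
        - (1 / 3 * ∫ x in Ioo a b, deriv (dcap (d ^ 4)) (w x) * p x ^ 4 * φ x)
          - C * d - C * (∫ x in Ioo a b, w x ^ 3 * z x ^ 2) / d ^ 5 ≤ production a b w p q φ := by
  set CY : ℝ := 2 + 100 * M ^ 2 * K ^ 2 * E with hCY
  set CX : ℝ := 18 * M * (2 + 101 * M ^ 2 * K ^ 2 * E) with hCX
  -- The three pieces come from the dissipation term `h7`, from the three occurrences of `K d P` in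
  -- `h5`, `h6`, `h7`, and from `K / d * Z` in `hZd`.
  refine ⟨max 0 (2 * K + 3 * K * E + K * (3 / 2 * (CX + CY) + K * (E + CX))), le_max_left _ _, ?_⟩
  intro w p q z φ S hφ hwM hE hT d hd hd1
  obtain ⟨hYb, hXb⟩ := S.weighted_bounds hab hφ hM hwM hE hT
  have hφc := hφ.test.continuous.continuousOn (s := Icc a b)
  have hφd := hφ.test.derivative.continuous.continuousOn (s := Icc a b)
  have hφdd := hφ.test.derivative.derivative.continuous.continuousOn (s := Icc a b)
  have hK := hφ.one_le
  have hK0 : 0 < K := by linarith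
  -- The scale is chosen so that `cap δ (w)² ≤ δ w = d⁴ w`, which makes the low-level integral `Z`
  -- of order `d²`. The Young inequality for the `φ'` term divides `Z` by `d`, and an error of order
  -- `d` remains.
  set δ := d ^ 4 with hδd
  have hδ : 0 < δ := by positivity
  set Y := ∫ x in Ioo a b, w x * q x ^ 2 * φ x with hY
  set X := ∫ x in Ioo a b, p x ^ 4 * φ x with hX
  set P := ∫ x in Ioo a b, p x ^ 2 with hP
  set D := ∫ x in Ioo a b, w x ^ 3 * z x ^ 2 with hD
  set Z := ∫ x in Ioo a b, dcap δ (w x) * p x ^ 4 * φ x with hZ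
  have hP0 : 0 ≤ P := integral_nonneg fun x => sq_nonneg _
  have hD0 : 0 ≤ D := setIntegral_nonneg measurableSet_Ioo fun x hx => by
    have := S.nonneg x (Ioo_subset_Icc_self hx)
    positivity
  have hX0 : 0 ≤ X := integral_nonneg fun x => mul_nonneg (by positivity) (hφ.nonneg x)
  have hid : ∀ s : ℝ, 0 ≤ s → |id s| ≤ s := fun s hs => by simp [abs_of_nonneg hs]
  have hle' : ∀ s, 0 ≤ s → |cap δ s| ≤ s := fun s hs => by
    rw [abs_of_nonneg (cap_nonneg δ hs)]
    exact cap_le_self δ hs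
  have iY : IntegrableOn (fun x => w x * q x ^ 2 * φ x) (Ioo a b) :=
    S.integrableOn_mul_q_sq continuous_id hid hφc
  have iX : IntegrableOn (fun x => p x ^ 4 * φ x) (Ioo a b) :=
    ContinuousOn.integrableOn_Ioo ((S.p_cont.pow 4).mul hφc)
  have iP : IntegrableOn (fun x => p x ^ 2) (Ioo a b) :=
    ContinuousOn.integrableOn_Ioo (S.p_cont.pow 2)
  have iZ : IntegrableOn (fun x => dcap δ (w x) * p x ^ 4 * φ x) (Ioo a b) :=
    ContinuousOn.integrableOn_Ioo
      (((S.comp_cont (dcap_continuous δ)).mul (S.p_cont.pow 4)).mul hφc)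
  have iA : IntegrableOn (fun x => cap δ (w x) * q x * (p x ^ 2 * φ x)) (Ioo a b) :=
    S.integrableOn_mul_q (cap_continuous δ) hle' ((S.p_cont.pow 2).mul hφc)
  have iB : IntegrableOn (fun x => cap δ (w x) * p x ^ 3 * deriv φ x) (Ioo a b) :=
    ContinuousOn.integrableOn_Ioo
      (((S.comp_cont (cap_continuous δ)).mul (S.p_cont.pow 3)).mul hφd)
  have iC : IntegrableOn (fun x => dcap δ (w x) * p x ^ 3 * deriv φ x) (Ioo a b) :=
    ContinuousOn.integrableOn_Ioo
      (((S.comp_cont (dcap_continuous δ)).mul (S.p_cont.pow 3)).mul hφd)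
  have iD : IntegrableOn (fun x => cap δ (w x) * p x ^ 2 * deriv (deriv φ) x) (Ioo a b) :=
    ContinuousOn.integrableOn_Ioo
      (((S.comp_cont (cap_continuous δ)).mul (S.p_cont.pow 2)).mul hφdd)
  have hk0 : ∀ s ≤ δ / 2, s - cap δ s = 0 := fun s hs => by rw [cap_eq_self hδ hs, sub_self]
  have hkle : ∀ s, 0 ≤ s → |s - cap δ s| ≤ s := fun s hs => by
    rw [abs_of_nonneg (by linarith [cap_le_self δ hs])]
    linarith [cap_nonneg δ hs]
  have iF : IntegrableOn (fun x => (w x - cap δ (w x)) * z x * (p x * φ x)) (Ioo a b) :=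
    S.integrableOn_mul_z (k := fun s => s - cap δ s) (e := δ / 2) (by positivity)
      (continuous_id.sub (cap_continuous δ)) hkle hk0 (S.p_cont.mul hφc)
  -- the part of `X` on low level sets
  have hZb : Z ≤ 3 / 2 * d ^ 2 * (X + Y) + d ^ 4 * K * (P + X) := by
    have id1 := S.integral_h hab hφ.test (hasDerivAt_cap δ) (dcap_continuous δ) (cap_zero δ) hle'
    have hA : -(3 * ∫ x in Ioo a b, cap δ (w x) * q x * (p x ^ 2 * φ x))
        ≤ 3 / 2 * d ^ 2 * X + 3 / 2 * d ^ 2 * Y := by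
      rw [hX, hY, ← integral_const_mul, ← integral_neg, ← integral_const_mul, ← integral_const_mul,
        ← integral_add (iX.const_mul _) (iY.const_mul _)]
      refine setIntegral_mono_on (iA.const_mul 3).neg ((iX.const_mul _).add (iY.const_mul _))
        measurableSet_Ioo fun x hx => ?_
      have h2 := S.nonneg x (Ioo_subset_Icc_self hx)
      set c := cap δ (w x) with hc
      have h3 : c ^ 2 ≤ d ^ 4 * w x := by
        rw [sq]
        exact mul_le_mul (cap_le hδ h2) (cap_le_self δ h2) (cap_nonneg δ h2) hδ.le
      have h4 : -(2 * (c * q x * p x ^ 2)) * d ^ 2 ≤ (d ^ 2 * p x ^ 4 + d ^ 2 * (w x * q x ^ 2)) * d ^ 2 := by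
        have : c ^ 2 * q x ^ 2 ≤ d ^ 4 * w x * q x ^ 2 := by gcongr
        nlinarith [sq_nonneg (d ^ 2 * p x ^ 2 + c * q x)]
      have h5 := le_of_mul_le_mul_right h4 (by positivity)
      have := mul_le_mul_of_nonneg_right h5 (hφ.nonneg x)
      linarith
    have hB : -(∫ x in Ioo a b, cap δ (w x) * p x ^ 3 * deriv φ x)
        ≤ d ^ 4 * K * P + d ^ 4 * K * X := by
      rw [hX, hP, ← integral_neg, ← integral_const_mul, ← integral_const_mul,
        ← integral_add (iP.const_mul _) (iX.const_mul _)]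
      refine setIntegral_mono_on iB.neg ((iP.const_mul _).add (iX.const_mul _))
        measurableSet_Ioo fun x hx => ?_
      have h2 := S.nonneg x (Ioo_subset_Icc_self hx)
      have h4 := hφ.young 1 one_pos x (p x)
      calc -(cap δ (w x) * p x ^ 3 * deriv φ x) ≤ |cap δ (w x) * p x ^ 3 * deriv φ x| :=
            neg_le_abs _
        _ = cap δ (w x) * (|p x| ^ 3 * |deriv φ x|) := by
            rw [abs_mul, abs_mul, abs_of_nonneg (cap_nonneg δ h2), abs_pow, mul_assoc]
        _ ≤ d ^ 4 * (K * (1 * p x ^ 2 + p x ^ 4 * φ x / 1)) := by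
            gcongr
            exact cap_le hδ h2
        _ = _ := by ring
    linarith
  have h5 : 5 / 6 * (∫ x in Ioo a b, dcap δ (w x) * p x ^ 3 * deriv φ x) ≤ K * d * P + K / d * Z := by
    have h0 : ∫ x in Ioo a b, |dcap δ (w x) * p x ^ 3 * deriv φ x| ≤ K * d * P + K / d * Z := by
      rw [hZ, hP, ← integral_const_mul, ← integral_const_mul,
        ← integral_add (iP.const_mul _) (iZ.const_mul _)]
      refine setIntegral_mono_on iC.abs ((iP.const_mul _).add (iZ.const_mul _))
        measurableSet_Ioo fun x hx => ?_
      have h4 := hφ.young d hd x (p x)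
      have h6 := dcap_nonneg δ (w x)
      have h7 := dcap_le_one δ (w x)
      calc |dcap δ (w x) * p x ^ 3 * deriv φ x| = dcap δ (w x) * (|p x| ^ 3 * |deriv φ x|) := by
            rw [abs_mul, abs_mul, abs_of_nonneg h6, abs_pow, mul_assoc]
        _ ≤ dcap δ (w x) * (K * (d * p x ^ 2 + p x ^ 4 * φ x / d)) := by gcongr
        _ = dcap δ (w x) * (K * d * p x ^ 2) + K / d * (dcap δ (w x) * p x ^ 4 * φ x) := by ring
        _ ≤ 1 * (K * d * p x ^ 2) + K / d * (dcap δ (w x) * p x ^ 4 * φ x) := by gcongr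
        _ = _ := by ring
    have h1 : ∫ x in Ioo a b, dcap δ (w x) * p x ^ 3 * deriv φ x
        ≤ ∫ x in Ioo a b, |dcap δ (w x) * p x ^ 3 * deriv φ x| :=
      integral_mono iC iC.abs fun x => le_abs_self _
    have h2 : 0 ≤ ∫ x in Ioo a b, |dcap δ (w x) * p x ^ 3 * deriv φ x| :=
      integral_nonneg fun x => abs_nonneg _
    linarith
  have h6 : 1 / 2 * (∫ x in Ioo a b, cap δ (w x) * p x ^ 2 * deriv (deriv φ) x) ≤ K * d * P := by
    have h0 : ∫ x in Ioo a b, cap δ (w x) * p x ^ 2 * deriv (deriv φ) x ≤ K * d * P := by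
      rw [hP, ← integral_const_mul]
      refine setIntegral_mono_on iD (iP.const_mul _) measurableSet_Ioo fun x hx => ?_
      have h2 := S.nonneg x (Ioo_subset_Icc_self hx)
      have h3 : cap δ (w x) ≤ d := (cap_le hδ h2).trans (by
        rw [hδd]; exact pow_le_of_le_one hd.le hd1 (by norm_num))
      have h4 := cap_nonneg δ h2
      calc cap δ (w x) * p x ^ 2 * deriv (deriv φ) x ≤ cap δ (w x) * p x ^ 2 * |deriv (deriv φ) x| := by
            gcongr; exact le_abs_self _
        _ ≤ d * p x ^ 2 * K := by
            gcongr; exact hφ.deriv2_le x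
        _ = _ := by ring
    have : 0 ≤ K * d * P := by positivity
    linarith
  have h7 : ∫ x in Ioo a b, (w x - cap δ (w x)) * z x * (p x * φ x)
      ≤ K * d * P + 2 * K / d ^ 5 * D := by
    rw [hD, hP, ← integral_const_mul, ← integral_const_mul,
      ← integral_add (iP.const_mul _) (S.wz_int.const_mul _)]
    refine setIntegral_mono_on iF ((iP.const_mul _).add (S.wz_int.const_mul _))
      measurableSet_Ioo fun x hx => ?_
    have h2 := S.nonneg x (Ioo_subset_Icc_self hx)
    have hR : 0 ≤ K * d * p x ^ 2 + 2 * K / d ^ 5 * (w x ^ 3 * z x ^ 2) := by positivity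
    -- Where `w ≤ δ / 2` the integrand vanishes. Elsewhere one factor `w` may be inserted at the
    -- price `2 / δ`, turning `w² z² / d` into the dissipation density with coefficient `2 / d⁵`.
    rcases le_or_gt (w x) (δ / 2) with hw | hw
    · rw [hk0 _ hw]
      linarith
    · have e1 : (w x - cap δ (w x)) * z x * (p x * φ x) ≤ w x * (|z x| * |p x|) * K := by
        calc (w x - cap δ (w x)) * z x * (p x * φ x)
            ≤ |(w x - cap δ (w x)) * z x * (p x * φ x)| := le_abs_self _
          _ = |w x - cap δ (w x)| * (|z x| * |p x|) * φ x := by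
              rw [abs_mul, abs_mul, abs_mul, abs_of_nonneg (hφ.nonneg x)]; ring
          _ ≤ _ := by
              gcongr
              · exact hφ.nonneg x
              · exact hkle _ h2
              · exact hφ.le x
      have e2 : w x * (|z x| * |p x|) ≤ d * p x ^ 2 + w x ^ 2 * z x ^ 2 / d := by
        have : d * p x ^ 2 + w x ^ 2 * z x ^ 2 / d - w x * (|z x| * |p x|)
            = ((d * |p x| - w x * |z x|) ^ 2 + (d * |p x|) * (w x * |z x|)) / d := by
          rw [← sq_abs (p x), ← sq_abs (z x)]
          field_simp
          ring
        have h8 : 0 ≤ ((d * |p x| - w x * |z x|) ^ 2 + (d * |p x|) * (w x * |z x|)) / d := by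
          positivity
        linarith
      have e3 : w x ^ 2 * z x ^ 2 / d ≤ 2 / d ^ 5 * (w x ^ 3 * z x ^ 2) := by
        have h9 : δ * (w x ^ 2 * z x ^ 2) ≤ 2 * w x * (w x ^ 2 * z x ^ 2) := by gcongr; linarith
        rw [div_mul_eq_mul_div, div_le_div_iff₀ hd (by positivity)]
        have : w x ^ 2 * z x ^ 2 * d ^ 5 = d * (δ * (w x ^ 2 * z x ^ 2)) := by rw [hδd]; ring
        rw [this]
        calc d * (δ * (w x ^ 2 * z x ^ 2)) ≤ d * (2 * w x * (w x ^ 2 * z x ^ 2)) := by gcongr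
          _ = _ := by ring
      calc _ ≤ w x * (|z x| * |p x|) * K := e1
        _ ≤ (d * p x ^ 2 + 2 / d ^ 5 * (w x ^ 3 * z x ^ 2)) * K := by gcongr; linarith
        _ = _ := by ring
  have h8 : 0 ≤ ∫ x in Ioo a b, cap δ (w x) * q x ^ 2 * φ x :=
    setIntegral_nonneg measurableSet_Ioo fun x hx => by
      have h2 := cap_nonneg δ (S.nonneg x (Ioo_subset_Icc_self hx))
      have := hφ.nonneg x
      positivity
  have hZd : K / d * Z ≤ d * (K * (3 / 2 * (X + Y) + K * (P + X))) := by
    have h10 : d ^ 3 ≤ d := pow_le_of_le_one hd.le hd1 (by norm_num)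
    have h11 : d ^ 3 * (K * (K * (P + X))) ≤ d * (K * (K * (P + X))) := by gcongr
    calc K / d * Z ≤ K / d * (3 / 2 * d ^ 2 * (X + Y) + d ^ 4 * K * (P + X)) := by gcongr
      _ = d * (K * (3 / 2 * (X + Y))) + d ^ 3 * (K * (K * (P + X))) := by field_simp
      _ ≤ d * (K * (3 / 2 * (X + Y))) + d * (K * (K * (P + X))) := by linarith
      _ = _ := by ring
  have hfin : d * (K * (3 / 2 * (X + Y) + K * (P + X)))
      ≤ d * (K * (3 / 2 * (CX + CY) + K * (E + CX))) := by gcongr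
  have hPE : K * d * P ≤ K * d * E := by gcongr
  have hE0 : 0 ≤ E := hP0.trans hE
  have hCX0 : 0 ≤ CX := hX0.trans hXb
  have hY0 : 0 ≤ Y := setIntegral_nonneg measurableSet_Ioo fun x hx => by
    have h2 := S.nonneg x (Ioo_subset_Icc_self hx)
    have := hφ.nonneg x
    positivity
  have hCY0 : 0 ≤ CY := hY0.trans hYb
  rw [S.production_eq hab hφ.test hδ]
  set C := 2 * K + 3 * K * E + K * (3 / 2 * (CX + CY) + K * (E + CX)) with hC
  have hC0 : 0 ≤ C := by positivity
  rw [max_eq_right hC0]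
  have hCd : C * d = 2 * K * d + 3 * (K * d * E) + d * (K * (3 / 2 * (CX + CY) + K * (E + CX))) := by
    rw [hC]; ring
  have hCD : 2 * K / d ^ 5 * D ≤ C * D / d ^ 5 := by
    rw [div_mul_eq_mul_div]
    gcongr
    rw [hC]
    have : 0 ≤ 3 * K * E + K * (3 / 2 * (CX + CY) + K * (E + CX)) := by positivity
    linarith
  have : 0 ≤ 2 * K * d := by positivity
  linarith

end Slice
end ThinFilm

namespace ThinFilm

/-! ### Limits of profiles with vanishing dissipation -/

/-- Profiles are differentiated only in the open interval; this carries estimates to the closed one,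
including a wall, where the condition `p = 0` is read off. -/
theorem abs_le_on_Icc_of_Ioo {c d K : ℝ} {f : ℝ → ℝ} (hcd : c < d) (hf : ContinuousOn f (Icc c d))
    (h : ∀ x ∈ Ioo c d, |f x| ≤ K) : ∀ x ∈ Icc c d, |f x| ≤ K := by
  have h1 : MapsTo (fun x => |f x|) (Ioo c d) (Iic K) := h
  have h2 := h1.closure_of_continuousOn (by rw [closure_Ioo hcd.ne]; exact hf.abs)
  rw [closure_Ioo hcd.ne, closure_Iic] at h2
  exact h2

theorem exists_forall_lt_of_tendstoUniformlyOn {c d : ℝ} {v : ℝ → ℝ} {w : ℕ → ℝ → ℝ}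
    (hv : ContinuousOn v (Icc c d)) (hpos : ∀ x ∈ Icc c d, 0 < v x)
    (h : TendstoUniformlyOn w v atTop (Icc c d)) :
    ∃ δ, 0 < δ ∧ ∀ᶠ k in atTop, ∀ x ∈ Icc c d, δ ≤ w k x := by
  rcases (Icc c d).eq_empty_or_nonempty with he | hne
  · exact ⟨1, one_pos, Eventually.of_forall fun k x hx => by simp [he] at hx⟩
  · obtain ⟨x0, hx0, hmin⟩ := isCompact_Icc.exists_isMinOn hne hv
    refine ⟨v x0 / 2, half_pos (hpos x0 hx0), ?_⟩
    filter_upwards [Metric.tendstoUniformlyOn_iff.1 h (v x0 / 2) (half_pos (hpos x0 hx0))] with k hk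
      x hx
    have h1 := hk x hx
    rw [Real.dist_eq, abs_lt] at h1
    have h2 : v x0 ≤ v x := hmin hx
    linarith [h1.2]

/-- The second derivative hardly oscillates where the profile is bounded below. -/
theorem Slice.abs_q_sub_le {a b c d : ℝ} {w p q z : ℝ → ℝ} (S : Slice a b w p q z) {δ μ : ℝ}
    (hac : a ≤ c) (hdb : d ≤ b) (hδ : 0 < δ) (hμ : 0 < μ) (hw : ∀ x ∈ Icc c d, δ ≤ w x)
    {x y : ℝ} (hx : x ∈ Ioo c d) (hy : y ∈ Ioo c d) :
    |q y - q x| ≤ μ * (d - c) + (∫ s in Ioo a b, w s ^ 3 * z s ^ 2) / (δ ^ 3 * μ) := by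
  have hIoo : Ioo c d ⊆ Ioo a b := Ioo_subset_Ioo hac hdb
  have hpos : Ioo c d ⊆ posSet a b w := fun s hs =>
    ⟨hIoo hs, hδ.trans_le (hw s (Ioo_subset_Icc_self hs))⟩
  have hsub : uIcc x y ⊆ Ioo c d := ordConnected_Ioo.uIcc_subset hx hy
  rw [S.q_eq x y (hsub.trans hpos)]
  have hcd : c ≤ d := (hx.1.trans hx.2).le
  have hW0 : ∀ s ∈ Ioo a b, 0 ≤ w s ^ 3 * z s ^ 2 := fun s hs => by
    have := S.nonneg s (Ioo_subset_Icc_self hs)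
    positivity
  have hwz : IntegrableOn (fun s => μ + w s ^ 3 * z s ^ 2 / (δ ^ 3 * μ)) (Ioo c d) :=
    (integrableOn_const (by simp)).add ((S.wz_int.mono_set hIoo).div_const _)
  -- A pointwise Young inequality replaces Cauchy–Schwarz; the lower bound `δ` on `w` converts `z²`
  -- into the dissipation density.
  have hbound : ∀ s ∈ Ioo c d, |z s| ≤ μ + w s ^ 3 * z s ^ 2 / (δ ^ 3 * μ) := fun s hs => by
    have h1 : δ ^ 3 ≤ w s ^ 3 := by
      have := hw s (Ioo_subset_Icc_self hs)
      gcongr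
    have h2 : |z s| ≤ μ + z s ^ 2 / μ := by
      have : μ + z s ^ 2 / μ - |z s| = ((μ - |z s|) ^ 2 + μ * |z s|) / μ := by
        rw [← sq_abs (z s)]; field_simp; ring
      have h3 : 0 ≤ ((μ - |z s|) ^ 2 + μ * |z s|) / μ := by positivity
      linarith
    have h3 : z s ^ 2 / μ ≤ w s ^ 3 * z s ^ 2 / (δ ^ 3 * μ) := by
      rw [div_le_div_iff₀ hμ (by positivity)]
      have : δ ^ 3 * (z s ^ 2 * μ) ≤ w s ^ 3 * (z s ^ 2 * μ) := by gcongr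
      linarith
    linarith
  have hzi : IntegrableOn z (Ioo c d) :=
    Integrable.mono' hwz (S.z_meas.mono_measure (Measure.restrict_mono hIoo le_rfl))
      ((ae_restrict_mem measurableSet_Ioo).mono hbound)
  calc |∫ s in x..y, z s| ≤ ∫ s in uIoc x y, |z s| :=
        intervalIntegral.norm_integral_le_integral_norm_uIoc (f := z) (μ := volume)
    _ ≤ ∫ s in Ioo c d, |z s| := setIntegral_mono_set hzi.abs
        (Eventually.of_forall fun s => abs_nonneg _)
        (Eventually.of_forall (uIoc_subset_uIcc.trans hsub))
    _ ≤ ∫ s in Ioo c d, (μ + w s ^ 3 * z s ^ 2 / (δ ^ 3 * μ)) :=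
        setIntegral_mono_on hzi.abs hwz measurableSet_Ioo hbound
    _ = μ * (d - c) + (∫ s in Ioo c d, w s ^ 3 * z s ^ 2) / (δ ^ 3 * μ) := by
        have hc : IntegrableOn (fun _ : ℝ => μ) (Ioo c d) := integrableOn_const (by simp)
        rw [integral_add hc ((S.wz_int.mono_set hIoo).div_const _),
          integral_div, setIntegral_const]
        simp [hcd, mul_comm]
    _ ≤ _ := by
        gcongr
        · exact (ae_restrict_mem measurableSet_Ioo).mono fun s hs => hW0 s hs
        · exact S.wz_int

/-- Second order Taylor estimates for a profile with nearly constant second derivative. -/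
theorem Slice.taylor {a b c d : ℝ} {w p q z : ℝ → ℝ} (S : Slice a b w p q z) {ε x₀ : ℝ}
    (hac : a ≤ c) (hdb : d ≤ b) (hw : ∀ x ∈ Icc c d, 0 < w x) (hx₀ : x₀ ∈ Ioo c d)
    (hq : ∀ x ∈ Ioo c d, |q x - q x₀| ≤ ε) :
    (∀ x ∈ Icc c d, |p x - p x₀ - q x₀ * (x - x₀)| ≤ ε * (d - c)) ∧
    (∀ x ∈ Icc c d, |w x - w x₀ - p x₀ * (x - x₀) - q x₀ / 2 * (x - x₀) ^ 2|
      ≤ ε * (d - c) ^ 2) := by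
  have hcd : c < d := hx₀.1.trans hx₀.2
  have hε : 0 ≤ ε := (abs_nonneg _).trans (hq x₀ hx₀)
  have hIcc : Icc c d ⊆ Icc a b := Icc_subset_Icc hac hdb
  have hIoo : Ioo c d ⊆ Ioo a b := Ioo_subset_Ioo hac hdb
  have hpos : Ioo c d ⊆ posSet a b w := fun s hs => ⟨hIoo hs, hw s (Ioo_subset_Icc_self hs)⟩
  have hdist : ∀ x ∈ Ioo c d, |x - x₀| ≤ d - c := fun x hx => by
    rw [abs_le]; constructor <;> linarith [hx.1, hx.2, hx₀.1, hx₀.2]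
  have h1 : ∀ x ∈ Ioo c d, |p x - p x₀ - q x₀ * (x - x₀)| ≤ ε * (d - c) := by
    intro x hx
    have := (convex_Ioo c d).norm_image_sub_le_of_norm_hasDerivWithin_le
      (f := fun x => p x - q x₀ * (x - x₀)) (f' := fun x => q x - q x₀) (C := ε)
      (fun y hy => by
        have := (S.p_deriv y (hpos hy)).sub (((hasDerivAt_id y).sub_const x₀).const_mul (q x₀))
        exact (this.congr_deriv (by simp)).hasDerivWithinAt) hq hx₀ hx
    rw [Real.norm_eq_abs, Real.norm_eq_abs] at this
    calc _ = |p x - q x₀ * (x - x₀) - (p x₀ - q x₀ * (x₀ - x₀))| := by ring_nf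
      _ ≤ ε * |x - x₀| := this
      _ ≤ _ := by gcongr; exact hdist x hx
  have h2 : ∀ x ∈ Ioo c d, |w x - w x₀ - p x₀ * (x - x₀) - q x₀ / 2 * (x - x₀) ^ 2|
      ≤ ε * (d - c) ^ 2 := by
    intro x hx
    have := (convex_Ioo c d).norm_image_sub_le_of_norm_hasDerivWithin_le
      (f := fun x => w x - p x₀ * (x - x₀) - q x₀ / 2 * (x - x₀) ^ 2)
      (f' := fun x => p x - p x₀ - q x₀ * (x - x₀)) (C := ε * (d - c))
      (fun y hy => by
        have := ((S.w_deriv y (hIoo hy)).sub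
          (((hasDerivAt_id y).sub_const x₀).const_mul (p x₀))).sub
          ((((hasDerivAt_id y).sub_const x₀).fun_pow 2).const_mul (q x₀ / 2))
        refine (this.congr_deriv ?_).hasDerivWithinAt
        simp only [id]
        push_cast
        ring) h1 hx₀ hx
    rw [Real.norm_eq_abs, Real.norm_eq_abs] at this
    calc _ = |w x - p x₀ * (x - x₀) - q x₀ / 2 * (x - x₀) ^ 2
          - (w x₀ - p x₀ * (x₀ - x₀) - q x₀ / 2 * (x₀ - x₀) ^ 2)| := by ring_nf
      _ ≤ ε * (d - c) * |x - x₀| := this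
      _ ≤ ε * (d - c) * (d - c) := by
          exact mul_le_mul_of_nonneg_left (hdist x hx) (mul_nonneg hε (by linarith))
      _ = _ := by ring
  have hpc := S.p_cont.mono hIcc
  have hwc := S.w_cont.mono hIcc
  exact ⟨abs_le_on_Icc_of_Ioo hcd (by fun_prop) h1, abs_le_on_Icc_of_Ioo hcd (by fun_prop) h2⟩

/-- Profiles with vanishing dissipation converge in `C¹` to a quadratic polynomial on compact
intervals where the limit is positive. -/
theorem exists_quadratic_limit {a b : ℝ} {v : ℝ → ℝ} {w p q z : ℕ → ℝ → ℝ}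
    (S : ∀ k, Slice a b (w k) (p k) (q k) (z k))
    (hD : Tendsto (fun k => ∫ x in Ioo a b, w k x ^ 3 * z k x ^ 2) atTop (𝓝 0))
    (hv : TendstoUniformlyOn w v atTop (Icc a b)) {c d : ℝ} (hac : a ≤ c) (hcd : c < d)
    (hdb : d ≤ b) (hpos : ∀ x ∈ Icc c d, 0 < v x) :
    ∃ α β γ : ℝ, (∀ x ∈ Icc c d, v x = α + β * x + γ * x ^ 2) ∧
      TendstoUniformlyOn p (fun x => β + 2 * γ * x) atTop (Icc c d) := by
  have hIcc : Icc c d ⊆ Icc a b := Icc_subset_Icc hac hdb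
  have hvu := hv.mono hIcc
  have hvc : ContinuousOn v (Icc c d) :=
    hvu.continuousOn (Frequently.of_forall fun k => (S k).w_cont.mono hIcc)
  obtain ⟨δ, hδ, hlow⟩ := exists_forall_lt_of_tendstoUniformlyOn hvc hpos hvu
  have hlen : 0 < d - c := by linarith
  set x₀ := (c + d) / 2 with hx0d
  have hx₀ : x₀ ∈ Ioo c d := ⟨by linarith, by linarith⟩
  set L := d - c with hL
  -- Only `w k` is known to converge, so the derivatives at `x₀` are recovered from the values at
  -- `x₀` and `x₀ ± h`: the symmetric difference cancels the quadratic term of the Taylor formula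
  -- and gives `p`, the second difference cancels the linear term and gives `q`. The quarter length
  -- keeps all three points inside.
  set h := L / 4 with hh
  have hhp : 0 < h := by positivity
  have hosc : ∀ ε, 0 < ε → ∀ᶠ k in atTop,
      (∀ x ∈ Icc c d, |p k x - p k x₀ - q k x₀ * (x - x₀)| ≤ ε * L) ∧
      (∀ x ∈ Icc c d, |w k x - w k x₀ - p k x₀ * (x - x₀) - q k x₀ / 2 * (x - x₀) ^ 2|
        ≤ ε * L ^ 2) := by
    intro ε hε
    have hμ : 0 < ε / (2 * L) := by positivity
    have hDs : ∀ᶠ k in atTop, (∫ x in Ioo a b, w k x ^ 3 * z k x ^ 2) < ε / 2 * (δ ^ 3 * (ε / (2 * L))) :=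
      hD.eventually_lt_const (by positivity)
    filter_upwards [hlow, hDs] with k hk hDk
    refine (S k).taylor hac hdb (fun x hx => hδ.trans_le (hk x hx)) hx₀ fun x hx => ?_
    have := (S k).abs_q_sub_le hac hdb hδ hμ hk hx₀ hx
    have h2 : (∫ x in Ioo a b, w k x ^ 3 * z k x ^ 2) / (δ ^ 3 * (ε / (2 * L))) ≤ ε / 2 := by
      rw [div_le_iff₀ (by positivity)]; exact hDk.le
    have h3 : ε / (2 * L) * L = ε / 2 := by field_simp
    rw [← hL] at this
    linarith
  have hvt : ∀ x ∈ Icc c d, Tendsto (fun k => w k x) atTop (𝓝 (v x)) := fun x hx =>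
    hvu.tendsto_at hx
  have hm : x₀ - h ∈ Icc c d := ⟨by linarith, by linarith⟩
  have hpl : x₀ + h ∈ Icc c d := ⟨by linarith, by linarith⟩
  have hx₀' := Ioo_subset_Icc_self hx₀
  -- convergence of the coefficients
  have hp0 : Tendsto (fun k => p k x₀) atTop (𝓝 ((v (x₀ + h) - v (x₀ - h)) / (2 * h))) := by
    have h1 : Tendsto (fun k => (w k (x₀ + h) - w k (x₀ - h)) / (2 * h)) atTop
        (𝓝 ((v (x₀ + h) - v (x₀ - h)) / (2 * h))) := ((hvt _ hpl).sub (hvt _ hm)).div_const _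
    have h2 : Tendsto (fun k => p k x₀ - (w k (x₀ + h) - w k (x₀ - h)) / (2 * h)) atTop (𝓝 0) := by
      rw [Metric.tendsto_atTop']
      intro ε hε
      obtain ⟨N, hN⟩ := eventually_atTop.1 (hosc (ε * h / (2 * L ^ 2)) (by positivity))
      refine ⟨N, fun k hk => ?_⟩
      have e1 := (hN k hk.le).2 _ hpl
      have e2 := (hN k hk.le).2 _ hm
      have e3 : ε * h / (2 * L ^ 2) * L ^ 2 = ε * h / 2 := by field_simp
      rw [e3, abs_le] at e1 e2
      rw [dist_zero_right, Real.norm_eq_abs]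
      have e4 : p k x₀ - (w k (x₀ + h) - w k (x₀ - h)) / (2 * h)
          = (2 * h * p k x₀ - (w k (x₀ + h) - w k (x₀ - h))) / (2 * h) := by field_simp
      rw [e4, abs_div, abs_of_pos (by positivity : (0 : ℝ) < 2 * h), div_lt_iff₀ (by positivity),
        abs_lt]
      have : 0 < ε * h := by positivity
      constructor <;> nlinarith [e1.1, e1.2, e2.1, e2.2]
    simpa using h2.add h1
  have hq0 : Tendsto (fun k => q k x₀) atTop
      (𝓝 ((v (x₀ + h) + v (x₀ - h) - 2 * v x₀) / h ^ 2)) := by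
    have h1 : Tendsto (fun k => (w k (x₀ + h) + w k (x₀ - h) - 2 * w k x₀) / h ^ 2) atTop
        (𝓝 ((v (x₀ + h) + v (x₀ - h) - 2 * v x₀) / h ^ 2)) :=
      (((hvt _ hpl).add (hvt _ hm)).sub ((hvt _ hx₀').const_mul 2)).div_const _
    have h2 : Tendsto (fun k => q k x₀ - (w k (x₀ + h) + w k (x₀ - h) - 2 * w k x₀) / h ^ 2)
        atTop (𝓝 0) := by
      rw [Metric.tendsto_atTop']
      intro ε hε
      obtain ⟨N, hN⟩ := eventually_atTop.1 (hosc (ε * h ^ 2 / (4 * L ^ 2)) (by positivity))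
      refine ⟨N, fun k hk => ?_⟩
      have e1 := (hN k hk.le).2 _ hpl
      have e2 := (hN k hk.le).2 _ hm
      have e3 : ε * h ^ 2 / (4 * L ^ 2) * L ^ 2 = ε * h ^ 2 / 4 := by field_simp
      rw [e3, abs_le] at e1 e2
      rw [dist_zero_right, Real.norm_eq_abs]
      have e4 : q k x₀ - (w k (x₀ + h) + w k (x₀ - h) - 2 * w k x₀) / h ^ 2
          = (h ^ 2 * q k x₀ - (w k (x₀ + h) + w k (x₀ - h) - 2 * w k x₀)) / h ^ 2 := by field_simp
      rw [e4, abs_div, abs_of_pos (by positivity : (0 : ℝ) < h ^ 2), div_lt_iff₀ (by positivity),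
        abs_lt]
      have : 0 < ε * h ^ 2 := by positivity
      constructor <;> nlinarith [e1.1, e1.2, e2.1, e2.2]
    simpa using h2.add h1
  set B := (v (x₀ + h) - v (x₀ - h)) / (2 * h) with hB
  set G := (v (x₀ + h) + v (x₀ - h) - 2 * v x₀) / h ^ 2 with hG
  refine ⟨v x₀ - B * x₀ + G / 2 * x₀ ^ 2, B - G * x₀, G / 2, fun x hx => ?_, ?_⟩
  · have h1 : Tendsto (fun k => w k x - w k x₀ - p k x₀ * (x - x₀) - q k x₀ / 2 * (x - x₀) ^ 2)
        atTop (𝓝 (v x - v x₀ - B * (x - x₀) - G / 2 * (x - x₀) ^ 2)) :=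
      (((hvt x hx).sub (hvt _ hx₀')).sub (hp0.mul_const _)).sub ((hq0.div_const 2).mul_const _)
    have h2 : Tendsto (fun k => w k x - w k x₀ - p k x₀ * (x - x₀) - q k x₀ / 2 * (x - x₀) ^ 2)
        atTop (𝓝 0) := by
      rw [Metric.tendsto_atTop']
      intro ε hε
      obtain ⟨N, hN⟩ := eventually_atTop.1 (hosc (ε / (2 * L ^ 2)) (by positivity))
      refine ⟨N, fun k hk => ?_⟩
      rw [dist_zero_right, Real.norm_eq_abs]
      refine ((hN k hk.le).2 x hx).trans_lt ?_
      have : ε / (2 * L ^ 2) * L ^ 2 = ε / 2 := by field_simp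
      linarith
    have := tendsto_nhds_unique h1 h2
    linarith
  · rw [Metric.tendstoUniformlyOn_iff]
    intro ε hε
    have e1 := hosc (ε / (4 * L)) (by positivity)
    have e2 := Metric.tendsto_nhds.1 hp0 (ε / 4) (by positivity)
    have e3 := Metric.tendsto_nhds.1 hq0 (ε / (4 * L)) (by positivity)
    filter_upwards [e1, e2, e3] with k h1 h2 h3 x hx
    have h1 := h1.1 x hx
    rw [Real.dist_eq] at h2 h3 ⊢
    have e4 : ε / (4 * L) * L = ε / 4 := by field_simp
    have h5 : |x - x₀| ≤ L := by rw [abs_le]; constructor <;> linarith [hx.1, hx.2, hx₀.1, hx₀.2]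
    have h6 : |(q k x₀ - G) * (x - x₀)| ≤ ε / 4 := by
      rw [abs_mul, ← e4]
      gcongr
    rw [e4] at h1
    have h7 : B - G * x₀ + 2 * (G / 2) * x - p k x = -(p k x - p k x₀ - q k x₀ * (x - x₀))
      - (p k x₀ - B) - (q k x₀ - G) * (x - x₀) := by ring
    rw [h7, abs_lt]
    rw [abs_le] at h1 h6
    rw [abs_lt] at h2
    constructor <;> linarith [h1.1, h1.2, h2.1, h2.2, h6.1, h6.2]

/-! ### Rigidity of locally quadratic profiles. -/

/-- `v` is quadratic on intervals where it is positive, and flat at the walls. -/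
def LocallyQuadratic (a b : ℝ) (v : ℝ → ℝ) : Prop :=
  ∀ c d, a ≤ c → c < d → d ≤ b → (∀ x ∈ Icc c d, 0 < v x) →
    ∃ α β γ : ℝ, (∀ x ∈ Icc c d, v x = α + β * x + γ * x ^ 2) ∧
      (c = a → β + 2 * γ * a = 0) ∧ (d = b → β + 2 * γ * b = 0)

/-- The convergence of `p k` is uniform up to the walls, so the condition `p k = 0` there passes to
the slope of the limiting polynomial. -/
theorem locallyQuadratic_of_limit {a b : ℝ} {v : ℝ → ℝ} {w p q z : ℕ → ℝ → ℝ}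
    (S : ∀ k, Slice a b (w k) (p k) (q k) (z k))
    (hD : Tendsto (fun k => ∫ x in Ioo a b, w k x ^ 3 * z k x ^ 2) atTop (𝓝 0))
    (hv : TendstoUniformlyOn w v atTop (Icc a b)) : LocallyQuadratic a b v := by
  intro c d hac hcd hdb hpos
  obtain ⟨α, β, γ, h1, h2⟩ := exists_quadratic_limit S hD hv hac hcd hdb hpos
  refine ⟨α, β, γ, h1, fun hc => ?_, fun hd => ?_⟩
  · subst hc
    have := h2.tendsto_at (left_mem_Icc.2 hcd.le)
    simp only [(S _).p_left] at this
    exact tendsto_nhds_unique this tendsto_const_nhds |>.symm ▸ rfl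
  · subst hd
    have := h2.tendsto_at (right_mem_Icc.2 hcd.le)
    simp only [(S _).p_right] at this
    exact tendsto_nhds_unique this tendsto_const_nhds |>.symm ▸ rfl

/-- Three points determine a quadratic; the two ends and the midpoint isolate `γ` through a second
difference. Used to glue local representations. -/
theorem quadratic_coeffs_unique {c d α β γ α' β' γ' : ℝ} (hcd : c < d)
    (h : ∀ x ∈ Icc c d, α + β * x + γ * x ^ 2 = α' + β' * x + γ' * x ^ 2) :
    α = α' ∧ β = β' ∧ γ = γ' := by
  have h1 := h c (left_mem_Icc.2 hcd.le)
  have h2 := h d (right_mem_Icc.2 hcd.le)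
  have h3 := h ((c + d) / 2) ⟨by linarith, by linarith⟩
  have hne : d - c ≠ 0 := by linarith
  have hγ : γ = γ' := by
    have : (γ - γ') * (d - c) ^ 2 = 0 := by linear_combination 2 * h1 + 2 * h2 - 4 * h3
    rcases mul_eq_zero.1 this with h | h
    · linarith
    · exact absurd (pow_eq_zero_iff (two_ne_zero) |>.1 h) hne
  subst hγ
  have hβ : β = β' := by
    have : (β - β') * (d - c) = 0 := by linear_combination h2 - h1
    rcases mul_eq_zero.1 this with h | h
    · linarith
    · exact absurd h hne
  subst hβ
  exact ⟨by linarith, rfl, rfl⟩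

/-- Every point is enclosed with a fixed core `[m, m']` in one interval of positivity, so its
polynomial agrees with that of the core. Continuity adds the end points, where `v` may vanish. -/
theorem LocallyQuadratic.exists_on_Ioo {a b c d : ℝ} {v : ℝ → ℝ} (hq : LocallyQuadratic a b v)
    (hvc : ContinuousOn v (Icc a b)) (hac : a ≤ c) (hcd : c < d) (hdb : d ≤ b)
    (hpos : ∀ x ∈ Ioo c d, 0 < v x) :
    ∃ α β γ : ℝ, ∀ x ∈ Icc c d, v x = α + β * x + γ * x ^ 2 := by
  obtain ⟨m, hm, hm'⟩ := exists_between hcd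
  obtain ⟨m', hm2, hm2'⟩ := exists_between hm'
  obtain ⟨α, β, γ, h1, -⟩ := hq m m' (hac.trans hm.le) hm2 (hm2'.le.trans hdb)
    fun x hx => hpos x ⟨hm.trans_le hx.1, hx.2.trans_lt hm2'⟩
  refine ⟨α, β, γ, ?_⟩
  have h2 : ∀ x ∈ Ioo c d, v x = α + β * x + γ * x ^ 2 := by
    intro x hx
    have hl : c < min m x := lt_min hm hx.1
    have hr : max m' x < d := max_lt hm2' hx.2
    have hlr : min m x < max m' x := (min_le_left _ _).trans_lt (hm2.trans_le (le_max_left _ _))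
    obtain ⟨α', β', γ', h3, -⟩ := hq (min m x) (max m' x) (hac.trans hl.le) hlr (hr.le.trans hdb)
      fun y hy => hpos y ⟨hl.trans_le hy.1, hy.2.trans_lt hr⟩
    obtain ⟨rfl, rfl, rfl⟩ := quadratic_coeffs_unique hm2 fun y hy => (h1 y hy).symm.trans
      (h3 y ⟨(min_le_left _ _).trans hy.1, hy.2.trans (le_max_left _ _)⟩)
    exact h3 x ⟨min_le_right _ _, le_max_right _ _⟩
  have hvc' := hvc.mono (Icc_subset_Icc hac hdb)
  have h3 := abs_le_on_Icc_of_Ioo (f := fun x => v x - (α + β * x + γ * x ^ 2)) (K := 0) hcd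
    (by fun_prop) fun x hx => by rw [h2 x hx]; simp
  intro x hx
  have := abs_nonpos_iff.1 (h3 x hx)
  linarith

/-- At the left end of a component of `{v > 0}` inside the domain, `v` has a positive slope. -/
theorem LocallyQuadratic.left_slope {a b x₀ y : ℝ} {v : ℝ → ℝ} (hq : LocallyQuadratic a b v)
    (hvc : ContinuousOn v (Icc a b)) (hv0 : ∀ x ∈ Icc a b, 0 ≤ v x) (hax : a ≤ x₀) (hxy : x₀ < y)
    (hyb : y ≤ b) (hvx : v x₀ = 0) (hpos : ∀ x ∈ Ioc x₀ y, 0 < v x) :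
    ∃ s γ, 0 < s ∧ ∀ x ∈ Icc x₀ y, v x = s * (x - x₀) + γ * (x - x₀) ^ 2 := by
  have hvy := hpos y ⟨hxy, le_rfl⟩
  -- Either the component ends at a first zero `t ≤ b`, or it extends to the wall, where the profile
  -- is flat.
  by_cases hz : ∃ x ∈ Icc y b, v x = 0
  · have hcl : IsCompact (Icc y b ∩ v ⁻¹' {0}) :=
      isCompact_Icc.of_isClosed_subset
        ((hvc.mono (Icc_subset_Icc (hax.trans hxy.le) le_rfl)).preimage_isClosed_of_isClosed
        isClosed_Icc isClosed_singleton) inter_subset_left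
    obtain ⟨t, ⟨ht, ht0⟩, hmin⟩ := hcl.exists_isLeast hz
    have ht0 : v t = 0 := ht0
    have hyt : y < t := lt_of_le_of_ne ht.1 fun h => by rw [h, ht0] at hvy; exact lt_irrefl _ hvy
    have hxt : x₀ < t := hxy.trans hyt
    obtain ⟨α, β, γ, h1⟩ := hq.exists_on_Ioo hvc hax hxt ht.2 fun x hx => by
      rcases le_or_gt x y with h | h
      · exact hpos x ⟨hx.1, h⟩
      · refine lt_of_le_of_ne (hv0 x ⟨hax.trans hx.1.le, hx.2.le.trans ht.2⟩) fun h0 => ?_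
        exact absurd (hmin ⟨⟨h.le, hx.2.le.trans ht.2⟩, h0.symm⟩) (not_le.2 hx.2)
    have h5 := h1 x₀ (left_mem_Icc.2 hxt.le)
    have h6 := h1 t (right_mem_Icc.2 hxt.le)
    have h7 := h1 y ⟨hxy.le, hyt.le⟩
    rw [hvx] at h5
    rw [ht0] at h6
    refine ⟨β + 2 * γ * x₀, γ, ?_, fun x hx => ?_⟩
    -- With zeros at `x₀` and `t` the profile is `-γ (x - x₀)(t - x)`; positivity at `y` forces `γ <
    -- 0`, and the slope at `x₀` is `-γ (t - x₀)`.
    · have h8 : β + 2 * γ * x₀ + γ * (t - x₀) = 0 := by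
        have : (t - x₀) * (β + 2 * γ * x₀ + γ * (t - x₀)) = 0 := by linear_combination h5 - h6
        exact (mul_eq_zero.1 this).resolve_left (by linarith)
      have h9 : 0 < (-γ * (t - y)) * (y - x₀) := by
        have : v y = (-γ * (t - y)) * (y - x₀) := by
          linear_combination h7 - h5 + (y - x₀) * h8
        rwa [← this]
      have h10 : 0 < -γ := pos_of_mul_pos_left (pos_of_mul_pos_left h9 (by linarith)) (by linarith)
      have h11 : 0 < (-γ) * (t - x₀) := mul_pos h10 (by linarith)
      linarith
    · rw [h1 x ⟨hx.1, hx.2.trans hyt.le⟩]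
      linear_combination -h5
  · push Not at hz
    have hpos' : ∀ x ∈ Ioc x₀ b, 0 < v x := fun x hx => by
      rcases le_or_gt x y with h | h
      · exact hpos x ⟨hx.1, h⟩
      · exact lt_of_le_of_ne (hv0 x ⟨hax.trans hx.1.le, hx.2⟩) (hz x ⟨h.le, hx.2⟩).symm
    have hxb : x₀ < b := hxy.trans_le hyb
    obtain ⟨α, β, γ, h1⟩ := hq.exists_on_Ioo hvc hax hxb le_rfl
      fun x hx => hpos' x (Ioo_subset_Ioc_self hx)
    obtain ⟨m, hm, hm'⟩ := exists_between hxb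
    obtain ⟨α', β', γ', h2, -, h3⟩ := hq m b (hax.trans hm.le) hm' le_rfl
      fun x hx => hpos' x ⟨hm.trans_le hx.1, hx.2⟩
    obtain ⟨rfl, rfl, rfl⟩ := quadratic_coeffs_unique hm' fun x hx =>
      (h1 x ⟨hm.le.trans hx.1, hx.2⟩).symm.trans (h2 x hx)
    have h4 := h3 rfl
    have h5 := h1 x₀ (left_mem_Icc.2 hxb.le)
    have h6 := h1 b (right_mem_Icc.2 hxb.le)
    have h7 := hpos' b ⟨hxb, le_rfl⟩
    rw [hvx] at h5
    refine ⟨β + 2 * γ * x₀, γ, ?_, fun x hx => ?_⟩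
    -- A parabola starting at height zero and flat at `b` satisfies `s (b - x₀) = 2 v(b)`, and `v(b)
    -- > 0`.
    · have h8 : (β + 2 * γ * x₀) * (b - x₀) = 2 * v b := by
        linear_combination -(b - x₀) * h4 - 2 * h6 + 2 * h5
      exact pos_of_mul_pos_left (by rw [h8]; linarith) (by linarith : 0 ≤ b - x₀)
    · rw [h1 x ⟨hx.1, hx.2.trans hyb⟩]
      linear_combination -h5

/-- Reflection exchanges the walls and the sign of slopes, so right end points reduce to left ones.
-/
theorem LocallyQuadratic.reflect {a b : ℝ} {v : ℝ → ℝ} (hq : LocallyQuadratic a b v) :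
    LocallyQuadratic a b (fun x => v (a + b - x)) := by
  intro c d hac hcd hdb hpos
  obtain ⟨α, β, γ, h1, h2, h3⟩ := hq (a + b - d) (a + b - c) (by linarith) (by linarith)
    (by linarith) fun x hx => by
      simpa using hpos (a + b - x) ⟨by linarith [hx.2], by linarith [hx.1]⟩
  refine ⟨α + β * (a + b) + γ * (a + b) ^ 2, -β - 2 * γ * (a + b), γ, fun x hx => ?_, ?_, ?_⟩
  · have h4 := h1 (a + b - x) ⟨by linarith [hx.2], by linarith [hx.1]⟩
    simp only [h4]
    ring
  · intro hc
    linarith [h3 (by linarith)]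
  · intro hd
    linarith [h2 (by linarith)]

theorem LocallyQuadratic.right_slope {a b x₀ y : ℝ} {v : ℝ → ℝ} (hq : LocallyQuadratic a b v)
    (hvc : ContinuousOn v (Icc a b)) (hv0 : ∀ x ∈ Icc a b, 0 ≤ v x) (hxb : x₀ ≤ b) (hxy : y < x₀)
    (hya : a ≤ y) (hvx : v x₀ = 0) (hpos : ∀ x ∈ Ico y x₀, 0 < v x) :
    ∃ s γ, 0 < s ∧ ∀ x ∈ Icc y x₀, v x = s * (x₀ - x) + γ * (x₀ - x) ^ 2 := by
  have hmap : MapsTo (fun x => a + b - x) (Icc a b) (Icc a b) := fun x hx =>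
    ⟨by linarith [hx.2], by linarith [hx.1]⟩
  obtain ⟨s, γ, hs, h⟩ := hq.reflect.left_slope (x₀ := a + b - x₀) (y := a + b - y)
    (hvc.comp (by fun_prop) hmap) (fun x hx => hv0 _ (hmap hx)) (by linarith) (by linarith)
    (by linarith) (by simpa using hvx) (fun x hx => hpos _ ⟨by linarith [hx.2], by linarith [hx.1]⟩)
  refine ⟨s, γ, hs, fun x hx => ?_⟩
  have := h (a + b - x) ⟨by linarith [hx.2], by linarith [hx.1]⟩
  simp only [sub_sub_cancel] at this
  rw [this]
  ring

end ThinFilm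

namespace ThinFilm

/-! ### Contact points with positive slope produce entropy -/

/-- Between heights `d / 2` and `d` the function `dcap d (w)` goes from one to zero, so its total
variation `∫ |(dcap d)'(w) p|` on `[c, e]` is at least one. The remaining factor `|p|³ φ` of the
integrand is at least `s₀³ φ₀` there, and off `[c, e]` the integrand has the right sign. -/
theorem Slice.level_set_lower {a b c e d K φ₀ s₀ : ℝ} {w p q z φ : ℝ → ℝ}
    (S : Slice a b w p q z) (hφ : Weight a b K φ) (hd : 0 < d) (hac : a ≤ c) (hce : c < e)
    (heb : e ≤ b) (hφ₀ : 0 ≤ φ₀) (hs₀ : 0 ≤ s₀) (hφle : ∀ x ∈ Icc c e, φ₀ ≤ φ x)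
    (hp : ∀ x ∈ Icc c e, s₀ ≤ |p x|)
    (hw : (w c ≤ d / 2 ∧ d ≤ w e) ∨ (w e ≤ d / 2 ∧ d ≤ w c)) :
    s₀ ^ 3 * φ₀ ≤ - ∫ x in Ioo a b, deriv (dcap d) (w x) * p x ^ 4 * φ x := by
  have hφc := hφ.test.continuous.continuousOn (s := Icc a b)
  have hIcc : Icc c e ⊆ Icc a b := Icc_subset_Icc hac heb
  have hIoo : Ioo c e ⊆ Ioo a b := Ioo_subset_Ioo hac heb
  have c1 : ContinuousOn (fun x => deriv (dcap d) (w x) * p x) (Icc c e) :=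
    ((S.comp_cont (continuous_deriv_dcap d)).mul S.p_cont).mono hIcc
  have i1 : IntegrableOn (fun x => - (deriv (dcap d) (w x) * p x ^ 4 * φ x)) (Ioo a b) :=
    (ContinuousOn.integrableOn_Ioo
      (((S.comp_cont (continuous_deriv_dcap d)).mul (S.p_cont.pow 4)).mul hφc)).neg
  have ftc := intervalIntegral.integral_eq_sub_of_hasDerivAt_of_le hce.le
    (f := fun x => dcap d (w x)) (f' := fun x => deriv (dcap d) (w x) * p x)
    ((S.comp_cont (dcap_continuous d)).mono hIcc)
    (fun x hx => (hasDerivAt_dcap d (w x)).comp x (S.w_deriv x (hIoo hx)))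
    ((c1.integrableOn_compact isCompact_Icc).mono_set (by rw [uIcc_of_le hce.le])).intervalIntegrable
  have h1 : 1 ≤ |∫ x in c..e, deriv (dcap d) (w x) * p x| := by
    rw [ftc]
    rcases hw with ⟨h1, h2⟩ | ⟨h1, h2⟩ <;> simp [dcap_eq_one hd h1, dcap_eq_zero hd h2]
  have h2 : |∫ x in c..e, deriv (dcap d) (w x) * p x|
      ≤ ∫ x in Ioo c e, |deriv (dcap d) (w x) * p x| := by
    rw [← integral_Ioc_eq_integral_Ioo, ← intervalIntegral.integral_of_le hce.le]
    exact intervalIntegral.abs_integral_le_integral_abs hce.le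
  have h3 : s₀ ^ 3 * φ₀ * ∫ x in Ioo c e, |deriv (dcap d) (w x) * p x|
      ≤ ∫ x in Ioo c e, - (deriv (dcap d) (w x) * p x ^ 4 * φ x) := by
    rw [← integral_const_mul]
    refine setIntegral_mono_on ((ContinuousOn.integrableOn_Ioo c1).abs.const_mul _)
      (i1.mono_set hIoo) measurableSet_Ioo fun x hx => ?_
    have hx' := Ioo_subset_Icc_self hx
    have e1 := deriv_dcap_nonpos hd (w x)
    have e2 := hp x hx'
    have e3 := hφle x hx'
    have e4 : p x ^ 4 = |p x| ^ 3 * |p x| := by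
      rw [← pow_succ, (by decide : Even 4).pow_abs]
    rw [abs_mul, abs_of_nonpos e1, e4]
    have e5 : 0 ≤ - deriv (dcap d) (w x) * |p x| := mul_nonneg (by linarith) (abs_nonneg _)
    calc s₀ ^ 3 * φ₀ * (-deriv (dcap d) (w x) * |p x|)
        ≤ |p x| ^ 3 * φ x * (-deriv (dcap d) (w x) * |p x|) := by gcongr
      _ = _ := by ring
  have h4 : ∫ x in Ioo c e, - (deriv (dcap d) (w x) * p x ^ 4 * φ x)
      ≤ ∫ x in Ioo a b, - (deriv (dcap d) (w x) * p x ^ 4 * φ x) := by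
    refine setIntegral_mono_set i1 (Eventually.of_forall fun x => ?_) (Eventually.of_forall hIoo)
    have e1 := deriv_dcap_nonpos hd (w x)
    have := hφ.nonneg x
    have h5 : 0 ≤ (- deriv (dcap d) (w x)) * p x ^ 4 * φ x :=
      mul_nonneg (mul_nonneg (by linarith) (by positivity)) this
    simp only [Pi.zero_apply]
    linarith
  rw [← integral_neg]
  have h5 : 0 ≤ s₀ ^ 3 * φ₀ := by positivity
  nlinarith

/-- If the limit profile crosses all small levels with a slope bounded below, the production stays
away from zero. -/
theorem production_eventually_ge {a b K M E φ₀ s₀ V : ℝ} {v φ : ℝ → ℝ} {w p q z : ℕ → ℝ → ℝ}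
    (hab : a < b) (hM : 1 ≤ M) (S : ∀ k, Slice a b (w k) (p k) (q k) (z k))
    (hwM : ∀ k, ∀ x ∈ Icc a b, w k x ≤ M) (hE : ∀ k, ∫ x in Ioo a b, p k x ^ 2 ≤ E)
    (hD : Tendsto (fun k => ∫ x in Ioo a b, w k x ^ 3 * z k x ^ 2) atTop (𝓝 0))
    (hv : TendstoUniformlyOn w v atTop (Icc a b)) (hφ : Weight a b K φ) (hφ₀ : 0 < φ₀)
    (hs₀ : 0 < s₀) (hV : 0 < V)
    (H : ∀ η, 0 < η → η < V → ∃ c e, a ≤ c ∧ c < e ∧ e ≤ b ∧ (∀ x ∈ Icc c e, 0 < v x) ∧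
      (∀ x ∈ Icc c e, φ₀ ≤ φ x) ∧ (∀ α β γ : ℝ, (∀ x ∈ Icc c e, v x = α + β * x + γ * x ^ 2) →
        ∀ x ∈ Icc c e, 2 * s₀ ≤ |β + 2 * γ * x|) ∧
      ((v c < η / 2 ∧ η < v e) ∨ (v e < η / 2 ∧ η < v c))) :
    ∃ m, 0 < m ∧ ∀ᶠ k in atTop, m ≤ production a b (w k) (p k) (q k) φ := by
  obtain ⟨C, hC, hlow⟩ := Slice.production_lower (K := K) (E := E) hab hM
  -- One third of the bound from `Slice.level_set_lower` is `4 m`; the two error terms of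
  -- `Slice.production_lower` are each made smaller than `m`. The scale `d` is fixed first, and only
  -- then is `k` taken large to beat the factor `1 / d⁵`.
  set m := s₀ ^ 3 * φ₀ / 12 with hm
  have hm0 : 0 < m := by positivity
  obtain ⟨d, hd, hd1, hdV, hdC⟩ : ∃ d, 0 < d ∧ d ≤ 1 ∧ d ^ 4 < V ∧ C * d < m := by
    have t1 : Tendsto (fun d : ℝ => d ^ 4) (𝓝[>] 0) (𝓝 0) := by
      have : Tendsto (fun d : ℝ => d ^ 4) (𝓝 0) (𝓝 (0 ^ 4)) := (continuous_pow 4).tendsto 0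
      simpa using this.mono_left nhdsWithin_le_nhds
    have t2 : Tendsto (fun d : ℝ => C * d) (𝓝[>] 0) (𝓝 0) := by
      have : Tendsto (fun d : ℝ => C * d) (𝓝 0) (𝓝 (C * 0)) := (continuous_const_mul C).tendsto 0
      simpa using this.mono_left nhdsWithin_le_nhds
    have t3 : ∀ᶠ d : ℝ in 𝓝[>] 0, d ≤ 1 :=
      nhdsWithin_le_nhds (eventually_le_nhds one_pos)
    obtain ⟨d, ⟨h1, h2⟩, h3, h4⟩ := ((t1.eventually_lt_const hV).and
      (t2.eventually_lt_const hm0)).and (t3.and self_mem_nhdsWithin) |>.exists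
    exact ⟨d, h4, h3, h1, h2⟩
  obtain ⟨c, e, hac, hce, heb, hpos, hφle, hslope, hlev⟩ := H (d ^ 4) (by positivity) hdV
  obtain ⟨α, β, γ, hquad, hpu⟩ := exists_quadratic_limit S hD hv hac hce heb hpos
  have hs := hslope α β γ hquad
  have hIcc : Icc c e ⊆ Icc a b := Icc_subset_Icc hac heb
  have hvc := hv.tendsto_at (hIcc (left_mem_Icc.2 hce.le))
  have hve := hv.tendsto_at (hIcc (right_mem_Icc.2 hce.le))
  have ev1 : ∀ᶠ k in atTop, (w k c ≤ d ^ 4 / 2 ∧ d ^ 4 ≤ w k e) ∨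
      (w k e ≤ d ^ 4 / 2 ∧ d ^ 4 ≤ w k c) := by
    rcases hlev with ⟨h1, h2⟩ | ⟨h1, h2⟩
    · filter_upwards [hvc.eventually_lt_const h1, hve.eventually_const_lt h2] with k g1 g2
      exact Or.inl ⟨g1.le, g2.le⟩
    · filter_upwards [hve.eventually_lt_const h1, hvc.eventually_const_lt h2] with k g1 g2
      exact Or.inr ⟨g1.le, g2.le⟩
  have ev2 : ∀ᶠ k in atTop, C * (∫ x in Ioo a b, w k x ^ 3 * z k x ^ 2) / d ^ 5 < m := by
    have : Tendsto (fun k => C * (∫ x in Ioo a b, w k x ^ 3 * z k x ^ 2) / d ^ 5) atTop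
        (𝓝 (C * 0 / d ^ 5)) := (hD.const_mul C).div_const _
    exact this.eventually_lt_const (by simpa using hm0)
  -- The lower estimate assumes production at most one; when it is larger there is nothing to prove,
  -- hence the minimum with `1`.
  refine ⟨min 1 m, lt_min one_pos hm0, ?_⟩
  filter_upwards [ev1, ev2, Metric.tendstoUniformlyOn_iff.1 hpu s₀ hs₀] with k h1 h2 h3
  rcases le_or_gt (production a b (w k) (p k) (q k) φ) 1 with hT | hT
  · refine (min_le_right _ _).trans ?_
    have h4 := hlow (w k) (p k) (q k) (z k) φ (S k) hφ (hwM k) (hE k) hT d hd hd1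
    have h5 := (S k).level_set_lower hφ (pow_pos hd 4) hac hce heb hφ₀.le hs₀.le hφle
      (fun x hx => by
        have g1 := h3 x hx
        have g2 := hs x hx
        rw [Real.dist_eq] at g1
        have g3 := abs_sub_abs_le_abs_sub (β + 2 * γ * x) (p k x)
        linarith) h1
    linarith
  · exact (min_le_left _ _).trans hT.le

/-- An end point of a component of `{v > 0}` can be found near any boundary point. -/
theorem exists_component_endpoint {a b x₀ r : ℝ} {v : ℝ → ℝ} (hvc : ContinuousOn v (Icc a b))
    (hv0 : ∀ x ∈ Icc a b, 0 ≤ v x) (hx₀ : x₀ ∈ Ioo a b) (hf : x₀ ∈ frontier (posSet a b v))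
    (hr : 0 < r) : ∃ y₀ ∈ Ioo a b ∩ Metric.ball x₀ r, v y₀ = 0 ∧
      ((∃ y ∈ Ioo a b, y₀ < y ∧ ∀ x ∈ Ioc y₀ y, 0 < v x) ∨
        (∃ y ∈ Ioo a b, y < y₀ ∧ ∀ x ∈ Ico y y₀, 0 < v x)) := by
  have hvx₀ : v x₀ = 0 := by
    have h1 : x₀ ∉ posSet a b v := fun h => (isOpen_posSet hvc).frontier_eq ▸ hf |>.2 h
    have h2 := hv0 x₀ (Ioo_subset_Icc_self hx₀)
    by_contra h3
    exact h1 ⟨hx₀, lt_of_le_of_ne h2 (Ne.symm h3)⟩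
  obtain ⟨y, hy, hyp⟩ := mem_closure_iff_nhds.1 (frontier_subset_closure hf) _
    (Metric.ball_mem_nhds x₀ hr)
  have hball : ∀ s ∈ uIcc x₀ y, s ∈ Ioo a b ∩ Metric.ball x₀ r := fun s hs => by
    refine ⟨ordConnected_Ioo.uIcc_subset hx₀ hyp.1 hs, ?_⟩
    rw [Real.ball_eq_Ioo] at hy ⊢
    exact ordConnected_Ioo.uIcc_subset ⟨by linarith, by linarith⟩ hy hs
  have hcomp : IsCompact (uIcc x₀ y ∩ v ⁻¹' {0}) :=
    isCompact_uIcc.of_isClosed_subset ((hvc.mono fun s hs =>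
      Ioo_subset_Icc_self (hball s hs).1).preimage_isClosed_of_isClosed isCompact_uIcc.isClosed
      isClosed_singleton) inter_subset_left
  have hne : (uIcc x₀ y ∩ v ⁻¹' {0}).Nonempty := ⟨x₀, left_mem_uIcc, hvx₀⟩
  have hpos : ∀ s ∈ uIcc x₀ y, v s ≠ 0 → 0 < v s := fun s hs h =>
    lt_of_le_of_ne (hv0 s (Ioo_subset_Icc_self (hball s hs).1)) h.symm
  have hyne : x₀ ≠ y := fun h => by have := hyp.2; rw [← h, hvx₀] at this; exact lt_irrefl _ this
  rcases lt_or_gt_of_ne hyne with hlt | hlt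
  -- The point `x₀` may be an accumulation point of components and the end of none. The last zero
  -- between `x₀` and a nearby positive point `y` is the end of a component.
  · obtain ⟨y₀, ⟨h1, h2⟩, hmax⟩ := hcomp.exists_isGreatest hne
    have h1' := h1
    rw [uIcc_of_le hlt.le] at h1'
    have hy₀y : y₀ < y := lt_of_le_of_ne h1'.2 fun h => by
      have := hyp.2; rw [← h] at this; exact this.ne' h2
    refine ⟨y₀, hball y₀ h1, h2, Or.inl ⟨y, hyp.1, hy₀y, fun x hx => ?_⟩⟩
    have hxm : x ∈ uIcc x₀ y := by
      rw [uIcc_of_le hlt.le]; exact ⟨h1'.1.trans hx.1.le, hx.2⟩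
    exact hpos x hxm fun h => absurd (hmax ⟨hxm, h⟩) (not_le.2 hx.1)
  · obtain ⟨y₀, ⟨h1, h2⟩, hmin⟩ := hcomp.exists_isLeast hne
    have h1' := h1
    rw [uIcc_of_ge hlt.le] at h1'
    have hy₀y : y < y₀ := lt_of_le_of_ne h1'.1 fun h => by
      have := hyp.2; rw [h] at this; exact this.ne' h2
    refine ⟨y₀, hball y₀ h1, h2, Or.inr ⟨y, hyp.1, hy₀y, fun x hx => ?_⟩⟩
    have hxm : x ∈ uIcc x₀ y := by
      rw [uIcc_of_ge hlt.le]; exact ⟨hx.1, hx.2.le.trans h1'.2⟩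
    exact hpos x hxm fun h => absurd (hmin ⟨hxm, h⟩) (not_le.2 hx.2)

/-- The production stays away from zero if the weight is positive at an end point of a component of
the positivity set of the limit. -/
theorem production_eventually_ge_of_endpoint {a b K M E y₀ : ℝ} {v φ : ℝ → ℝ}
    {w p q z : ℕ → ℝ → ℝ} (hab : a < b) (hM : 1 ≤ M)
    (S : ∀ k, Slice a b (w k) (p k) (q k) (z k))
    (hwM : ∀ k, ∀ x ∈ Icc a b, w k x ≤ M) (hE : ∀ k, ∫ x in Ioo a b, p k x ^ 2 ≤ E)
    (hD : Tendsto (fun k => ∫ x in Ioo a b, w k x ^ 3 * z k x ^ 2) atTop (𝓝 0))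
    (hv : TendstoUniformlyOn w v atTop (Icc a b)) (hφ : Weight a b K φ)
    (hy₀ : y₀ ∈ Ioo a b) (hvy₀ : v y₀ = 0) (hφy : 0 < φ y₀)
    (hend : (∃ y ∈ Ioo a b, y₀ < y ∧ ∀ x ∈ Ioc y₀ y, 0 < v x) ∨
        (∃ y ∈ Ioo a b, y < y₀ ∧ ∀ x ∈ Ico y y₀, 0 < v x)) :
    ∃ m, 0 < m ∧ ∀ᶠ k in atTop, m ≤ production a b (w k) (p k) (q k) φ := by
  have hvc : ContinuousOn v (Icc a b) := hv.continuousOn (Frequently.of_forall fun k => (S k).w_cont)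
  have hv0 : ∀ x ∈ Icc a b, 0 ≤ v x := fun x hx =>
    ge_of_tendsto' (hv.tendsto_at hx) fun k => (S k).nonneg x hx
  have hq := locallyQuadratic_of_limit S hD hv
  obtain ⟨r, hr, hrφ⟩ := Metric.eventually_nhds_iff.1
    (hφ.test.continuous.continuousAt.eventually (lt_mem_nhds (half_lt_self hφy)))
  rcases hend with ⟨y, hy, hlt, hpos⟩ | ⟨y, hy, hlt, hpos⟩
  · obtain ⟨s, γ, hs, hform⟩ := hq.left_slope hvc hv0 hy₀.1.le hlt hy.2.le hvy₀ hpos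
    -- Within distance `ρ` the weight stays above half its value at `y₀`, and the slope of the
    -- parabola changes by at most `s / 2`, leaving `2 * (s / 4)`.
    obtain ⟨ρ, hρ, hρ1, hρ2, hρ3⟩ : ∃ ρ, 0 < ρ ∧ ρ ≤ y - y₀ ∧ ρ < r ∧ 2 * |γ| * ρ ≤ s / 2 := by
      refine ⟨min (y - y₀) (min (r / 2) (s / (4 * (|γ| + 1)))), ?_, min_le_left _ _, ?_, ?_⟩
      · exact lt_min (by linarith) (lt_min (by linarith) (by positivity))
      · exact ((min_le_right _ _).trans (min_le_left _ _)).trans_lt (by linarith)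
      · have h1 : min (y - y₀) (min (r / 2) (s / (4 * (|γ| + 1)))) ≤ s / (4 * (|γ| + 1)) :=
          (min_le_right _ _).trans (min_le_right _ _)
        calc _ ≤ 2 * (|γ| + 1) * (s / (4 * (|γ| + 1))) := by gcongr; linarith
          _ = s / 2 := by field_simp; norm_num
    refine production_eventually_ge (φ₀ := φ y₀ / 2) (s₀ := s / 4) (V := v (y₀ + ρ)) hab hM S hwM hE
      hD hv hφ (by positivity) (by positivity) (hpos _ ⟨by linarith, by linarith⟩) fun η hη hηV => ?_
    -- The interval must lie in `{v > 0}`, so it starts strictly after `y₀`, yet so close that the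
    -- level `η / 2` is still ahead. Thus every level below `v (y₀ + ρ)` is crossed.
    obtain ⟨c, hc1, hc2, hc3⟩ : ∃ c, y₀ < c ∧ c < y₀ + ρ ∧ v c < η / 2 := by
      have t1 : Tendsto v (𝓝[>] y₀) (𝓝 0) := by
        have := (hvc.continuousAt (Icc_mem_nhds hy₀.1 hy₀.2)).tendsto
        rw [hvy₀] at this
        exact this.mono_left nhdsWithin_le_nhds
      obtain ⟨c, h1, h2, h3⟩ := ((t1.eventually_lt_const (half_pos hη)).and
        ((eventually_nhdsWithin_of_eventually_nhds (eventually_lt_nhds (by linarith : y₀ < y₀ + ρ))).and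
          self_mem_nhdsWithin)).exists
      exact ⟨c, h3, h2, h1⟩
    refine ⟨c, y₀ + ρ, by linarith [hy₀.1], hc2, by linarith [hy.2], ?_, ?_, ?_, Or.inl ⟨hc3, hηV⟩⟩
    · exact fun x hx => hpos x ⟨hc1.trans_le hx.1, by linarith [hx.2]⟩
    · refine fun x hx => (hrφ ?_).le
      rw [Real.dist_eq, abs_lt]
      constructor <;> linarith [hx.1, hx.2]
    · intro α' β' γ' hquad x hx
      obtain ⟨-, rfl, rfl⟩ := quadratic_coeffs_unique (α := - s * y₀ + γ * y₀ ^ 2)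
        (β := s - 2 * γ * y₀) (γ := γ) hc2 fun x hx => by
          rw [← hquad x hx, hform x ⟨by linarith [hx.1], by linarith [hx.2]⟩]
          ring
      have h1 : |2 * γ * (x - y₀)| ≤ s / 2 := by
        rw [abs_mul, abs_mul, abs_of_pos (by norm_num : (0 : ℝ) < 2),
          abs_of_nonneg (by linarith [hx.1] : 0 ≤ x - y₀)]
        refine le_trans ?_ hρ3
        gcongr
        linarith [hx.2]
      refine le_trans ?_ (le_abs_self _)
      rw [abs_le] at h1
      linarith [h1.1]
  · obtain ⟨s, γ, hs, hform⟩ := hq.right_slope hvc hv0 hy₀.2.le hlt hy.1.le hvy₀ hpos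
    obtain ⟨ρ, hρ, hρ1, hρ2, hρ3⟩ : ∃ ρ, 0 < ρ ∧ ρ ≤ y₀ - y ∧ ρ < r ∧ 2 * |γ| * ρ ≤ s / 2 := by
      refine ⟨min (y₀ - y) (min (r / 2) (s / (4 * (|γ| + 1)))), ?_, min_le_left _ _, ?_, ?_⟩
      · exact lt_min (by linarith) (lt_min (by linarith) (by positivity))
      · exact ((min_le_right _ _).trans (min_le_left _ _)).trans_lt (by linarith)
      · have h1 : min (y₀ - y) (min (r / 2) (s / (4 * (|γ| + 1)))) ≤ s / (4 * (|γ| + 1)) :=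
          (min_le_right _ _).trans (min_le_right _ _)
        calc _ ≤ 2 * (|γ| + 1) * (s / (4 * (|γ| + 1))) := by gcongr; linarith
          _ = s / 2 := by field_simp; norm_num
    refine production_eventually_ge (φ₀ := φ y₀ / 2) (s₀ := s / 4) (V := v (y₀ - ρ)) hab hM S hwM hE
      hD hv hφ (by positivity) (by positivity) (hpos _ ⟨by linarith, by linarith⟩) fun η hη hηV => ?_
    obtain ⟨e, he1, he2, he3⟩ : ∃ e, e < y₀ ∧ y₀ - ρ < e ∧ v e < η / 2 := by
      have t1 : Tendsto v (𝓝[<] y₀) (𝓝 0) := by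
        have := (hvc.continuousAt (Icc_mem_nhds hy₀.1 hy₀.2)).tendsto
        rw [hvy₀] at this
        exact this.mono_left nhdsWithin_le_nhds
      obtain ⟨c, h1, h2, h3⟩ := ((t1.eventually_lt_const (half_pos hη)).and
        ((eventually_nhdsWithin_of_eventually_nhds (eventually_gt_nhds (by linarith : y₀ - ρ < y₀))).and
          self_mem_nhdsWithin)).exists
      exact ⟨c, h3, h2, h1⟩
    refine ⟨y₀ - ρ, e, by linarith [hy.1], he2, by linarith [hy₀.2], ?_, ?_, ?_, Or.inr ⟨he3, hηV⟩⟩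
    · exact fun x hx => hpos x ⟨by linarith [hx.1], hx.2.trans_lt he1⟩
    · refine fun x hx => (hrφ ?_).le
      rw [Real.dist_eq, abs_lt]
      constructor <;> linarith [hx.1, hx.2]
    · intro α' β' γ' hquad x hx
      obtain ⟨-, rfl, rfl⟩ := quadratic_coeffs_unique (α := s * y₀ + γ * y₀ ^ 2)
        (β := - s - 2 * γ * y₀) (γ := γ) he2 fun x hx => by
          rw [← hquad x hx, hform x ⟨by linarith [hx.1], by linarith [hx.2]⟩]
          ring
      have h1 : |2 * γ * (x - y₀)| ≤ s / 2 := by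
        rw [abs_mul, abs_mul, abs_of_pos (by norm_num : (0 : ℝ) < 2),
          abs_of_nonpos (by linarith [hx.2] : x - y₀ ≤ 0)]
        refine le_trans ?_ hρ3
        gcongr
        linarith [hx.1]
      refine le_trans ?_ (neg_le_abs _)
      rw [abs_le] at h1
      linarith [h1.2]

end ThinFilm

namespace ThinFilm

/-! ### Asymptotics of `B` -/

theorem rpow_neg_two_eq {v : ℝ} : v ^ (-2 : ℝ) = 1 / v ^ 2 := by
  rw [show (-2 : ℝ) = ((-2 : ℤ) : ℝ) by norm_num, Real.rpow_intCast]
  simp [zpow_neg]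

theorem dB_integrand_nonneg (n : ℝ) {v : ℝ} (hv : 0 < v) : 0 ≤ 1 / (v ^ (n - 1) + v ^ 2) := by
  have := Real.rpow_pos_of_pos hv (n - 1)
  positivity

theorem dB_integrand_le (n : ℝ) {v : ℝ} (hv : 0 < v) :
    1 / (v ^ (n - 1) + v ^ 2) ≤ v ^ (-2 : ℝ) := by
  have := Real.rpow_pos_of_pos hv (n - 1)
  rw [rpow_neg_two_eq]
  gcongr
  linarith

/-- For `n < 3` the exponent `1 + n / 3` lies between `n - 1` and `2`, so one power works for both
small and large `v`. It exceeds one, giving decay at infinity, and the resulting bound `r ^ (-(n /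
3))` for `dB` is integrable at zero. -/
theorem dB_integrand_le_rpow {n : ℝ} (hn3 : n < 3) {v : ℝ} (hv : 0 < v) :
    1 / (v ^ (n - 1) + v ^ 2) ≤ v ^ (-(1 + n / 3)) := by
  have h1 := Real.rpow_pos_of_pos hv (n - 1)
  rw [Real.rpow_neg hv.le, ← one_div]
  have h2 : v ^ (1 + n / 3) ≤ v ^ (n - 1) + v ^ 2 := by
    rcases le_total v 1 with h | h
    · have := Real.rpow_le_rpow_of_exponent_ge hv h (by linarith : n - 1 ≤ 1 + n / 3)
      have h3 : 0 ≤ v ^ 2 := by positivity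
      linarith
    · have := Real.rpow_le_rpow_of_exponent_le h (by linarith : 1 + n / 3 ≤ 2)
      rw [Real.rpow_two] at this
      linarith
  have h3 := Real.rpow_pos_of_pos hv (1 + n / 3)
  gcongr

/-- This is `1 / (1 + x) ≥ 1 - x` with `x = v ^ (n - 3)`, multiplied by `v⁻²`. -/
theorem dB_integrand_ge {n v : ℝ} (hv : 0 < v) :
    v ^ (-2 : ℝ) - v ^ (n - 5) ≤ 1 / (v ^ (n - 1) + v ^ 2) := by
  have h1 := Real.rpow_pos_of_pos hv (n - 1)
  have h2 : v ^ (n - 5) = v ^ (n - 1) / v ^ 4 := by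
    rw [show n - 5 = (n - 1) - (4 : ℕ) by push_cast; ring, Real.rpow_sub_natCast hv.ne']
  rw [rpow_neg_two_eq, h2, sub_le_iff_le_add, div_add_div _ _ (by positivity) (by positivity),
    div_le_div_iff₀ (by positivity) (by positivity)]
  nlinarith [mul_pos h1 h1, pow_pos hv 2, pow_pos hv 4]

theorem dB_integrand_integrableOn (n : ℝ) {r : ℝ} (hr : 0 < r) :
    IntegrableOn (fun v : ℝ => 1 / (v ^ (n - 1) + v ^ 2)) (Ioi r) := by
  refine Integrable.mono' (integrableOn_Ioi_rpow_of_lt (by norm_num : (-2 : ℝ) < -1) hr) ?_ ?_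
  · exact Measurable.aestronglyMeasurable (by fun_prop)
  · refine (ae_restrict_mem measurableSet_Ioi).mono fun v hv => ?_
    have hv0 : 0 < v := hr.trans hv
    rw [Real.norm_of_nonneg (dB_integrand_nonneg n hv0)]
    exact dB_integrand_le n hv0

theorem dB_nonneg (n : ℝ) {r : ℝ} (hr : 0 ≤ r) : 0 ≤ dB n r :=
  setIntegral_nonneg measurableSet_Ioi fun _ hv => dB_integrand_nonneg n (lt_of_le_of_lt hr hv)

theorem dB_le_inv (n : ℝ) {r : ℝ} (hr : 0 < r) : dB n r ≤ r⁻¹ := by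
  have h1 := setIntegral_mono_on (dB_integrand_integrableOn n hr)
    (integrableOn_Ioi_rpow_of_lt (by norm_num : (-2 : ℝ) < -1) hr) measurableSet_Ioi
    fun v hv => dB_integrand_le n (hr.trans hv)
  rw [integral_Ioi_rpow_of_lt (by norm_num) hr] at h1
  refine h1.trans_eq ?_
  rw [show (-2 : ℝ) + 1 = -1 by norm_num, Real.rpow_neg_one]
  ring

theorem dB_le_rpow {n : ℝ} (hn0 : 0 < n) (hn3 : n < 3) {r : ℝ} (hr : 0 < r) :
    dB n r ≤ 3 / n * r ^ (-(n / 3)) := by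
  have h1 := setIntegral_mono_on (dB_integrand_integrableOn n hr)
    (integrableOn_Ioi_rpow_of_lt (by linarith : -(1 + n / 3) < -1) hr) measurableSet_Ioi
    fun v hv => dB_integrand_le_rpow hn3 (hr.trans hv)
  rw [integral_Ioi_rpow_of_lt (by linarith) hr] at h1
  refine h1.trans_eq ?_
  rw [show -(1 + n / 3) + 1 = -(n / 3) by ring]
  field_simp

theorem dB_ge {n : ℝ} (hn3 : n < 3) {r : ℝ} (hr : 0 < r) :
    r⁻¹ - r ^ (n - 4) / (4 - n) ≤ dB n r := by
  have i1 := integrableOn_Ioi_rpow_of_lt (by norm_num : (-2 : ℝ) < -1) hr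
  have i2 := integrableOn_Ioi_rpow_of_lt (by linarith : n - 5 < -1) hr
  have h1 := setIntegral_mono_on (i1.sub i2) (dB_integrand_integrableOn n hr) measurableSet_Ioi
    fun v hv => dB_integrand_ge (hr.trans hv)
  have h2 := integral_sub i1 i2
  simp only [Pi.sub_apply] at h1
  rw [h2, integral_Ioi_rpow_of_lt (by norm_num) hr, integral_Ioi_rpow_of_lt (by linarith) hr] at h1
  refine le_trans (le_of_eq ?_) h1
  rw [show (-2 : ℝ) + 1 = -1 by norm_num, Real.rpow_neg_one, show n - 5 + 1 = n - 4 by ring]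
  have : n - 4 ≠ 0 := by linarith
  have : 4 - n ≠ 0 := by linarith
  field_simp
  ring

theorem dB_antitoneOn (n : ℝ) : AntitoneOn (dB n) (Ioi 0) := fun _ hr _ _ hrs =>
  setIntegral_mono_set (dB_integrand_integrableOn n hr)
    ((ae_restrict_mem measurableSet_Ioi).mono fun _ hv =>
      dB_integrand_nonneg n (lt_trans hr hv)) (Eventually.of_forall (Ioi_subset_Ioi hrs))

theorem dB_intervalIntegrable {n : ℝ} (hn0 : 0 < n) (hn3 : n < 3) {s t : ℝ} (hs : 0 ≤ s)
    (ht : 0 ≤ t) : IntervalIntegrable (dB n) volume s t := by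
  have hsub : uIoc s t ⊆ Ioi 0 := fun x hx => lt_of_le_of_lt (le_min hs ht) hx.1
  have h1 : IntervalIntegrable (fun r : ℝ => 3 / n * r ^ (-(n / 3))) volume s t :=
    (intervalIntegral.intervalIntegrable_rpow' (by linarith)).const_mul _
  refine h1.mono_fun' ?_ ?_
  · exact ((aemeasurable_restrict_of_antitoneOn measurableSet_Ioi
      (dB_antitoneOn n)).aestronglyMeasurable).mono_measure (Measure.restrict_mono hsub le_rfl)
  · refine (ae_restrict_mem measurableSet_uIoc).mono fun r hr => ?_
    have hr0 : 0 < r := hsub hr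
    refine (Real.norm_of_nonneg (dB_nonneg n hr0.le)).trans_le ?_
    exact dB_le_rpow hn0 hn3 hr0

theorem B_sub {n : ℝ} (hn0 : 0 < n) (hn3 : n < 3) {s t : ℝ} (hs : 0 ≤ s) (ht : 0 ≤ t) :
    B n t - B n s = ∫ r in s..t, dB n r := by
  rw [B, B, sub_eq_iff_eq_add, add_comm, intervalIntegral.integral_add_adjacent_intervals
    (dB_intervalIntegrable hn0 hn3 le_rfl hs) (dB_intervalIntegrable hn0 hn3 hs ht)]

theorem B_mono {n : ℝ} (hn0 : 0 < n) (hn3 : n < 3) {s t : ℝ} (hs : 0 ≤ s) (hst : s ≤ t) :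
    B n s ≤ B n t := by
  have h1 := B_sub hn0 hn3 hs (hs.trans hst)
  have h2 : 0 ≤ ∫ r in s..t, dB n r :=
    intervalIntegral.integral_nonneg hst fun r hr => dB_nonneg n (hs.trans hr.1)
  linarith

theorem B_nonneg (n : ℝ) {s : ℝ} (hs : 0 ≤ s) : 0 ≤ B n s :=
  intervalIntegral.integral_nonneg hs fun _ hr => dB_nonneg n hr.1

theorem B_le_log {n : ℝ} (hn0 : 0 < n) (hn3 : n < 3) {s : ℝ} (hs : 1 ≤ s) :
    B n s ≤ B n 1 + Real.log s := by
  have h1 := B_sub hn0 hn3 zero_le_one (zero_le_one.trans hs)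
  have h0 : (0 : ℝ) ∉ uIcc 1 s := by rw [uIcc_of_le hs]; exact fun h => absurd h.1 (by norm_num)
  have h2 := intervalIntegral.integral_mono_on hs
    (dB_intervalIntegrable hn0 hn3 zero_le_one (zero_le_one.trans hs))
    (intervalIntegral.intervalIntegrable_inv (μ := volume) (f := fun r => r)
      (fun r hr => ne_of_mem_of_not_mem hr h0) continuousOn_id)
    fun r hr => dB_le_inv n (zero_lt_one.trans_le hr.1)
  rw [integral_inv h0, div_one] at h2
  linarith

/-- Integrating `dB_ge` from `1` gives the logarithm; the correction is at most `∫_1^∞ r ^ (n - 4) /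
(4 - n) dr`, finite because `n < 3`. -/
theorem B_ge_log {n : ℝ} (hn0 : 0 < n) (hn3 : n < 3) {s : ℝ} (hs : 1 ≤ s) :
    Real.log s - 1 / ((4 - n) * (3 - n)) ≤ B n s := by
  have h1 := B_sub hn0 hn3 zero_le_one (zero_le_one.trans hs)
  have h0 : (0 : ℝ) ∉ uIcc 1 s := by rw [uIcc_of_le hs]; exact fun h => absurd h.1 (by norm_num)
  have i1 : IntervalIntegrable (fun r : ℝ => r⁻¹) volume 1 s :=
    intervalIntegral.intervalIntegrable_inv (μ := volume) (f := fun r => r)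
      (fun r hr => ne_of_mem_of_not_mem hr h0) continuousOn_id
  have i2 : IntervalIntegrable (fun r : ℝ => r ^ (n - 4)) volume 1 s :=
    intervalIntegral.intervalIntegrable_rpow (Or.inr h0)
  have h2 := intervalIntegral.integral_mono_on hs (i1.sub (i2.div_const (4 - n)))
    (dB_intervalIntegrable hn0 hn3 zero_le_one (zero_le_one.trans hs))
    fun r hr => dB_ge hn3 (zero_lt_one.trans_le hr.1)
  rw [intervalIntegral.integral_sub i1 (i2.div_const _), integral_inv h0, div_one,
    intervalIntegral.integral_div, integral_rpow (Or.inr ⟨by linarith, h0⟩), Real.one_rpow] at h2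
  have h3 : 0 ≤ s ^ (n - 4 + 1) := Real.rpow_nonneg (by linarith) _
  have h4 : (s ^ (n - 4 + 1) - 1) / (n - 4 + 1) / (4 - n) ≤ 1 / ((4 - n) * (3 - n)) := by
    have e : (s ^ (n - 4 + 1) - 1) / (n - 4 + 1) / (4 - n)
        = (1 - s ^ (n - 4 + 1)) / ((4 - n) * (3 - n)) := by
      have : n - 4 + 1 ≠ 0 := by linarith
      have : 3 - n ≠ 0 := by linarith
      have : 4 - n ≠ 0 := by linarith
      field_simp
      ring
    rw [e]
    have : 0 < (4 - n) * (3 - n) := mul_pos (by linarith) (by linarith)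
    gcongr
    linarith
  have h5 := B_nonneg n zero_le_one
  linarith

/-! ### The rescaled function `B^ε` and its limit value one. -/

theorem Beps_nonneg (n : ℝ) {ε s : ℝ} (hε : 0 < ε) (hs : 0 ≤ s) : 0 ≤ Beps n ε s :=
  mul_nonneg (by positivity) (B_nonneg n (by positivity))

theorem abs_log_pos {ε : ℝ} (hε : ε ∈ Ioo (0 : ℝ) 1) : 0 < |Real.log ε| :=
  abs_pos.2 (Real.log_neg hε.1 hε.2).ne

/-- `log (M / ε) = log M + |ln ε|`, and dividing by `|ln ε|` leaves the main term `1`. -/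
theorem Beps_le {n : ℝ} (hn0 : 0 < n) (hn3 : n < 3) {ε s M : ℝ} (hε : ε ∈ Ioo (0 : ℝ) 1)
    (hM : 1 ≤ M) (hs : 0 ≤ s) (hsM : s ≤ M) :
    Beps n ε s ≤ 1 + (B n 1 + Real.log M) / |Real.log ε| := by
  have hl := abs_log_pos hε
  have h1 : 1 ≤ M / ε := by rw [le_div_iff₀ hε.1]; linarith [hε.2]
  have h2 : B n (s / ε) ≤ B n 1 + Real.log (M / ε) :=
    (B_mono hn0 hn3 (div_nonneg hs hε.1.le) (by have := hε.1; gcongr)).trans (B_le_log hn0 hn3 h1)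
  rw [Real.log_div (by linarith) hε.1.ne'] at h2
  have h3 : |Real.log ε| = - Real.log ε := abs_of_neg (Real.log_neg hε.1 hε.2)
  rw [Beps, inv_mul_eq_div, div_le_iff₀ hl, add_mul, div_mul_cancel₀ _ hl.ne', one_mul]
  linarith

theorem Beps_ge {n : ℝ} (hn0 : 0 < n) (hn3 : n < 3) {ε s δ : ℝ} (hε : ε ∈ Ioo (0 : ℝ) 1)
    (hδ : ε ≤ δ) (hs : δ ≤ s) :
    1 + (Real.log δ - 1 / ((4 - n) * (3 - n))) / |Real.log ε| ≤ Beps n ε s := by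
  have hl := abs_log_pos hε
  have hδ0 : 0 < δ := hε.1.trans_le hδ
  have h1 : 1 ≤ δ / ε := by rw [le_div_iff₀ hε.1]; linarith
  have h2 := (B_ge_log hn0 hn3 h1).trans
    (B_mono hn0 hn3 (zero_le_one.trans h1) (by have := hε.1; gcongr : δ / ε ≤ s / ε))
  rw [Real.log_div hδ0.ne' hε.1.ne'] at h2
  have h3 : |Real.log ε| = - Real.log ε := abs_of_neg (Real.log_neg hε.1 hε.2)
  rw [Beps, inv_mul_eq_div, le_div_iff₀ hl, add_mul, div_mul_cancel₀ _ hl.ne', one_mul]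
  linarith

/-- Monotonicity of `B` is available for non-negative arguments; the truncation makes the function
monotone, hence measurable, on the whole line. -/
theorem measurable_Beps_max {n : ℝ} (hn0 : 0 < n) (hn3 : n < 3) {ε : ℝ} (hε : 0 < ε) :
    Measurable fun s => Beps n ε (max s 0) := by
  have : Monotone fun s => B n (max s 0 / ε) := fun s t hst =>
    B_mono hn0 hn3 (div_nonneg (le_max_right _ _) hε.le) (by gcongr)
  exact this.measurable.const_mul _

/-! ### The mobility and the control of the flux. -/

theorem mobility_nonneg (n : ℝ) {ε s : ℝ} (hε : 0 ≤ ε) (hs : 0 ≤ s) : 0 ≤ mobility n ε s := by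
  have h1 := Real.rpow_nonneg hε (3 - n)
  have h2 := Real.rpow_nonneg hs n
  rw [mobility]
  positivity

theorem cube_le_mobility (n : ℝ) {ε s : ℝ} (hε : 0 ≤ ε) (hs : 0 ≤ s) : s ^ 3 ≤ mobility n ε s := by
  have h1 := Real.rpow_nonneg hε (3 - n)
  have h2 := Real.rpow_nonneg hs n
  rw [mobility]
  nlinarith [mul_nonneg h1 h2]

/-- For `r ≤ 1` use `dB ≤ (3 / n) r ^ (-(n / 3))`, whose square times `r ^ n` is `r ^ (n / 3)` up to
a constant; for `r ≥ 1` use `dB ≤ 1 / r`, which gives linear growth. -/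
theorem dB_sq_mul_le {n : ℝ} (hn0 : 0 < n) (hn3 : n < 3) {r : ℝ} (hr : 0 < r) :
    dB n r ^ 2 * (r ^ n + r ^ 3) ≤ (2 + 18 / n ^ 2) * (1 + r) := by
  have h0 := dB_nonneg n hr.le
  have hrn := Real.rpow_pos_of_pos hr n
  have hc : 0 ≤ 18 / n ^ 2 := by positivity
  rcases le_total r 1 with h | h
  · have h1 := dB_le_rpow hn0 hn3 hr
    have h2 : r ^ 3 ≤ r ^ n := by
      rw [← Real.rpow_natCast]
      exact Real.rpow_le_rpow_of_exponent_ge hr h (by push_cast; linarith)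
    have h3 : (r ^ (-(n / 3))) ^ 2 * r ^ n ≤ 1 := by
      rw [← Real.rpow_natCast, ← Real.rpow_mul hr.le, ← Real.rpow_add hr]
      exact Real.rpow_le_one hr.le h (by push_cast; linarith)
    calc dB n r ^ 2 * (r ^ n + r ^ 3) ≤ (3 / n * r ^ (-(n / 3))) ^ 2 * (r ^ n + r ^ n) := by gcongr
      _ = 18 / n ^ 2 * ((r ^ (-(n / 3))) ^ 2 * r ^ n) := by field_simp; ring
      _ ≤ 18 / n ^ 2 * 1 := by gcongr
      _ ≤ _ := by nlinarith
  · have h1 := dB_le_inv n hr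
    have h2 : r ^ n ≤ r ^ 3 := by
      rw [← Real.rpow_natCast r 3]
      exact Real.rpow_le_rpow_of_exponent_le h (by push_cast; linarith)
    calc dB n r ^ 2 * (r ^ n + r ^ 3) ≤ r⁻¹ ^ 2 * (r ^ 3 + r ^ 3) := by gcongr
      _ = 2 * r := by field_simp; ring
      _ ≤ _ := by nlinarith

/-- The flux `R` is controlled by the dissipation. -/
theorem flux_le {n : ℝ} (hn0 : 0 < n) (hn3 : n < 3) {ε s M η z : ℝ} (hε : ε ∈ Ioo (0 : ℝ) 1)
    (hs : 0 < s) (hsM : s ≤ M) (hη : 0 < η) :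
    |-(|Real.log ε| * dBeps n ε s * mobility n ε s * z)|
      ≤ η * ((2 + 18 / n ^ 2) * (1 + M)) + mobility n ε s * z ^ 2 / η := by
  have hl := abs_log_pos hε
  have hε0 := hε.1
  set A := ε⁻¹ * dB n (s / ε) with hA
  have hA0 : 0 ≤ A := mul_nonneg (by positivity) (dB_nonneg n (by positivity))
  set m := mobility n ε s with hm
  have hm0 : 0 ≤ m := mobility_nonneg n hε.1.le hs.le
  -- The mobility scales as `ε³ (r ^ n + r³)` with `r = s / ε`, so `A² m` is `ε` times the quantity
  -- in `dB_sq_mul_le`, hence at most a constant times `ε + s`.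
  have hAm : A ^ 2 * m ≤ (2 + 18 / n ^ 2) * (1 + M) := by
    have h1 := dB_sq_mul_le hn0 hn3 (div_pos hs hε.1)
    have h2 : m = ε ^ 3 * ((s / ε) ^ n + (s / ε) ^ 3) := by
      rw [hm, mobility, Real.div_rpow hs.le hε.1.le, Real.rpow_sub hε.1,
        show (3 : ℝ) = ((3 : ℕ) : ℝ) by norm_num, Real.rpow_natCast]
      have := Real.rpow_pos_of_pos hε.1 n
      field_simp
    have h3 : A ^ 2 * m = ε * (dB n (s / ε) ^ 2 * ((s / ε) ^ n + (s / ε) ^ 3)) := by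
      rw [h2, hA]; field_simp
    rw [h3]
    calc _ ≤ ε * ((2 + 18 / n ^ 2) * (1 + s / ε)) := by gcongr
      _ = (2 + 18 / n ^ 2) * (ε + s) := by field_simp
      _ ≤ _ := by gcongr; exact hε.2.le
  have h4 : |-(|Real.log ε| * dBeps n ε s * m * z)| = A * m * |z| := by
    have : |Real.log ε| * dBeps n ε s = A := by rw [dBeps, ← hA, mul_inv_cancel_left₀ hl.ne']
    rw [this, abs_neg, abs_mul, abs_of_nonneg (mul_nonneg hA0 hm0)]
  have h5 : A * m * |z| ≤ η * (A ^ 2 * m) + m * z ^ 2 / η := by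
    have : η * (A ^ 2 * m) + m * z ^ 2 / η - A * m * |z|
        = m * ((η * A - |z|) ^ 2 + η * A * |z|) / η := by
      rw [← sq_abs z]; field_simp; ring
    have h6 : 0 ≤ m * ((η * A - |z|) ^ 2 + η * A * |z|) / η := by positivity
    linarith
  rw [h4]
  refine h5.trans ?_
  gcongr

end ThinFilm

namespace ThinFilm

/-! ### Regularity of profiles with weak derivatives -/

theorem IsTest.exists_Icc_deriv {c d : ℝ} (hcd : c < d) {φ : ℝ → ℝ} (h : IsTest (Ioo c d) φ) :
    ∃ l r, c < l ∧ l < r ∧ r < d ∧ (∀ x, x ∉ Ioo l r → φ x = 0) ∧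
      ∀ x, x ∉ Ioo l r → deriv φ x = 0 := by
  obtain ⟨l, r, h1, h2, h3, h0⟩ := h.exists_Icc hcd
  obtain ⟨l', h1', h4⟩ := exists_between h1
  obtain ⟨r', h5, h3'⟩ := exists_between h3
  refine ⟨l', r', h1', h4.trans (h2.trans h5), h3', fun x hx => h0 x fun hx' =>
    hx ⟨h4.trans hx'.1, hx'.2.trans h5⟩, fun x hx => ?_⟩
  have hx' : x ∉ Icc l r := fun hx' => hx ⟨h4.trans_le hx'.1, hx'.2.trans_lt h5⟩
  have : φ =ᶠ[𝓝 x] fun _ => 0 := by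
    filter_upwards [isClosed_Icc.isOpen_compl.mem_nhds hx'] with y hy
      using h0 y fun h => hy (Ioo_subset_Icc_self h)
  rw [this.deriv_eq, deriv_const]

theorem IsTest.setIntegral_eq {U V : Set ℝ} {φ f : ℝ → ℝ} (hU : MeasurableSet U) (hVU : V ⊆ U)
    (hφ : IsTest V φ) : ∫ x in U, f x * φ x = ∫ x in V, f x * φ x :=
  setIntegral_eq_of_subset_of_forall_sdiff_eq_zero hU hVU fun x hx => by
    rw [hφ.eq_zero hx.2, mul_zero]

theorem integral_mul_deriv_of_hasDerivAt {l r : ℝ} (hlr : l < r) {w p φ : ℝ → ℝ}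
    (hw : ∀ x ∈ Ioo l r, HasDerivAt w (p x) x) (hp : ContinuousOn p (Ioo l r))
    (hφ : IsTest (Ioo l r) φ) :
    ∫ x in Ioo l r, w x * deriv φ x = - ∫ x in Ioo l r, p x * φ x := by
  obtain ⟨c, d, hc, hcd, hd, h0, h0'⟩ := hφ.exists_Icc_deriv hlr
  rw [setIntegral_eq_intervalIntegral_of_eq_zero hc hcd hd (fun x hx => by simp [h0' x hx]),
    setIntegral_eq_intervalIntegral_of_eq_zero hc hcd hd (fun x hx => by simp [h0 x hx])]
  have hsub : uIcc c d ⊆ Ioo l r := by rw [uIcc_of_le hcd.le]; exact Icc_subset_Ioo hc hd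
  rw [intervalIntegral.integral_mul_deriv_eq_deriv_mul (fun x hx => hw x (hsub hx))
    (fun x _ => (hφ.differentiable x).hasDerivAt) (hp.mono hsub).intervalIntegrable
    (hφ.derivative.continuous.intervalIntegrable _ _), h0 c (by simp), h0 d (by simp)]
  ring

/-- A continuous function with an integrable weak derivative is its primitive up to the boundary. -/
theorem sub_eq_integral_of_hasWeakDeriv {a b : ℝ} (hab : a < b) {f g : ℝ → ℝ}
    (hf : ContinuousOn f (Icc a b)) (hg : IntegrableOn g (Ioo a b))
    (h : ∀ φ, IsTest (Ioo a b) φ →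
      ∫ x in Ioo a b, f x * deriv φ x = - ∫ x in Ioo a b, g x * φ x) :
    ∀ x ∈ Icc a b, ∀ y ∈ Icc a b, f y - f x = ∫ s in x..y, g s := by
  obtain ⟨x₀, hx₀⟩ := exists_between hab
  obtain ⟨C, hC⟩ := ae_eq_primitive hx₀
    ((hf.mono Ioo_subset_Icc_self).locallyIntegrableOn measurableSet_Ioo)
    hg.locallyIntegrableOn h
  have hgi : IntervalIntegrable g volume a b := (intervalIntegrable_iff_integrableOn_Ioo_of_le hab.le).2 hg
  have hmem : x₀ ∈ uIcc a b := by rw [uIcc_of_le hab.le]; exact Ioo_subset_Icc_self hx₀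
  have hcont := (hgi.absolutelyContinuousOnInterval_intervalIntegral hmem).continuousOn
  rw [uIcc_of_le hab.le] at hcont
  have heq : EqOn f (fun x => C + ∫ y in x₀..x, g y) (Icc a b) := by
    refine Measure.eqOn_Icc_of_ae_eq volume hab.ne ?_ hf (continuousOn_const.add hcont)
    rw [Filter.EventuallyEq, ← restrict_Ioo_eq_restrict_Icc, ae_restrict_iff' measurableSet_Ioo]
    exact hC
  intro x hx y hy
  have hsub : ∀ s ∈ Icc a b, ∀ t ∈ Icc a b, IntervalIntegrable g volume s t := fun s hs t ht =>
    hgi.mono_set (by rw [uIcc_of_le hab.le]; exact ordConnected_Icc.uIcc_subset hs ht)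
  have hx₀' := Ioo_subset_Icc_self (α := ℝ) (show x₀ ∈ Ioo a b from hx₀)
  rw [heq hx, heq hy]
  simp only
  rw [← intervalIntegral.integral_add_adjacent_intervals (hsub x₀ hx₀' x hx)
    (hsub x hx y hy)]
  ring

theorem hasDerivAt_of_sub_eq_integral {l r : ℝ} {f g : ℝ → ℝ} (hg : ContinuousOn g (Ioo l r))
    (h : ∀ x ∈ Ioo l r, ∀ y ∈ Ioo l r, f y - f x = ∫ s in x..y, g s) :
    ∀ x ∈ Ioo l r, HasDerivAt f (g x) x := by
  intro x hx
  have hnh : Ioo l r ∈ 𝓝 x := Ioo_mem_nhds hx.1 hx.2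
  have h1 : HasDerivAt (fun y => ∫ s in x..y, g s) (g x) x :=
    intervalIntegral.integral_hasDerivAt_right (by simp)
      (hg.stronglyMeasurableAtFilter isOpen_Ioo x hx) (hg.continuousAt hnh)
  refine (h1.const_add (f x)).congr_of_eventuallyEq ?_
  filter_upwards [hnh] with y hy
  rw [← h x hx y hy]
  ring

theorem primitive_continuousOn {l r x₀ : ℝ} (hx₀ : x₀ ∈ Ioo l r) {g : ℝ → ℝ}
    (hg : LocallyIntegrableOn g (Ioo l r)) : ContinuousOn (fun x => ∫ y in x₀..x, g y) (Ioo l r) := by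
  intro x hx
  obtain ⟨c, hc, hc'⟩ := exists_between (lt_min hx.1 hx₀.1)
  obtain ⟨d, hd, hd'⟩ := exists_between (max_lt hx.2 hx₀.2)
  have hcx := hc'.trans_le (min_le_left _ _)
  have hcx0 := hc'.trans_le (min_le_right _ _)
  have hdx := (le_max_left _ _).trans_lt hd
  have hdx0 := (le_max_right _ _).trans_lt hd
  have hi : IntervalIntegrable g volume c d :=
    locallyIntegrableOn_intervalIntegrable hg ⟨hc, hcx.trans hx.2⟩ ⟨hx.1.trans hdx, hd'⟩
  have := (hi.absolutelyContinuousOnInterval_intervalIntegral (c := x₀)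
    (by rw [uIcc_of_le (hcx.trans hdx).le]; exact ⟨hcx0.le, hdx0.le⟩)).continuousOn
  rw [uIcc_of_le (hcx.trans hdx).le] at this
  exact (this.continuousAt (Icc_mem_nhds hcx hdx)).continuousWithinAt

/-- Weak second and third derivatives of a `C¹` function on an interval. -/
theorem exists_second_derivative {l r : ℝ} (hlr : l < r) {w p q₀ z₀ : ℝ → ℝ}
    (hw : ∀ x ∈ Ioo l r, HasDerivAt w (p x) x) (hp : ContinuousOn p (Ioo l r))
    (hq₀ : LocallyIntegrableOn q₀ (Ioo l r)) (hz₀ : LocallyIntegrableOn z₀ (Ioo l r))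
    (h2 : ∀ φ, IsTest (Ioo l r) φ →
      ∫ x in Ioo l r, w x * deriv (deriv φ) x = ∫ x in Ioo l r, q₀ x * φ x)
    (h3 : ∀ φ, IsTest (Ioo l r) φ →
      ∫ x in Ioo l r, w x * deriv (deriv (deriv φ)) x = - ∫ x in Ioo l r, z₀ x * φ x) :
    ∃ q : ℝ → ℝ, (∀ x ∈ Ioo l r, HasDerivAt p (q x) x) ∧ ContinuousOn q (Ioo l r) ∧
      (∀ x ∈ Ioo l r, ∀ y ∈ Ioo l r, q y - q x = ∫ s in x..y, z₀ s) ∧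
      ∀ᵐ x, x ∈ Ioo l r → q₀ x = q x := by
  obtain ⟨x₀, hx₀⟩ := exists_between hlr
  have hx₀ : x₀ ∈ Ioo l r := hx₀
  -- The equations for `w` become equations for `p` and `q₀`: `q₀` is the weak derivative of `p`,
  -- and `z₀` that of `q₀`. Hence `q₀` has a continuous representative, a primitive of `z₀`.
  have hpq : ∀ φ, IsTest (Ioo l r) φ →
      ∫ x in Ioo l r, p x * deriv φ x = - ∫ x in Ioo l r, q₀ x * φ x := fun φ hφ => by
    have := integral_mul_deriv_of_hasDerivAt hlr hw hp hφ.derivative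
    rw [h2 φ hφ] at this
    linarith
  have hqz : ∀ φ, IsTest (Ioo l r) φ →
      ∫ x in Ioo l r, q₀ x * deriv φ x = - ∫ x in Ioo l r, z₀ x * φ x := fun φ hφ => by
    rw [← h2 _ hφ.derivative, h3 φ hφ]
  obtain ⟨C, hC⟩ := ae_eq_primitive hx₀ hq₀ hz₀ hqz
  set q : ℝ → ℝ := fun x => C + ∫ y in x₀..x, z₀ y with hq
  have hqc : ContinuousOn q (Ioo l r) := continuousOn_const.add (primitive_continuousOn hx₀ hz₀)
  have hqp : ∀ x ∈ Ioo l r, ∀ y ∈ Ioo l r, q y - q x = ∫ s in x..y, z₀ s := fun x hx y hy => by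
    rw [hq]
    simp only
    rw [← intervalIntegral.integral_add_adjacent_intervals
      (locallyIntegrableOn_intervalIntegrable hz₀ hx₀ hx)
      (locallyIntegrableOn_intervalIntegrable hz₀ hx hy)]
    ring
  have hpq' : ∀ x ∈ Ioo l r, ∀ y ∈ Ioo l r, p y - p x = ∫ s in x..y, q s := by
    intro x hx y hy
    -- The representative is only known to be continuous in the open interval, so the passage from
    -- weak to integrated form is made on a compact subinterval containing `x` and `y`.
    obtain ⟨c, hc, hc'⟩ := exists_between (lt_min hx.1 hy.1)
    obtain ⟨d, hd, hd'⟩ := exists_between (max_lt hx.2 hy.2)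
    have hcx := hc'.trans_le (min_le_left _ _)
    have hcy := hc'.trans_le (min_le_right _ _)
    have hdx := (le_max_left _ _).trans_lt hd
    have hdy := (le_max_right _ _).trans_lt hd
    have hsub : Icc c d ⊆ Ioo l r := Icc_subset_Ioo hc hd'
    refine sub_eq_integral_of_hasWeakDeriv (hcx.trans hdx) (hp.mono hsub)
      (ContinuousOn.integrableOn_Ioo (hqc.mono hsub)) (fun φ hφ => ?_) x ⟨hcx.le, hdx.le⟩
      y ⟨hcy.le, hdy.le⟩
    have hsub' := Ioo_subset_Icc_self.trans hsub
    have e := hpq φ (hφ.mono hsub')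
    rw [IsTest.setIntegral_eq measurableSet_Ioo hsub' hφ.derivative,
      IsTest.setIntegral_eq measurableSet_Ioo hsub' hφ] at e
    rw [e]
    congr 1
    refine integral_congr_ae ((ae_restrict_iff' measurableSet_Ioo).2 ?_)
    filter_upwards [hC] with s hs hs'
    rw [hs (hsub' hs')]
  exact ⟨q, hasDerivAt_of_sub_eq_integral hqc hpq', hqc, hqp, hC⟩

theorem exists_Ioo_of_uIcc_subset {U : Set ℝ} (hU : IsOpen U) {c d : ℝ} (h : uIcc c d ⊆ U) :
    ∃ l r, c ∈ Ioo l r ∧ d ∈ Ioo l r ∧ Ioo l r ⊆ U := by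
  obtain ⟨δ, hδ, hsub⟩ := isCompact_uIcc.exists_thickening_subset_open hU h
  refine ⟨min c d - δ, max c d + δ, ⟨?_, ?_⟩, ⟨?_, ?_⟩, fun x hx => hsub ?_⟩
  · linarith [min_le_left c d]
  · linarith [le_max_left c d]
  · linarith [min_le_right c d]
  · linarith [le_max_right c d]
  · rw [Metric.mem_thickening_iff]
    have hmm : min c d ≤ max c d := min_le_max
    rcases lt_or_ge x (min c d) with h1 | h1
    · exact ⟨min c d, ⟨le_rfl, hmm⟩, by rw [Real.dist_eq, abs_lt]; constructor <;> linarith [hx.1]⟩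
    · rcases le_or_gt x (max c d) with h2 | h2
      · exact ⟨x, ⟨h1, h2⟩, by simpa using hδ⟩
      · exact ⟨max c d, ⟨hmm, le_rfl⟩, by rw [Real.dist_eq, abs_lt]; constructor <;> linarith [hx.2]⟩

theorem iteratedDeriv_two_eq (φ : ℝ → ℝ) : iteratedDeriv 2 φ = deriv (deriv φ) := by
  rw [iteratedDeriv_succ, iteratedDeriv_one]

theorem iteratedDeriv_three_eq (φ : ℝ → ℝ) : iteratedDeriv 3 φ = deriv (deriv (deriv φ)) := by
  rw [iteratedDeriv_succ, iteratedDeriv_two_eq]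

/-- Profiles with weak derivatives on the positivity set are regular. -/
theorem exists_slice {a b : ℝ} (hab : a < b) {w p q₀ z₀ : ℝ → ℝ}
    (hw : ContinuousOn w (Icc a b)) (hw0 : ∀ x ∈ Icc a b, 0 ≤ w x)
    (h1 : HasWeakDeriv 1 (Ioo a b) w p) (hp : ContinuousOn p (Icc a b)) (hpa : p a = 0)
    (hpb : p b = 0) (h2 : HasWeakDeriv 2 (posSet a b w) w q₀)
    (h3 : HasWeakDeriv 3 (posSet a b w) w z₀)
    (hwq : IntegrableOn (fun x => w x * q₀ x ^ 2) (posSet a b w))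
    (hwz : IntegrableOn (fun x => w x ^ 3 * z₀ x ^ 2) (posSet a b w)) :
    ∃ q, Slice a b w p q ((posSet a b w).indicator z₀) ∧
      ∀ᵐ x, x ∈ posSet a b w → q₀ x = q x := by
  classical
  have hU := isOpen_posSet hw
  set U := posSet a b w with hUd
  have hUsub : U ⊆ Ioo a b := fun x hx => hx.1
  have hwp := sub_eq_integral_of_hasWeakDeriv hab hw (ContinuousOn.integrableOn_Ioo hp) fun φ hφ => by
    have := h1.2.2 φ hφ
    rw [iteratedDeriv_one] at this
    rw [this]; ring
  have hder : ∀ x ∈ Ioo a b, HasDerivAt w (p x) x :=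
    hasDerivAt_of_sub_eq_integral (hp.mono Ioo_subset_Icc_self) fun x hx y hy =>
      hwp x (Ioo_subset_Icc_self hx) y (Ioo_subset_Icc_self hy)
  -- Taking `deriv p` as the second derivative everywhere makes the pieces obtained on different
  -- intervals agree without any gluing.
  have hloc : ∀ l r, l < r → Ioo l r ⊆ U → (∀ x ∈ Ioo l r, HasDerivAt p (deriv p x) x) ∧
      ContinuousOn (deriv p) (Ioo l r) ∧
      (∀ x ∈ Ioo l r, ∀ y ∈ Ioo l r, deriv p y - deriv p x = ∫ s in x..y, z₀ s) ∧
      ∀ᵐ x, x ∈ Ioo l r → q₀ x = deriv p x := by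
    intro l r hlr hsub
    obtain ⟨q, g1, g2, g3, g4⟩ := exists_second_derivative hlr (q₀ := q₀) (z₀ := z₀)
      (fun x hx => hder x (hUsub (hsub hx)))
      (hp.mono (hsub.trans (hUsub.trans Ioo_subset_Icc_self)))
      (h2.2.1.mono_set hsub) (h3.2.1.mono_set hsub)
      (fun φ hφ => by
        have e := h2.2.2 φ (hφ.mono hsub)
        rw [iteratedDeriv_two_eq, IsTest.setIntegral_eq hU.measurableSet hsub hφ.derivative.derivative,
          IsTest.setIntegral_eq hU.measurableSet hsub hφ] at e
        rw [e]; ring)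
      (fun φ hφ => by
        have e := h3.2.2 φ (hφ.mono hsub)
        rw [iteratedDeriv_three_eq,
          IsTest.setIntegral_eq hU.measurableSet hsub hφ.derivative.derivative.derivative,
          IsTest.setIntegral_eq hU.measurableSet hsub hφ] at e
        rw [e]; ring)
    have hd : ∀ x ∈ Ioo l r, deriv p x = q x := fun x hx => (g1 x hx).deriv
    refine ⟨fun x hx => by rw [hd x hx]; exact g1 x hx, g2.congr hd, fun x hx y hy => ?_, ?_⟩
    · rw [hd x hx, hd y hy, g3 x hx y hy]
    · filter_upwards [g4] with x hx hxI
      rw [hx hxI, hd x hxI]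
  have hnear : ∀ x ∈ U, ∃ l r, x ∈ Ioo l r ∧ Ioo l r ⊆ U := fun x hx => by
    obtain ⟨l, r, h, -, h'⟩ := exists_Ioo_of_uIcc_subset (c := x) (d := x) hU (by simpa using hx)
    exact ⟨l, r, h, h'⟩
  have hae : ∀ᵐ x, x ∈ U → q₀ x = deriv p x := by
    have : volume {x | x ∈ U ∧ q₀ x ≠ deriv p x} = 0 := by
      -- The positivity set may have infinitely many components; a set that is null near each of its
      -- points is null.
      refine measure_null_of_locally_null _ fun x hx => ?_
      obtain ⟨l, r, hxI, hsub⟩ := hnear x hx.1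
      have g := (hloc l r (hxI.1.trans hxI.2) hsub).2.2.2
      refine ⟨{y | ¬ (y ∈ Ioo l r → q₀ y = deriv p y)} , ?_, ae_iff.1 g⟩
      filter_upwards [mem_nhdsWithin_of_mem_nhds (Ioo_mem_nhds hxI.1 hxI.2), self_mem_nhdsWithin]
        with y hy hy'
      exact fun h => hy'.2 (h hy)
    rw [ae_iff]
    convert this using 3
    simp
  have hindz : ∀ x ∈ U, U.indicator z₀ x = z₀ x := fun x hx => indicator_of_mem hx _
  have hindq : ∀ x ∈ U, U.indicator (deriv p) x = deriv p x := fun x hx => indicator_of_mem hx _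
  have ext : ∀ F G : ℝ → ℝ, IntegrableOn F U → (∀ᵐ x, x ∈ U → F x = G x) →
      (∀ x ∈ Ioo a b, x ∉ U → G x = 0) → IntegrableOn G (Ioo a b) := by
    intro F G hF hFG hG
    have hGU : IntegrableOn G U :=
      hF.congr ((ae_restrict_iff' hU.measurableSet).2 hFG)
    exact hGU.of_forall_sdiff_eq_zero measurableSet_Ioo fun x hx => hG x hx.1 hx.2
  refine ⟨U.indicator (deriv p), ⟨hw, hw0, hder, hp, hpa, hpb, ?_, ?_, ?_, ?_, ?_, ?_, ?_, ?_, ?_⟩, ?_⟩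
  · intro x hx
    obtain ⟨l, r, hxI, hsub⟩ := hnear x hx
    rw [hindq x hx]
    exact (hloc l r (hxI.1.trans hxI.2) hsub).1 x hxI
  · have : ContinuousOn (deriv p) U := fun x hx => by
      obtain ⟨l, r, hxI, hsub⟩ := hnear x hx
      exact ((hloc l r (hxI.1.trans hxI.2) hsub).2.1.continuousAt
        (Ioo_mem_nhds hxI.1 hxI.2)).continuousWithinAt
    exact this.congr hindq
  · exact fun x hx => indicator_of_notMem hx _
  · exact fun x hx => indicator_of_notMem hx _
  · exact ((aestronglyMeasurable_indicator_iff hU.measurableSet).2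
      h3.2.1.aestronglyMeasurable).restrict
  · intro c d hcd
    obtain ⟨l, r, hc, hd, hsub⟩ := exists_Ioo_of_uIcc_subset hU hcd
    refine (locallyIntegrableOn_intervalIntegrable (h3.2.1.mono_set hsub) hc hd).congr ?_
    intro x hx
    exact (hindz x (hcd (uIoc_subset_uIcc hx))).symm
  · intro c d hcd
    obtain ⟨l, r, hc, hd, hsub⟩ := exists_Ioo_of_uIcc_subset hU hcd
    rw [hindq c (hcd left_mem_uIcc), hindq d (hcd right_mem_uIcc),
      (hloc l r (hc.1.trans hc.2) hsub).2.2.1 c hc d hd]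
    exact intervalIntegral.integral_congr fun x hx => (hindz x (hcd hx)).symm
  · refine ext _ _ hwq ?_ fun x _ hx => by rw [indicator_of_notMem hx]; ring
    filter_upwards [hae] with x hx hxU
    rw [hindq x hxU, hx hxU]
  · exact ext _ _ hwz (Eventually.of_forall fun x hx => by rw [hindz x hx]) fun x _ hx => by
      rw [indicator_of_notMem hx]; ring
  · filter_upwards [hae] with x hx hxU
    rw [hindq x hxU, hx hxU]

end ThinFilm

namespace ThinFilm

/-! ### Measurability in time and bounds for solutions -/

section Measurability

variable {a b : ℝ} {u : ℝ → ℝ → ℝ}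

/-- A solution, extended by zero outside `(0, ∞) × (a, b)`. -/
noncomputable def extendZero (a b : ℝ) (u : ℝ → ℝ → ℝ) (y : ℝ × ℝ) : ℝ :=
  open Classical in (Ioi 0 ×ˢ Ioo a b).piecewise (Function.uncurry u) (fun _ => 0) y

theorem extendZero_eq {t x : ℝ} (ht : 0 < t) (hx : x ∈ Ioo a b) :
    extendZero a b u (t, x) = u t x := by
  rw [extendZero, piecewise_eq_of_mem _ _ _ (show (t, x) ∈ Ioi (0 : ℝ) ×ˢ Ioo a b from ⟨ht, hx⟩)]
  rfl

theorem extendZero_pos_iff {t x : ℝ} (ht : 0 < t) :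
    0 < extendZero a b u (t, x) ↔ x ∈ posSet a b (u t) := by
  by_cases hx : x ∈ Ioo a b
  · rw [extendZero_eq ht hx]
    exact ⟨fun h => ⟨hx, h⟩, fun h => h.2⟩
  · rw [extendZero, piecewise_eq_of_notMem _ _ _ fun h => hx h.2]
    exact ⟨fun h => absurd h (lt_irrefl _), fun h => absurd h.1 hx⟩

theorem measurable_extendZero (hu : ContinuousOn (Function.uncurry u) (Ici 0 ×ˢ Icc a b)) :
    Measurable (extendZero a b u) :=
  (hu.mono (prod_mono Ioi_subset_Ici_self Ioo_subset_Icc_self)).measurable_piecewise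
    continuousOn_const (measurableSet_Ioi.prod measurableSet_Ioo)

/-- The domain of integration moves with `t`. An indicator of the jointly measurable set
`{extendZero > 0}` turns it into a section integral, to which Tonelli's theorem applies. -/
theorem aemeasurable_lintegral_posSet (hu : ContinuousOn (Function.uncurry u) (Ici 0 ×ˢ Icc a b))
    {Z : ℝ → ℝ → ℝ} (hZ : Measurable (Function.uncurry Z)) {F : ℝ × ℝ → ℝ≥0∞} (hF : Measurable F) :
    AEMeasurable (fun t => ∫⁻ x in posSet a b (u t), F (u t x, Z t x))
      (volume.restrict (Ioi (0 : ℝ))) := by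
  have hm := measurable_extendZero hu
  have hP : MeasurableSet {y : ℝ × ℝ | 0 < extendZero a b u y} := measurableSet_lt measurable_const hm
  have h1 : Measurable (fun y : ℝ × ℝ => {y : ℝ × ℝ | 0 < extendZero a b u y}.indicator
      (fun y => F (extendZero a b u y, Z y.1 y.2)) y) :=
    (hF.comp (hm.prodMk hZ)).indicator hP
  have h2 : Measurable (fun t : ℝ => ∫⁻ x, {y : ℝ × ℝ | 0 < extendZero a b u y}.indicator
      (fun y => F (extendZero a b u y, Z y.1 y.2)) (t, x)) := h1.lintegral_prod_right'
  refine ⟨_, h2, (ae_restrict_iff' measurableSet_Ioi).2 (Eventually.of_forall fun t ht => ?_)⟩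
  have ht : 0 < t := ht
  have hset : {x | 0 < extendZero a b u (t, x)} = posSet a b (u t) :=
    Set.ext fun x => extendZero_pos_iff ht
  have hms : MeasurableSet (posSet a b (u t)) := by
    rw [← hset]; exact measurableSet_lt measurable_const (hm.comp measurable_prodMk_left)
  beta_reduce
  rw [← lintegral_indicator hms]
  refine lintegral_congr fun x => ?_
  by_cases hx : x ∈ posSet a b (u t)
  · rw [indicator_of_mem hx, indicator_of_mem ((extendZero_pos_iff ht).2 hx : (t, x) ∈ _)]
    rw [extendZero_eq ht hx.1]
  · rw [indicator_of_notMem hx, indicator_of_notMem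
      (show (t, x) ∉ {y : ℝ × ℝ | 0 < extendZero a b u y} from
        fun h => hx ((extendZero_pos_iff ht).1 h))]

theorem ae_prod_restrict_mem (s t : Set ℝ) (hs : MeasurableSet s) (ht : MeasurableSet t) :
    ∀ᵐ y ∂((volume.restrict s).prod (volume.restrict t)), y.1 ∈ s ∧ y.2 ∈ t := by
  rw [Measure.prod_restrict]
  exact ae_restrict_mem (hs.prod ht)

theorem aestronglyMeasurable_posSet (hu : ContinuousOn (Function.uncurry u) (Ici 0 ×ˢ Icc a b))
    {H : ℝ → ℝ → ℝ} {F : ℝ → ℝ × ℝ → ℝ} (hF : Measurable (Function.uncurry F))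
    (hH : ∀ t, 0 < t → ∀ x, H t x = (posSet a b (u t)).indicator (fun y => F (u t y) (t, y)) x)
    {I : Set ℝ} (hI : MeasurableSet I) (hI0 : I ⊆ Ioi 0) :
    AEStronglyMeasurable (Function.uncurry H)
      ((volume.restrict I).prod (volume.restrict (Ioo a b))) := by
  have hm := measurable_extendZero hu
  have hP : MeasurableSet {y : ℝ × ℝ | 0 < extendZero a b u y} := measurableSet_lt measurable_const hm
  have h1 : Measurable ({y : ℝ × ℝ | 0 < extendZero a b u y}.indicator
      (fun y => F (extendZero a b u y) y)) := (hF.comp (hm.prodMk measurable_id)).indicator hP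
  refine ⟨_, h1.stronglyMeasurable, ?_⟩
  filter_upwards [ae_prod_restrict_mem I (Ioo a b) hI measurableSet_Ioo] with y hy
  obtain ⟨t, x⟩ := y
  have ht : 0 < t := hI0 hy.1
  rw [Function.uncurry_apply_pair, hH t ht x]
  by_cases hx : x ∈ posSet a b (u t)
  · rw [indicator_of_mem hx, indicator_of_mem ((extendZero_pos_iff ht).2 hx : (t, x) ∈ _)]
    rw [extendZero_eq ht hx.1]
  · rw [indicator_of_notMem hx, indicator_of_notMem
      (show (t, x) ∉ {y : ℝ × ℝ | 0 < extendZero a b u y} from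
        fun h => hx ((extendZero_pos_iff ht).1 h))]

theorem integrable_prod_of_lintegral_lt_top {I J : Set ℝ} {F : ℝ → ℝ → ℝ}
    (hF : AEStronglyMeasurable (Function.uncurry F)
      ((volume.restrict I).prod (volume.restrict J)))
    (h : ∫⁻ t in I, ∫⁻ x in J, ENNReal.ofReal |F t x| < ⊤) :
    Integrable (Function.uncurry F) ((volume.restrict I).prod (volume.restrict J)) := by
  refine ⟨hF, ?_⟩
  rw [hasFiniteIntegral_iff_norm, lintegral_prod _ hF.norm.aemeasurable.ennreal_ofReal]
  exact h

end Measurability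

theorem measurable_dB (n : ℝ) : Measurable (dB n) := by
  have h1 : Measurable (fun y : ℝ × ℝ => {y : ℝ × ℝ | y.1 < y.2}.indicator
      (fun y => 1 / (y.2 ^ (n - 1) + y.2 ^ 2)) y) :=
    Measurable.indicator (by fun_prop) (measurableSet_lt measurable_fst measurable_snd)
  have h2 := h1.stronglyMeasurable.integral_prod_right' (ν := volume)
  have : dB n = fun r => ∫ v, {y : ℝ × ℝ | y.1 < y.2}.indicator
      (fun y => 1 / (y.2 ^ (n - 1) + y.2 ^ 2)) (r, v) := by
    funext r
    rw [dB, ← integral_indicator measurableSet_Ioi]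
    rfl
  rw [this]
  exact h2.measurable

/-- The dissipation of a solution at time `t`. -/
noncomputable def dissipation (a b n ε : ℝ) (u uxxx : ℝ → ℝ → ℝ) (t : ℝ) : ℝ≥0∞ :=
  ∫⁻ x in posSet a b (u t), ENNReal.ofReal (mobility n ε (u t x) * uxxx t x ^ 2)

theorem measurable_mobility (n ε : ℝ) : Measurable (mobility n ε) := by
  unfold mobility
  fun_prop

/-! ### Solutions at almost every time. -/

namespace IsSolutionWith

variable {a b n ε : ℝ} {uin : ℝ → ℝ} {u ux uxx uxxx : ℝ → ℝ → ℝ}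

theorem slice_continuousOn (h : IsSolutionWith a b n ε uin u ux uxx uxxx) {t : ℝ} (ht : 0 ≤ t) :
    ContinuousOn (u t) (Icc a b) := by
  have : ContinuousOn (fun x => Function.uncurry u (t, x)) (Icc a b) :=
    h.continuous.comp (by fun_prop) fun x hx => ⟨ht, hx⟩
  exact this

theorem aemeasurable_dissipation (h : IsSolutionWith a b n ε uin u ux uxx uxxx) :
    AEMeasurable (dissipation a b n ε u uxxx) (volume.restrict (Ioi (0 : ℝ))) :=
  aemeasurable_lintegral_posSet h.continuous h.meas_uxxx
    (F := fun y => ENNReal.ofReal (mobility n ε y.1 * y.2 ^ 2))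
    ((((measurable_mobility n ε).comp measurable_fst).mul
      (measurable_snd.pow_const 2)).ennreal_ofReal)

/-- The factor `|ln ε|` in the energy inequality is moved to the right. This smallness drives every
limit below. -/
theorem lintegral_dissipation_le (h : IsSolutionWith a b n ε uin u ux uxx uxxx)
    (hε : ε ∈ Ioo (0 : ℝ) 1) {E S : ℝ} (hS : 0 < S)
    (hE : ∫⁻ x in Ioo a b, ENNReal.ofReal (1 / 2 * ux 0 x ^ 2) ≤ ENNReal.ofReal (E / 2)) :
    ∫⁻ t in Ioo 0 S, dissipation a b n ε u uxxx t
      ≤ ENNReal.ofReal (E / 2) / ENNReal.ofReal |Real.log ε| := by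
  have hl := abs_log_pos hε
  have h1 : ∀ t, (∫⁻ x in posSet a b (u t),
      ENNReal.ofReal (|Real.log ε| * mobility n ε (u t x) * uxxx t x ^ 2))
      = ENNReal.ofReal |Real.log ε| * dissipation a b n ε u uxxx t := fun t => by
    rw [dissipation, ← lintegral_const_mul' _ _ ENNReal.ofReal_ne_top]
    refine lintegral_congr fun x => ?_
    rw [← ENNReal.ofReal_mul hl.le, mul_assoc]
  have h2 := (le_add_self.trans (h.energy S hS)).trans hE
  simp only [h1] at h2
  rw [lintegral_const_mul' _ _ ENNReal.ofReal_ne_top] at h2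
  rw [ENNReal.le_div_iff_mul_le (Or.inl (by simpa using hl.ne')) (Or.inl ENNReal.ofReal_ne_top),
    mul_comm]
  exact h2

theorem integral_ux_sq_le (h : IsSolutionWith a b n ε uin u ux uxx uxxx) {E t : ℝ} (hE0 : 0 ≤ E)
    (ht : 0 < t)
    (hE : ∫⁻ x in Ioo a b, ENNReal.ofReal (1 / 2 * ux 0 x ^ 2) ≤ ENNReal.ofReal (E / 2)) :
    ∫ x in Ioo a b, ux t x ^ 2 ≤ E := by
  have h2 := (le_self_add.trans (h.energy t ht)).trans hE
  have h3 : ∫ x in Ioo a b, 1 / 2 * ux t x ^ 2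
      = (∫⁻ x in Ioo a b, ENNReal.ofReal (1 / 2 * ux t x ^ 2)).toReal :=
    integral_eq_lintegral_of_nonneg_ae (Eventually.of_forall fun x => by
      simp only [Pi.zero_apply]; positivity)
      (((h.deriv_one t ht.le).2.1.pow 2).const_mul _)
  have h4 := ENNReal.toReal_le_of_le_ofReal (by positivity : 0 ≤ E / 2) h2
  rw [← h3, integral_const_mul] at h4
  linarith

/-- At almost every time a solution is a regular profile. -/
theorem ae_slice (h : IsSolutionWith a b n ε uin u ux uxx uxxx) (hab : a < b)
    (hε : ε ∈ Ioo (0 : ℝ) 1) {E : ℝ}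
    (hE : ∫⁻ x in Ioo a b, ENNReal.ofReal (1 / 2 * ux 0 x ^ 2) ≤ ENNReal.ofReal (E / 2)) :
    ∀ᵐ t ∂(volume.restrict (Ioi (0 : ℝ))), dissipation a b n ε u uxxx t < ⊤ ∧
      ∃ q, Slice a b (u t) (ux t) q ((posSet a b (u t)).indicator (uxxx t)) ∧
      (∫ x in Ioo a b, u t x ^ 3 * (posSet a b (u t)).indicator (uxxx t) x ^ 2)
        ≤ (dissipation a b n ε u uxxx t).toReal ∧
      ∀ φ, IsTest (Ioo a b) φ →
        ∫ x in Ioo a b, Tterm a b u ux uxxx t x * φ x = production a b (u t) (ux t) q φ := by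
  have hl := abs_log_pos hε
  have mono : ∀ N : ℕ, volume.restrict (Ioo (0 : ℝ) (N + 1)) ≤ volume.restrict (Ioi (0 : ℝ)) :=
    fun N => Measure.restrict_mono Ioo_subset_Ioi_self le_rfl
  have hcover : ∀ P : ℝ → Prop, (∀ N : ℕ, ∀ᵐ t ∂(volume.restrict (Ioo (0 : ℝ) (N + 1))), P t) →
      ∀ᵐ t ∂(volume.restrict (Ioi (0 : ℝ))), P t := fun P hP => by
    have h1 : ∀ N : ℕ, ∀ᵐ t, t ∈ Ioo (0 : ℝ) (N + 1) → P t := fun N =>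
      (ae_restrict_iff' measurableSet_Ioo).1 (hP N)
    rw [ae_restrict_iff' measurableSet_Ioi]
    filter_upwards [ae_all_iff.2 h1] with t ht ht0
    obtain ⟨N, hN⟩ := exists_nat_gt t
    exact ht N ⟨ht0, by linarith⟩
  have hdis : ∀ᵐ t ∂(volume.restrict (Ioi (0 : ℝ))), dissipation a b n ε u uxxx t < ⊤ :=
    hcover _ fun N => ae_lt_top' (h.aemeasurable_dissipation.mono_measure (mono N))
      ((h.lintegral_dissipation_le hε (by positivity) hE).trans_lt
        (ENNReal.div_lt_top ENNReal.ofReal_ne_top (by simpa using hl.ne'))).ne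
  have hentm : AEMeasurable (fun t => ∫⁻ x in posSet a b (u t),
      ENNReal.ofReal (u t x * uxx t x ^ 2)) (volume.restrict (Ioi (0 : ℝ))) :=
    aemeasurable_lintegral_posSet h.continuous h.meas_uxx
      (F := fun y => ENNReal.ofReal (y.1 * y.2 ^ 2)) (by fun_prop)
  -- Only finiteness is used here: the right side of the entropy inequality is a real number,
  -- possibly depending on `ε` and on the time horizon. The uniform bound on `w q²` comes later from
  -- `Slice.weighted_bounds`.
  have hent : ∀ᵐ t ∂(volume.restrict (Ioi (0 : ℝ))), (∫⁻ x in posSet a b (u t),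
      ENNReal.ofReal (u t x * uxx t x ^ 2)) < ⊤ :=
    hcover _ fun N => ae_lt_top' (hentm.mono_measure (mono N))
      ((le_self_add.trans (h.entropy (N + 1) (by positivity))).trans_lt ENNReal.ofReal_lt_top).ne
  filter_upwards [hdis, hent, h.deriv_two, h.deriv_three, h.neumann, h.T_formula,
    ae_restrict_mem measurableSet_Ioi] with t h1 h2 h3 h4 h5 h6 ht
  have ht : 0 < t := ht
  have hw := h.slice_continuousOn ht.le
  have hU := isOpen_posSet hw
  set U := posSet a b (u t) with hUd
  have hUsub : U ⊆ Ioo a b := fun x hx => hx.1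
  have hwm : AEStronglyMeasurable (u t) (volume.restrict U) :=
    (aestronglyMeasurable_of_continuousOn hw).mono_measure (Measure.restrict_mono hUsub le_rfl)
  have hqm : Measurable (uxx t) := h.meas_uxx.comp measurable_prodMk_left
  have hzm : Measurable (uxxx t) := h.meas_uxxx.comp measurable_prodMk_left
  have hpos : ∀ x ∈ U, 0 < u t x := fun x hx => hx.2
  have i1 : IntegrableOn (fun x => u t x * uxx t x ^ 2) U := by
    refine ⟨hwm.mul (hqm.aestronglyMeasurable.pow 2), ?_⟩
    rw [hasFiniteIntegral_iff_ofReal]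
    · exact h2
    · exact (ae_restrict_mem hU.measurableSet).mono fun x hx => by
        have := hpos x hx
        simp only [Pi.zero_apply]; positivity
  have i0 : IntegrableOn (fun x => mobility n ε (u t x) * uxxx t x ^ 2) U := by
    refine ⟨(((measurable_mobility n ε).comp_aemeasurable hwm.aemeasurable).aestronglyMeasurable).mul
      (hzm.aestronglyMeasurable.pow 2), ?_⟩
    rw [hasFiniteIntegral_iff_ofReal]
    · exact h1
    · exact (ae_restrict_mem hU.measurableSet).mono fun x hx => by
        have := mobility_nonneg n hε.1.le (hpos x hx).le
        simp only [Pi.zero_apply]; positivity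
  have hle : ∀ x ∈ U, u t x ^ 3 * uxxx t x ^ 2 ≤ mobility n ε (u t x) * uxxx t x ^ 2 :=
    fun x hx => by
      have := cube_le_mobility n hε.1.le (hpos x hx).le
      gcongr
  have i2 : IntegrableOn (fun x => u t x ^ 3 * uxxx t x ^ 2) U := by
    refine Integrable.mono' i0 ((hwm.pow 3).mul (hzm.aestronglyMeasurable.pow 2)) ?_
    exact (ae_restrict_mem hU.measurableSet).mono fun x hx => by
      rw [Real.norm_of_nonneg (by have := hpos x hx; positivity)]
      exact hle x hx
  obtain ⟨q, S, hq⟩ := exists_slice hab hw (h.nonneg t ht.le) (h.deriv_one t ht.le).1 h5.1 h5.2.1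
    h5.2.2 h3 h4 i1 i2
  refine ⟨h1, q, S, ?_, fun φ hφ => ?_⟩
  · have e1 : ∫ x in Ioo a b, u t x ^ 3 * U.indicator (uxxx t) x ^ 2
        = ∫ x in U, u t x ^ 3 * uxxx t x ^ 2 := by
      rw [setIntegral_eq_of_subset_of_forall_sdiff_eq_zero measurableSet_Ioo hUsub]
      · exact setIntegral_congr_fun hU.measurableSet fun x hx => by
          simp only [indicator_of_mem hx]
      · intro x hx
        rw [indicator_of_notMem hx.2]; ring
    rw [e1]
    refine (setIntegral_mono_on i2 i0 hU.measurableSet hle).trans_eq ?_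
    rw [integral_eq_lintegral_of_nonneg_ae, dissipation]
    · exact (ae_restrict_mem hU.measurableSet).mono fun x hx => by
        have := mobility_nonneg n hε.1.le (hpos x hx).le
        simp only [Pi.zero_apply]; positivity
    · exact i0.aestronglyMeasurable
  · rw [h6 φ hφ.smooth, production, iteratedDeriv_two_eq]
    congr 2
    rw [setIntegral_eq_of_subset_of_forall_sdiff_eq_zero measurableSet_Ioo hUsub (f := fun x =>
      u t x * q x ^ 2 * φ x) fun x hx => by rw [S.q_zero x hx.2]; ring]
    refine integral_congr_ae ((ae_restrict_iff' hU.measurableSet).2 ?_)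
    filter_upwards [hq] with x hx hxU
    rw [hx hxU]

end IsSolutionWith

end ThinFilm

namespace ThinFilm

/-! ### Evolution of `B^ε(u)` against test functions -/

theorem integrable_integral_mul {I J : Set ℝ} {F : ℝ → ℝ → ℝ} {φ : ℝ → ℝ} {K : ℝ}
    (hF : Integrable (Function.uncurry F) ((volume.restrict I).prod (volume.restrict J)))
    (hφ : Continuous φ) (hK : ∀ x, |φ x| ≤ K) :
    IntegrableOn (fun t => ∫ x in J, F t x * φ x) I := by
  have h1 : Integrable (fun y : ℝ × ℝ => Function.uncurry F y * φ y.2)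
      ((volume.restrict I).prod (volume.restrict J)) :=
    hF.mul_bdd (hφ.comp continuous_snd).aestronglyMeasurable
      (Eventually.of_forall fun y => hK y.2)
  exact h1.integral_prod_left

namespace IsSolutionWith

variable {a b n ε M S : ℝ} {uin : ℝ → ℝ} {u ux uxx uxxx : ℝ → ℝ → ℝ}

theorem integrable_rho (h : IsSolutionWith a b n ε uin u ux uxx uxxx) (hn0 : 0 < n) (hn3 : n < 3)
    (hε : ε ∈ Ioo (0 : ℝ) 1) (hM : 1 ≤ M) (hu : ∀ t, 0 < t → ∀ x ∈ Icc a b, u t x ≤ M) :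
    Integrable (Function.uncurry fun t x => Beps n ε (u t x))
      ((volume.restrict (Ioo 0 S)).prod (volume.restrict (Ioo a b))) := by
  have hmem := ae_prod_restrict_mem (Ioo 0 S) (Ioo a b) measurableSet_Ioo measurableSet_Ioo
  have hfin : IsFiniteMeasure ((volume.restrict (Ioo 0 S)).prod (volume.restrict (Ioo a b))) :=
    inferInstance
  refine Integrable.of_bound (C := 1 + (B n 1 + Real.log M) / |Real.log ε|) ?_ ?_
  · refine ⟨_, ((measurable_Beps_max hn0 hn3 hε.1).comp
      (measurable_extendZero h.continuous)).stronglyMeasurable, ?_⟩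
    filter_upwards [hmem] with y hy
    obtain ⟨t, x⟩ := y
    have ht : 0 < t := hy.1.1
    rw [Function.uncurry_apply_pair, Function.comp_apply, extendZero_eq ht hy.2,
      max_eq_left (h.nonneg t ht.le x (Ioo_subset_Icc_self hy.2))]
  · filter_upwards [hmem] with y hy
    obtain ⟨t, x⟩ := y
    have ht : 0 < t := hy.1.1
    have h0 := h.nonneg t ht.le x (Ioo_subset_Icc_self hy.2)
    rw [Function.uncurry_apply_pair, Real.norm_of_nonneg (Beps_nonneg n hε.1 h0)]
    exact Beps_le hn0 hn3 hε hM h0 (hu t ht x (Ioo_subset_Icc_self hy.2))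

theorem integrable_T (h : IsSolutionWith a b n ε uin u ux uxx uxxx) (hS : 0 < S) :
    Integrable (Function.uncurry (Tterm a b u ux uxxx))
      ((volume.restrict (Ioo 0 S)).prod (volume.restrict (Ioo a b))) := by
  refine integrable_prod_of_lintegral_lt_top (aestronglyMeasurable_posSet h.continuous
    (F := fun s y => -(s * ux y.1 y.2 * uxxx y.1 y.2)) ?_ (fun t _ x => rfl) measurableSet_Ioo
    Ioo_subset_Ioi_self) (h.T_mem S hS)
  have h1 := h.meas_ux.comp (measurable_snd : Measurable (Prod.snd : ℝ × (ℝ × ℝ) → ℝ × ℝ))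
  have h3 := h.meas_uxxx.comp (measurable_snd : Measurable (Prod.snd : ℝ × (ℝ × ℝ) → ℝ × ℝ))
  exact ((measurable_fst.mul h1).mul h3).neg

/-- The integrated form of `flux_le`. The parameter `η` stays free: it makes the first term small,
after which the vanishing dissipation beats `η⁻¹`. -/
theorem lintegral_Rterm_le (h : IsSolutionWith a b n ε uin u ux uxx uxxx) (hn0 : 0 < n)
    (hn3 : n < 3) (hε : ε ∈ Ioo (0 : ℝ) 1) (hM : 1 ≤ M)
    (hu : ∀ t, 0 < t → ∀ x ∈ Icc a b, u t x ≤ M) {t η : ℝ} (ht : 0 < t) (hη : 0 < η) :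
    ∫⁻ x in Ioo a b, ENNReal.ofReal |Rterm a b n ε u uxxx t x|
      ≤ ENNReal.ofReal (η * ((2 + 18 / n ^ 2) * (1 + M)) * (b - a))
        + ENNReal.ofReal η⁻¹ * dissipation a b n ε u uxxx t := by
  have hU := isOpen_posSet (h.slice_continuousOn ht.le)
  have hc : 0 ≤ η * ((2 + 18 / n ^ 2) * (1 + M)) := by positivity
  have h1 : ∀ x, ENNReal.ofReal |Rterm a b n ε u uxxx t x|
      ≤ ENNReal.ofReal (η * ((2 + 18 / n ^ 2) * (1 + M))) + ENNReal.ofReal η⁻¹ *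
        (posSet a b (u t)).indicator
          (fun x => ENNReal.ofReal (mobility n ε (u t x) * uxxx t x ^ 2)) x := fun x => by
    by_cases hx : x ∈ posSet a b (u t)
    · rw [Rterm, indicator_of_mem hx, indicator_of_mem hx, ← ENNReal.ofReal_mul (by positivity),
        ← ENNReal.ofReal_add hc]
      · refine ENNReal.ofReal_le_ofReal ?_
        have := flux_le hn0 hn3 hε (z := uxxx t x) hx.2 (hu t ht x (Ioo_subset_Icc_self hx.1)) hη
        rw [inv_mul_eq_div]
        exact this
      · have := mobility_nonneg n hε.1.le hx.2.le
        positivity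
    · rw [Rterm, indicator_of_notMem hx, indicator_of_notMem hx]
      simp
  calc ∫⁻ x in Ioo a b, ENNReal.ofReal |Rterm a b n ε u uxxx t x|
      ≤ ∫⁻ x in Ioo a b, (ENNReal.ofReal (η * ((2 + 18 / n ^ 2) * (1 + M))) + ENNReal.ofReal η⁻¹ *
        (posSet a b (u t)).indicator
          (fun x => ENNReal.ofReal (mobility n ε (u t x) * uxxx t x ^ 2)) x) :=
        lintegral_mono h1
    _ = ENNReal.ofReal (η * ((2 + 18 / n ^ 2) * (1 + M)) * (b - a)) + ENNReal.ofReal η⁻¹ *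
        ∫⁻ x in Ioo a b, (posSet a b (u t)).indicator
          (fun x => ENNReal.ofReal (mobility n ε (u t x) * uxxx t x ^ 2)) x := by
        rw [lintegral_add_left measurable_const, setLIntegral_const, Real.volume_Ioo,
          ← ENNReal.ofReal_mul hc, lintegral_const_mul' _ _ ENNReal.ofReal_ne_top]
    _ ≤ _ := by
        gcongr
        exact (setLIntegral_le_lintegral _ _).trans_eq (lintegral_indicator hU.measurableSet _)

theorem lintegral_lintegral_Rterm_le (h : IsSolutionWith a b n ε uin u ux uxx uxxx) (hn0 : 0 < n)
    (hn3 : n < 3) (hε : ε ∈ Ioo (0 : ℝ) 1) (hM : 1 ≤ M)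
    (hu : ∀ t, 0 < t → ∀ x ∈ Icc a b, u t x ≤ M) {E η : ℝ} (hS : 0 < S) (hη : 0 < η)
    (hE : ∫⁻ x in Ioo a b, ENNReal.ofReal (1 / 2 * ux 0 x ^ 2) ≤ ENNReal.ofReal (E / 2)) :
    ∫⁻ t in Ioo 0 S, ∫⁻ x in Ioo a b, ENNReal.ofReal |Rterm a b n ε u uxxx t x|
      ≤ ENNReal.ofReal (η * ((2 + 18 / n ^ 2) * (1 + M)) * (b - a)) * ENNReal.ofReal S
        + ENNReal.ofReal η⁻¹ * (ENNReal.ofReal (E / 2) / ENNReal.ofReal |Real.log ε|) := by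
  calc _ ≤ ∫⁻ t in Ioo 0 S, (ENNReal.ofReal (η * ((2 + 18 / n ^ 2) * (1 + M)) * (b - a))
        + ENNReal.ofReal η⁻¹ * dissipation a b n ε u uxxx t) :=
        setLIntegral_mono' measurableSet_Ioo fun t ht =>
          h.lintegral_Rterm_le hn0 hn3 hε hM hu ht.1 hη
    _ ≤ _ := by
        rw [lintegral_add_left measurable_const, setLIntegral_const, Real.volume_Ioo, sub_zero,
          lintegral_const_mul' _ _ ENNReal.ofReal_ne_top]
        gcongr
        exact h.lintegral_dissipation_le hε hS hE

theorem integrable_R (h : IsSolutionWith a b n ε uin u ux uxx uxxx) (hn0 : 0 < n) (hn3 : n < 3)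
    (hε : ε ∈ Ioo (0 : ℝ) 1) (hM : 1 ≤ M) (hu : ∀ t, 0 < t → ∀ x ∈ Icc a b, u t x ≤ M) {E : ℝ}
    (hE : ∫⁻ x in Ioo a b, ENNReal.ofReal (1 / 2 * ux 0 x ^ 2) ≤ ENNReal.ofReal (E / 2))
    (hS : 0 < S) :
    Integrable (Function.uncurry (Rterm a b n ε u uxxx))
      ((volume.restrict (Ioo 0 S)).prod (volume.restrict (Ioo a b))) := by
  refine integrable_prod_of_lintegral_lt_top (aestronglyMeasurable_posSet h.continuous
    (F := fun s y => -(|Real.log ε| * dBeps n ε s * mobility n ε s * uxxx y.1 y.2)) ?_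
    (fun t _ x => rfl) measurableSet_Ioo Ioo_subset_Ioi_self)
    ((h.lintegral_lintegral_Rterm_le hn0 hn3 hε hM hu hS one_pos hE).trans_lt ?_)
  · have h3 := h.meas_uxxx.comp (measurable_snd : Measurable (Prod.snd : ℝ × (ℝ × ℝ) → ℝ × ℝ))
    have h4 : Measurable (dBeps n ε) :=
      (((measurable_dB n).comp (measurable_id.div_const ε)).const_mul _).const_mul _
    exact ((((h4.comp measurable_fst).const_mul _).mul
      ((measurable_mobility n ε).comp measurable_fst)).mul h3).neg
  · have hl := abs_log_pos hε
    refine ENNReal.add_lt_top.2 ⟨ENNReal.mul_lt_top ENNReal.ofReal_lt_top ENNReal.ofReal_lt_top,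
      ENNReal.mul_lt_top ENNReal.ofReal_lt_top
        (ENNReal.div_lt_top ENNReal.ofReal_ne_top (by simpa using hl.ne'))⟩

/-- The total `B^ε(u)`-content weighted by a test function is absolutely continuous in time. -/
theorem evolution (h : IsSolutionWith a b n ε uin u ux uxx uxxx) (hn0 : 0 < n) (hn3 : n < 3)
    (hε : ε ∈ Ioo (0 : ℝ) 1) (hM : 1 ≤ M) (hu : ∀ t, 0 < t → ∀ x ∈ Icc a b, u t x ≤ M) {E : ℝ}
    (hE : ∫⁻ x in Ioo a b, ENNReal.ofReal (1 / 2 * ux 0 x ^ 2) ≤ ENNReal.ofReal (E / 2))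
    (hS : 0 < S) {φ : ℝ → ℝ} (hφ : IsTest (Ioo a b) φ) :
    IntegrableOn (fun t => ∫ x in Ioo a b, Tterm a b u ux uxxx t x * φ x) (Ioo 0 S) ∧
    IntegrableOn (fun t => ∫ x in Ioo a b, Rterm a b n ε u uxxx t x * deriv φ x) (Ioo 0 S) ∧
    ∃ c, ∀ᵐ t, t ∈ Ioo 0 S → ∫ x in Ioo a b, Beps n ε (u t x) * φ x = c +
      ∫ s in S / 2..t, ((∫ x in Ioo a b, Tterm a b u ux uxxx s x * φ x)
        - ∫ x in Ioo a b, Rterm a b n ε u uxxx s x * deriv φ x) := by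
  obtain ⟨K, hK⟩ := hφ.exists_bound
  obtain ⟨K', hK'⟩ := hφ.derivative.exists_bound
  have i0 := integrable_integral_mul (h.integrable_rho (S := S) hn0 hn3 hε hM hu) hφ.continuous hK
  have i1 := integrable_integral_mul (h.integrable_T hS) hφ.continuous hK
  have i2 := integrable_integral_mul (h.integrable_R hn0 hn3 hε hM hu hE hS)
    hφ.derivative.continuous hK'
  refine ⟨i1, i2, ae_eq_primitive ⟨by linarith, by linarith⟩ i0.locallyIntegrableOn
    (i1.sub i2).locallyIntegrableOn fun η hη => ?_⟩
  obtain ⟨C, hC⟩ := hη.exists_bound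
  set r : ℝ → ℝ := fun t => ∫ x in Ioo a b, Beps n ε (u t x) * φ x with hr
  set f : ℝ → ℝ := fun t => ∫ x in Ioo a b, Tterm a b u ux uxxx t x * φ x with hf
  set g : ℝ → ℝ := fun t => ∫ x in Ioo a b, Rterm a b n ε u uxxx t x * deriv φ x with hg
  have hsupp : tsupport (Function.uncurry fun t x => η t * φ x) ⊆ tsupport η ×ˢ tsupport φ := by
    refine closure_minimal (fun y hy => ?_) ((isClosed_tsupport η).prod (isClosed_tsupport φ))
    have hy' : η y.1 * φ y.2 ≠ 0 := hy
    exact ⟨subset_tsupport η (left_ne_zero_of_mul hy'),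
      subset_tsupport φ (right_ne_zero_of_mul hy')⟩
  -- Separated test functions turn the equation into a statement in time alone: `r` has weak
  -- derivative `f - g`, so `ae_eq_primitive` applies with base point `S / 2`.
  have key := h.rho_equation (fun t x => η t * φ x)
    ((hη.smooth.comp contDiff_fst).mul (hφ.smooth.comp contDiff_snd))
    ((hη.compact.prod hφ.compact).of_isClosed_subset (isClosed_tsupport _) hsupp)
    (hsupp.trans (prod_mono (hη.supp.trans Ioo_subset_Ioi_self) hφ.supp))
  have d1 : ∀ t x, deriv (fun s => η s * φ x) t = deriv η t * φ x := fun t x =>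
    deriv_mul_const (hη.differentiable t) _
  have d2 : ∀ t x, deriv (fun y => η t * φ y) x = η t * deriv φ x := fun t x =>
    deriv_const_mul _ (hφ.differentiable x)
  have e1 : ∀ t, ∫ x in Ioo a b, Beps n ε (u t x) * (deriv η t * φ x) = r t * deriv η t := fun t => by
    rw [hr, ← integral_mul_const]; exact integral_congr_ae (Eventually.of_forall fun x => by ring)
  have e2 : ∀ t, ∫ x in Ioo a b, Tterm a b u ux uxxx t x * (η t * φ x) = f t * η t := fun t => by
    rw [hf, ← integral_mul_const]; exact integral_congr_ae (Eventually.of_forall fun x => by ring)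
  have e3 : ∀ t, ∫ x in Ioo a b, Rterm a b n ε u uxxx t x * (η t * deriv φ x) = g t * η t :=
    fun t => by
    rw [hg, ← integral_mul_const]; exact integral_congr_ae (Eventually.of_forall fun x => by ring)
  have toIoo : ∀ F : ℝ → ℝ, (∀ t, t ∉ Ioo 0 S → F t = 0) →
      ∫ t in Ioi (0 : ℝ), F t = ∫ t in Ioo 0 S, F t := fun F hF =>
    setIntegral_eq_of_subset_of_forall_sdiff_eq_zero measurableSet_Ioi Ioo_subset_Ioi_self
      fun t ht => hF t ht.2
  simp only [d1, d2, e1, e2, e3] at key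
  rw [toIoo _ fun t ht => by rw [hη.derivative.eq_zero ht, mul_zero],
    toIoo _ fun t ht => by rw [hη.eq_zero ht, mul_zero],
    toIoo _ fun t ht => by rw [hη.eq_zero ht, mul_zero]] at key
  have j1 : IntegrableOn (fun t => f t * η t) (Ioo 0 S) :=
    i1.mul_bdd hη.continuous.aestronglyMeasurable (Eventually.of_forall hC)
  have j2 : IntegrableOn (fun t => g t * η t) (Ioo 0 S) :=
    i2.mul_bdd hη.continuous.aestronglyMeasurable (Eventually.of_forall hC)
  have e4 : ∫ t in Ioo 0 S, (f t - g t) * η t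
      = (∫ t in Ioo 0 S, f t * η t) - ∫ t in Ioo 0 S, g t * η t := by
    rw [← integral_sub j1 j2]
    exact integral_congr_ae (Eventually.of_forall fun x => by ring)
  linarith [e4, key]

/-- The flux tested with `φ'` is small in `L¹` in time. -/
theorem lintegral_flux_le (h : IsSolutionWith a b n ε uin u ux uxx uxxx) (hn0 : 0 < n)
    (hn3 : n < 3) (hε : ε ∈ Ioo (0 : ℝ) 1) (hM : 1 ≤ M)
    (hu : ∀ t, 0 < t → ∀ x ∈ Icc a b, u t x ≤ M) {E η K : ℝ} (hS : 0 < S) (hη : 0 < η)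
    (hE : ∫⁻ x in Ioo a b, ENNReal.ofReal (1 / 2 * ux 0 x ^ 2) ≤ ENNReal.ofReal (E / 2))
    {φ : ℝ → ℝ} (hK : ∀ x, |φ x| ≤ K) :
    ∫⁻ t in Ioo 0 S, ENNReal.ofReal |∫ x in Ioo a b, Rterm a b n ε u uxxx t x * φ x|
      ≤ ENNReal.ofReal K * (ENNReal.ofReal (η * ((2 + 18 / n ^ 2) * (1 + M)) * (b - a))
          * ENNReal.ofReal S
        + ENNReal.ofReal η⁻¹ * (ENNReal.ofReal (E / 2) / ENNReal.ofReal |Real.log ε|)) := by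
  have hK0 : 0 ≤ K := (abs_nonneg _).trans (hK 0)
  refine le_trans (lintegral_mono fun t => ?_) ((lintegral_const_mul' _ _
    ENNReal.ofReal_ne_top).le.trans (mul_le_mul_right
      (h.lintegral_lintegral_Rterm_le hn0 hn3 hε hM hu hS hη hE) _))
  rw [← lintegral_const_mul' _ _ ENNReal.ofReal_ne_top, ← Real.norm_eq_abs, ofReal_norm]
  refine (enorm_integral_le_lintegral_enorm _).trans (lintegral_mono fun x => ?_)
  rw [← ENNReal.ofReal_mul hK0, ← ofReal_norm, Real.norm_eq_abs, abs_mul, mul_comm]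
  exact ENNReal.ofReal_le_ofReal (mul_le_mul_of_nonneg_right (hK x) (abs_nonneg _))

/-- The negative part of the production is small in `L¹` in time. -/
theorem lintegral_production_neg_le (h : IsSolutionWith a b n ε uin u ux uxx uxxx) (hab : a < b)
    (hε : ε ∈ Ioo (0 : ℝ) 1) (hu : ∀ t, 0 < t → ∀ x ∈ Icc a b, u t x ≤ M) {E d C K : ℝ}
    (hS : 0 < S) (hE0 : 0 ≤ E) (hC : 0 ≤ C) (hd : 0 < d)
    (hE : ∫⁻ x in Ioo a b, ENNReal.ofReal (1 / 2 * ux 0 x ^ 2) ≤ ENNReal.ofReal (E / 2))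
    {φ : ℝ → ℝ} (hφ : Weight a b K φ)
    (hlow : ∀ w p q z φ : ℝ → ℝ, Slice a b w p q z → Weight a b K φ →
      (∀ x ∈ Icc a b, w x ≤ M) → ∫ x in Ioo a b, p x ^ 2 ≤ E → production a b w p q φ ≤ 1 →
      - C * d - C * (∫ x in Ioo a b, w x ^ 3 * z x ^ 2) / d ^ 5 ≤ production a b w p q φ) :
    ∫⁻ t in Ioo 0 S, ENNReal.ofReal (-∫ x in Ioo a b, Tterm a b u ux uxxx t x * φ x)
      ≤ ENNReal.ofReal (C * d) * ENNReal.ofReal S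
        + ENNReal.ofReal (C / d ^ 5) * (ENNReal.ofReal (E / 2) / ENNReal.ofReal |Real.log ε|) := by
  have key : ∀ᵐ t ∂(volume.restrict (Ioo 0 S)),
      ENNReal.ofReal (-∫ x in Ioo a b, Tterm a b u ux uxxx t x * φ x)
        ≤ ENNReal.ofReal (C * d) + ENNReal.ofReal (C / d ^ 5) * dissipation a b n ε u uxxx t := by
    filter_upwards [ae_restrict_of_ae_restrict_of_subset Ioo_subset_Ioi_self
      (h.ae_slice hab hε hE), ae_restrict_mem measurableSet_Ioo] with t ht htS
    obtain ⟨hD, q, S, hz, hT⟩ := ht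
    have hD0 := ENNReal.toReal_nonneg (a := dissipation a b n ε u uxxx t)
    rw [hT φ hφ.test, ← ENNReal.ofReal_toReal hD.ne, ← ENNReal.ofReal_mul (by positivity),
      ← ENNReal.ofReal_add (by positivity) (by positivity)]
    refine ENNReal.ofReal_le_ofReal ?_
    -- If the production exceeds one, its negative part vanishes and the bound is trivial.
    rcases le_or_gt (production a b (u t) (ux t) q φ) 1 with hp | hp
    · have h1 := hlow _ _ _ _ φ S hφ (hu t htS.1) (h.integral_ux_sq_le hE0 htS.1 hE) hp
      have h2 : C * (∫ x in Ioo a b, u t x ^ 3 * (posSet a b (u t)).indicator (uxxx t) x ^ 2) / d ^ 5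
          ≤ C * (dissipation a b n ε u uxxx t).toReal / d ^ 5 := by gcongr
      have h3 : C / d ^ 5 * (dissipation a b n ε u uxxx t).toReal
        = C * (dissipation a b n ε u uxxx t).toReal / d ^ 5 := by ring
      linarith
    · have : 0 ≤ C * d + C / d ^ 5 * (dissipation a b n ε u uxxx t).toReal := by positivity
      linarith
  refine (lintegral_mono_ae key).trans ?_
  rw [lintegral_add_left measurable_const, setLIntegral_const, Real.volume_Ioo, sub_zero,
    lintegral_const_mul' _ _ ENNReal.ofReal_ne_top]
  gcongr
  exact h.lintegral_dissipation_le hε hS hE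

end IsSolutionWith

/-- Choose `d` first to make `C d` small, then `k`: the factor `K d` may blow up as `d → 0` but is
fixed once `d` is. -/
theorem tendsto_zero_of_forall_le {A e : ℕ → ℝ≥0∞} {C : ℝ} {K : ℝ → ℝ}
    (he : Tendsto e atTop (𝓝 0))
    (h : ∀ d, 0 < d → d ≤ 1 → ∀ k, A k ≤ ENNReal.ofReal (C * d) + ENNReal.ofReal (K d) * e k) :
    Tendsto A atTop (𝓝 0) := by
  rw [ENNReal.tendsto_atTop_zero]
  intro η hη
  obtain ⟨d, hd, hd1, hdη⟩ : ∃ d : ℝ, 0 < d ∧ d ≤ 1 ∧ ENNReal.ofReal (C * d) < η := by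
    have t1 : Tendsto (fun d : ℝ => ENNReal.ofReal (C * d)) (𝓝[>] 0) (𝓝 0) := by
      have : Tendsto (fun d : ℝ => ENNReal.ofReal (C * d)) (𝓝 0) (𝓝 (ENNReal.ofReal (C * 0))) :=
        (ENNReal.continuous_ofReal.comp (continuous_const_mul C)).tendsto 0
      rw [mul_zero, ENNReal.ofReal_zero] at this
      exact this.mono_left nhdsWithin_le_nhds
    obtain ⟨d, hd, hd2⟩ := ((t1.eventually (gt_mem_nhds hη)).and (Ioc_mem_nhdsGT one_pos)).exists
    exact ⟨d, hd2.1, hd2.2, hd⟩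
  have t2 : Tendsto (fun k => ENNReal.ofReal (C * d) + ENNReal.ofReal (K d) * e k) atTop
      (𝓝 (ENNReal.ofReal (C * d) + ENNReal.ofReal (K d) * 0)) :=
    tendsto_const_nhds.add (ENNReal.Tendsto.const_mul he (Or.inr ENNReal.ofReal_ne_top))
  rw [mul_zero, add_zero] at t2
  obtain ⟨N, hN⟩ := eventually_atTop.1 (t2.eventually (gt_mem_nhds hdη))
  exact ⟨N, fun k hk => (h d hd hd1 k).trans (hN k hk).le⟩

end ThinFilm

namespace ThinFilm

/-! ### Extraction of subsequences, and convergence in time -/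

/-- Countably many sequences that converge to zero in `L¹` have a common subsequence that converges
almost everywhere. -/
theorem exists_subseq_ae_tendsto_zero {ι : Type*} [Countable ι] (μ : ι → Measure ℝ)
    (H : ι → ℕ → ℝ → ℝ≥0∞) (hm : ∀ i k, AEMeasurable (H i k) (μ i))
    (h : ∀ i, Tendsto (fun k => ∫⁻ t, H i k t ∂μ i) atTop (𝓝 0)) :
    ∃ σ : ℕ → ℕ, StrictMono σ ∧
      ∀ i, ∀ᵐ t ∂μ i, Tendsto (fun k => H i (σ k) t) atTop (𝓝 0) := by
  obtain ⟨enc, henc⟩ := exists_injective_nat ι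
  -- At stage `k` only the finitely many indices numbered up to `k` are required to have integral at
  -- most `2⁻ᵏ`. For a fixed index the integrals are summable from stage `enc i` on, so the
  -- functions themselves are summable almost everywhere.
  have hev : ∀ k : ℕ, ∀ᶠ m in atTop, ∀ i ∈ {i | enc i ≤ k},
      ∫⁻ t, H i m t ∂μ i ≤ (2⁻¹ : ℝ≥0∞) ^ k := fun k => by
    have hfin : {i | enc i ≤ k}.Finite := (finite_Iic k).preimage henc.injOn
    refine (eventually_all_finite hfin).2 fun i _ => ?_
    exact (h i).eventually (ge_mem_nhds (ENNReal.pow_pos (by simp) k))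
  obtain ⟨σ, hσ, hH⟩ := extraction_forall_of_eventually hev
  refine ⟨σ, hσ, fun i => ?_⟩
  have h1 : ∫⁻ t, ∑' k, H i (σ (k + enc i)) t ∂μ i ≠ ⊤ := by
    rw [lintegral_tsum fun k => hm i _]
    refine ne_top_of_le_ne_top (b := ∑' k : ℕ, (2⁻¹ : ℝ≥0∞) ^ k) ?_ (ENNReal.tsum_le_tsum fun k => ?_)
    · rw [ENNReal.tsum_geometric]
      simp
    · refine (hH (k + enc i) i (by simp)).trans ?_
      exact pow_le_pow_right_of_le_one' (by simp) (Nat.le_add_right _ _)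
  filter_upwards [ae_lt_top' (AEMeasurable.tsum fun k => hm i _) h1] with t ht
  exact (tendsto_add_atTop_iff_nat (enc i)).1 (ENNReal.tendsto_atTop_zero_of_tsum_ne_top ht.ne)

/-- Write `|f| = f + 2 f⁻`. The integral of `f` is the increment of `r` plus the integral of `g`;
the increment tends to `R - L ≤ 0`, while `f⁻` and `g` vanish in `L¹`. -/
theorem lintegral_abs_tendsto_zero {s₁ s₂ T L : ℝ} {r f g : ℕ → ℝ → ℝ} {c : ℕ → ℝ}
    (hs : s₁ < s₂) (h1 : s₁ ∈ Ioo 0 T) (h2 : s₂ ∈ Ioo 0 T)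
    (hf : ∀ k, IntegrableOn (f k) (Ioo 0 T)) (hg : ∀ k, IntegrableOn (g k) (Ioo 0 T))
    (hc1 : ∀ k, r k s₁ = c k + ∫ s in T / 2..s₁, (f k s - g k s))
    (hc2 : ∀ k, r k s₂ = c k + ∫ s in T / 2..s₂, (f k s - g k s))
    (hfn : Tendsto (fun k => ∫⁻ t in Ioo 0 T, ENNReal.ofReal (-f k t)) atTop (𝓝 0))
    (hgn : Tendsto (fun k => ∫⁻ t in Ioo 0 T, ENNReal.ofReal |g k t|) atTop (𝓝 0))
    (hr1 : Tendsto (fun k => r k s₁) atTop (𝓝 L)) {R : ℝ}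
    (hr2 : Tendsto (fun k => r k s₂) atTop (𝓝 R)) (hRL : R ≤ L) :
    Tendsto (fun k => ∫⁻ s in Ioo s₁ s₂, ENNReal.ofReal |f k s|) atTop (𝓝 0) := by
  have hsub : Ioo s₁ s₂ ⊆ Ioo 0 T := Ioo_subset_Ioo h1.1.le h2.2.le
  have bound : ∀ k, ∫⁻ s in Ioo s₁ s₂, ENNReal.ofReal |f k s| ≤ ENNReal.ofReal
      (r k s₂ - r k s₁ + (∫⁻ t in Ioo 0 T, ENNReal.ofReal |g k t|).toReal
        + 2 * (∫⁻ t in Ioo 0 T, ENNReal.ofReal (-f k t)).toReal) := fun k => by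
    have jf := (hf k).mono_set hsub
    have jg := (hg k).mono_set hsub
    have ii : ∀ x ∈ Ioo 0 T, ∀ y ∈ Ioo 0 T,
        IntervalIntegrable (fun s => f k s - g k s) volume x y := fun x hx y hy =>
      locallyIntegrableOn_intervalIntegrable ((hf k).sub (hg k)).locallyIntegrableOn hx hy
    have hT : T / 2 ∈ Ioo 0 T := ⟨by linarith [h1.1, h1.2], by linarith [h1.1, h1.2]⟩
    have e1 : r k s₂ - r k s₁ = (∫ s in Ioo s₁ s₂, f k s) - ∫ s in Ioo s₁ s₂, g k s := by
      rw [hc1, hc2, ← integral_sub jf jg, ← integral_Ioc_eq_integral_Ioo,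
        ← intervalIntegral.integral_of_le hs.le,
        ← intervalIntegral.integral_interval_sub_left (ii _ hT _ h2) (ii _ hT _ h1)]
      ring
    have jn : Integrable (fun t => max (-f k t) 0) (volume.restrict (Ioo 0 T)) := (hf k).neg.pos_part
    have e2 : ∫ s in Ioo s₁ s₂, |f k s|
        = (∫ s in Ioo s₁ s₂, f k s) + 2 * ∫ s in Ioo s₁ s₂, max (-f k s) 0 := by
      rw [← integral_const_mul, ← integral_add jf ((IntegrableOn.mono_set jn hsub).const_mul 2)]
      refine integral_congr_ae (Eventually.of_forall fun s => ?_)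
      rcases le_total (f k s) 0 with h | h
      · simp only [abs_of_nonpos h, max_eq_left (neg_nonneg.2 h)]; ring
      · simp only [abs_of_nonneg h, max_eq_right (neg_nonpos.2 h)]; ring
    have e3 : ∫ s in Ioo s₁ s₂, max (-f k s) 0
        ≤ (∫⁻ t in Ioo 0 T, ENNReal.ofReal (-f k t)).toReal := by
      have : (∫⁻ t in Ioo 0 T, ENNReal.ofReal (-f k t)) =
          ∫⁻ t in Ioo 0 T, ENNReal.ofReal (max (-f k t) 0) :=
        lintegral_congr fun t => by rw [ENNReal.ofReal_max, ENNReal.ofReal_zero, max_eq_left zero_le]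
      rw [this, ← integral_eq_lintegral_of_nonneg_ae (f := fun t => max (-f k t) 0)
        (Eventually.of_forall fun t => le_max_right _ _) jn.aestronglyMeasurable]
      exact setIntegral_mono_set jn (Eventually.of_forall fun t => le_max_right _ _)
        hsub.eventuallyLE
    have e4 : ∫ s in Ioo s₁ s₂, g k s ≤ (∫⁻ t in Ioo 0 T, ENNReal.ofReal |g k t|).toReal := by
      rw [← integral_eq_lintegral_of_nonneg_ae
        (Eventually.of_forall fun t => abs_nonneg _) (hg k).abs.aestronglyMeasurable]
      refine (setIntegral_mono jg jg.abs fun t => le_abs_self _).trans ?_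
      exact setIntegral_mono_set (hg k).abs (Eventually.of_forall fun t => abs_nonneg _)
        hsub.eventuallyLE
    rw [← ofReal_integral_eq_lintegral_ofReal jf.abs (Eventually.of_forall fun t => abs_nonneg _)]
    exact ENNReal.ofReal_le_ofReal (by linarith)
  have lim : Tendsto (fun k => ENNReal.ofReal
      (r k s₂ - r k s₁ + (∫⁻ t in Ioo 0 T, ENNReal.ofReal |g k t|).toReal
        + 2 * (∫⁻ t in Ioo 0 T, ENNReal.ofReal (-f k t)).toReal)) atTop (𝓝 0) := by
    have t1 := (ENNReal.tendsto_toReal ENNReal.zero_ne_top).comp hfn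
    have t2 := (ENNReal.tendsto_toReal ENNReal.zero_ne_top).comp hgn
    have := ENNReal.tendsto_ofReal (((hr2.sub hr1).add t2).add (t1.const_mul 2))
    rwa [ENNReal.toReal_zero, mul_zero, add_zero, add_zero, ENNReal.ofReal_of_nonpos
      (by linarith : R - L ≤ 0)] at this
  exact tendsto_of_tendsto_of_tendsto_of_le_of_le tendsto_const_nhds lim (fun _ => zero_le) bound

/-- If the increments of `r k` are almost non-negative and `r k` converges to a function below `L`,
then the increments vanish in the limit, after almost every time at which the value `L` is taken. -/
theorem ae_exists_rat_tendsto {T L : ℝ} {r f g : ℕ → ℝ → ℝ} {r' : ℝ → ℝ}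
    (hf : ∀ k, IntegrableOn (f k) (Ioo 0 T)) (hg : ∀ k, IntegrableOn (g k) (Ioo 0 T))
    (hc : ∀ k, ∃ c, ∀ᵐ t, t ∈ Ioo 0 T → r k t = c + ∫ s in T / 2..t, (f k s - g k s))
    (hfn : Tendsto (fun k => ∫⁻ t in Ioo 0 T, ENNReal.ofReal (-f k t)) atTop (𝓝 0))
    (hgn : Tendsto (fun k => ∫⁻ t in Ioo 0 T, ENNReal.ofReal |g k t|) atTop (𝓝 0))
    (hr : ∀ᵐ t, t ∈ Ioo 0 T → Tendsto (fun k => r k t) atTop (𝓝 (r' t)))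
    (hle : ∀ᵐ t, t ∈ Ioo 0 T → r' t ≤ L) :
    ∀ᵐ t, t ∈ Ioo 0 T → r' t = L → ∃ q : ℚ × ℚ, 0 ≤ q.1 ∧ t ∈ Ioo (q.1 : ℝ) q.2 ∧
      Tendsto (fun k => ∫⁻ s in Ioo (q.1 : ℝ) q.2, ENNReal.ofReal |f k s|) atTop (𝓝 0) := by
  choose c hc using hc
  have hP : ∀ᵐ t, t ∈ Ioo 0 T → ((∀ k, r k t = c k + ∫ s in T / 2..t, (f k s - g k s)) ∧
      Tendsto (fun k => r k t) atTop (𝓝 (r' t)) ∧ r' t ≤ L) := by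
    filter_upwards [ae_all_iff.2 hc, hr, hle] with t h1 h2 h3 ht
    exact ⟨fun k => h1 k ht, h2 ht, h3 ht⟩
  set P : ℝ → Prop := fun t => (∀ k, r k t = c k + ∫ s in T / 2..t, (f k s - g k s)) ∧
      Tendsto (fun k => r k t) atTop (𝓝 (r' t)) ∧ r' t ≤ L with hPd
  set A : Set ℝ := {t | t ∈ Ioo 0 T ∧ P t ∧ r' t = L} with hA
  -- An earlier time `s₁` at which the value `L` is taken is needed, so that `t` is interior to the
  -- interval. Only a least element of `A` lacks one, and there is at most one such time.
  have hN : {t | t ∈ A ∧ ∀ s ∈ A, t ≤ s}.Subsingleton := fun x hx y hy =>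
    le_antisymm (hx.2 y hy.1) (hy.2 x hx.1)
  have hdense := Measure.dense_of_ae hP
  filter_upwards [hP,
    measure_eq_zero_iff_ae_notMem.1 (hN.measure_zero volume)] with t htP htN ht htL
  have htA : t ∈ A := ⟨ht, htP ht, htL⟩
  obtain ⟨s₁, hs₁A, hs₁⟩ : ∃ s ∈ A, s < t := by
    by_contra! hcon
    exact htN ⟨htA, hcon⟩
  -- The later time may be any good one: there the limit is at most `L`. The interval is then shrunk
  -- to rational ends, so that countably many suffice.
  obtain ⟨s₂, hs₂P, hs₂⟩ := hdense.exists_between ht.2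
  have hs₂T : s₂ ∈ Ioo 0 T := ⟨ht.1.trans hs₂.1, hs₂.2⟩
  obtain ⟨q₁, hq₁⟩ := exists_rat_btwn hs₁
  obtain ⟨q₂, hq₂⟩ := exists_rat_btwn hs₂.1
  refine ⟨(q₁, q₂), ?_, ⟨hq₁.2, hq₂.1⟩, ?_⟩
  · exact_mod_cast (hs₁A.1.1.trans hq₁.1).le
  · have hp1 := hs₁A.2.1
    have hp2 := hs₂P hs₂T
    have := lintegral_abs_tendsto_zero (hs₁.trans hs₂.1) hs₁A.1 hs₂T hf hg hp1.1 hp2.1 hfn hgn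
      (hs₁A.2.2 ▸ hp1.2.1) hp2.2.1 hp2.2.2
    exact tendsto_of_tendsto_of_tendsto_of_le_of_le tendsto_const_nhds this (fun _ => zero_le)
      fun k => lintegral_mono_set (Ioo_subset_Ioo hq₁.1.le hq₂.2.le)

end ThinFilm

namespace ThinFilm

/-! ### Uniform bounds and compactness -/

section Bounds

variable {a b E : ℝ} {f g : ℝ → ℝ}

theorem HasWeakDeriv.integral_mul_deriv {U : Set ℝ} (h : HasWeakDeriv 1 U f g) {φ : ℝ → ℝ}
    (hφ : IsTest U φ) : ∫ x in U, f x * deriv φ x = - ∫ x in U, g x * φ x := by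
  simpa using h.2.2 φ hφ

theorem eLpNorm_two_sq (hg : MemLp g 2 (volume.restrict (Ioo a b))) :
    eLpNorm g 2 (volume.restrict (Ioo a b)) ^ 2 = ENNReal.ofReal (∫ x in Ioo a b, g x ^ 2) := by
  have h1 := eLpNorm_nnreal_pow_eq_lintegral (f := g) (μ := volume.restrict (Ioo a b)) (p := 2)
    (by norm_num)
  rw [ofReal_integral_eq_lintegral_ofReal hg.integrable_sq
    (Eventually.of_forall fun x => sq_nonneg _)]
  norm_num at h1
  rw [h1]
  refine lintegral_congr fun x => ?_
  rw [← ofReal_norm, ← ENNReal.ofReal_pow (norm_nonneg _), Real.norm_eq_abs, sq_abs]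

/-- The `C^{1/2}` estimate written with a free Young parameter `μ`, which avoids square roots. -/
theorem abs_sub_le_of_hasWeakDeriv (hab : a < b) (hf : ContinuousOn f (Icc a b))
    (h : HasWeakDeriv 1 (Ioo a b) f g) (hg : MemLp g 2 (volume.restrict (Ioo a b)))
    (hE : ∫ x in Ioo a b, g x ^ 2 ≤ E) {μ : ℝ} (hμ : 0 < μ) {x y : ℝ} (hx : x ∈ Icc a b)
    (hy : y ∈ Icc a b) : |f y - f x| ≤ μ * |y - x| + E / μ := by
  have hg1 : IntegrableOn g (Ioo a b) := hg.integrable one_le_two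
  wlog hxy : x ≤ y generalizing x y
  · rw [abs_sub_comm, abs_sub_comm y]
    exact this hy hx (le_of_not_ge hxy)
  have hsub : Ioo x y ⊆ Ioo a b := Ioo_subset_Ioo hx.1 hy.2
  have j1 := hg1.mono_set hsub
  have j2 : IntegrableOn (fun x => g x ^ 2) (Ioo a b) := hg.integrable_sq
  have j3 : IntegrableOn (fun x => g x ^ 2 / μ) (Ioo x y) := (j2.mono_set hsub).div_const μ
  rw [sub_eq_integral_of_hasWeakDeriv hab hf hg1 (fun φ hφ => h.integral_mul_deriv hφ) x hx y hy,
    intervalIntegral.integral_of_le hxy, integral_Ioc_eq_integral_Ioo,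
    abs_of_nonneg (sub_nonneg.2 hxy)]
  calc |∫ s in Ioo x y, g s| ≤ ∫ s in Ioo x y, |g s| := abs_integral_le_integral_abs
    _ ≤ ∫ s in Ioo x y, (μ + g s ^ 2 / μ) := by
        refine setIntegral_mono j1.abs ((integrable_const μ).add j3) fun s => ?_
        have h1 : 0 ≤ ((|g s| - μ) ^ 2 + |g s| * μ) / μ := by positivity
        have h2 : ((|g s| - μ) ^ 2 + |g s| * μ) / μ = μ + g s ^ 2 / μ - |g s| := by
          rw [← sq_abs (g s)]; field_simp; ring
        linarith
    _ = μ * (y - x) + (∫ s in Ioo x y, g s ^ 2) / μ := by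
        rw [integral_add (integrable_const μ) j3, integral_div, setIntegral_const, smul_eq_mul,
          measureReal_def, Real.volume_Ioo, ENNReal.toReal_ofReal (sub_nonneg.2 hxy), mul_comm]
    _ ≤ μ * (y - x) + E / μ := by
        have h3 : ∫ s in Ioo x y, g s ^ 2 ≤ ∫ s in Ioo a b, g s ^ 2 :=
          setIntegral_mono_set j2 (Eventually.of_forall fun s => sq_nonneg _) hsub.eventuallyLE
        gcongr
        exact h3.trans hE

/-- Oscillation is bounded by the case `μ = 1` of `abs_sub_le_of_hasWeakDeriv`, and the mean is `1 /
(b - a)`. -/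
theorem le_of_integral_eq_one (hab : a < b) (hf : ContinuousOn f (Icc a b))
    (h : HasWeakDeriv 1 (Ioo a b) f g) (hg : MemLp g 2 (volume.restrict (Ioo a b)))
    (hE : ∫ x in Ioo a b, g x ^ 2 ≤ E) (h1 : ∫ x in Ioo a b, f x = 1) {y : ℝ}
    (hy : y ∈ Icc a b) : f y ≤ 1 / (b - a) + (b - a) + E := by
  have hba : 0 < b - a := sub_pos.2 hab
  have hvol : (volume.restrict (Ioo a b)).real univ = b - a := by
    rw [measureReal_def, Measure.restrict_apply_univ, Real.volume_Ioo, ENNReal.toReal_ofReal hba.le]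
  have h2 : ∫ x in Ioo a b, (f y - ((b - a) + E)) ≤ ∫ x in Ioo a b, f x :=
    setIntegral_mono_on (integrable_const _) (ContinuousOn.integrableOn_Ioo hf) measurableSet_Ioo
      fun x hx => by
        have hx' := Ioo_subset_Icc_self hx
        have h3 := (le_abs_self _).trans (abs_sub_le_of_hasWeakDeriv hab hf h hg hE one_pos hx' hy)
        have h4 : |y - x| ≤ b - a := abs_sub_le_iff.2
          ⟨by linarith [hx'.1, hy.2], by linarith [hx'.2, hy.1]⟩
        rw [div_one, one_mul] at h3
        linarith
  rw [h1, integral_const, hvol, smul_eq_mul] at h2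
  have h5 : f y - ((b - a) + E) ≤ 1 / (b - a) := by
    rw [le_div_iff₀ hba]; linarith
  linarith

theorem HasWeakDeriv.ae_eq {f' g' : ℝ → ℝ} (h : HasWeakDeriv 1 (Ioo a b) f g)
    (h' : HasWeakDeriv 1 (Ioo a b) f' g') (hff : ∀ x ∈ Ioo a b, f x = f' x) :
    g =ᵐ[volume.restrict (Ioo a b)] g' := by
  rcases le_or_gt b a with hab | hab
  · simp [Ioo_eq_empty_of_le hab, EventuallyEq]
  refine (ae_restrict_iff' measurableSet_Ioo).2 ?_
  have key : ∀ᵐ x, x ∈ Ioo a b → g x - g' x = 0 := by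
    refine isOpen_Ioo.ae_eq_zero_of_integral_contDiff_smul_eq_zero (h.2.1.sub h'.2.1)
      fun φ h1 h2 h3 => ?_
    have hφ : IsTest (Ioo a b) φ := ⟨h1, h2, h3⟩
    rw [← setIntegral_eq_integral_of_forall_compl_eq_zero (s := Ioo a b)
      fun x hx => by rw [hφ.eq_zero hx, zero_smul]]
    have e1 : ∫ x in Ioo a b, f x * deriv φ x = ∫ x in Ioo a b, f' x * deriv φ x :=
      setIntegral_congr_fun measurableSet_Ioo fun x hx => by simp only [hff x hx]
    rw [h.integral_mul_deriv hφ, h'.integral_mul_deriv hφ, neg_inj] at e1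
    rw [← sub_eq_zero.2 e1, ← integral_sub (hφ.mul_integrableOn hab h.2.1)
      (hφ.mul_integrableOn hab h'.2.1)]
    exact integral_congr_ae (Eventually.of_forall fun x => by
      simp only [smul_eq_mul]; ring)
  filter_upwards [key] with x hx hxm
  exact sub_eq_zero.1 (hx hxm)

/-- Balls of `H¹(a, b)` are closed under uniform convergence. -/
theorem memH1_of_tendstoUniformlyOn {F G : ℕ → ℝ → ℝ}
    (hF : ∀ k, ContinuousOn (F k) (Icc a b)) (h : ∀ k, HasWeakDeriv 1 (Ioo a b) (F k) (G k))
    (hG : ∀ k, MemLp (G k) 2 (volume.restrict (Ioo a b)))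
    (hE : ∀ k, ∫ x in Ioo a b, G k x ^ 2 ≤ E) {v : ℝ → ℝ}
    (hv : TendstoUniformlyOn F v atTop (Icc a b)) : MemH1 a b v := by
  have hvc : ContinuousOn v (Icc a b) := hv.continuousOn (Frequently.of_forall hF)
  set μ := volume.restrict (Ioo a b) with hμ
  have hE0 : 0 ≤ E := (integral_nonneg fun x => sq_nonneg _).trans (hE 0)
  set L : ℕ → Lp ℝ 2 μ := fun k => (hG k).toLp with hL
  have hLn : ∀ k, ‖L k‖ ≤ √E := fun k => by
    refine Real.le_sqrt_of_sq_le ?_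
    rw [hL, Lp.norm_toLp, ← ENNReal.toReal_pow, eLpNorm_two_sq (hG k)]
    rw [ENNReal.toReal_ofReal (integral_nonneg fun x => sq_nonneg _)]
    exact hE k
  set D : ℕ → WeakDual ℝ (Lp ℝ 2 μ) := fun k =>
    StrongDual.toWeakDual (InnerProductSpace.toDual ℝ (Lp ℝ 2 μ) (L k)) with hDd
  have hcomp := WeakDual.isCompact_closedBall (𝕜 := ℝ) (E := Lp ℝ 2 μ) 0 √E
  -- Banach–Alaoglu: the derivatives are bounded in `L²`, so they converge weakly along an
  -- ultrafilter finer than `atTop`. No weakly convergent subsequence is needed, since the other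
  -- side of the weak-derivative identity converges along `atTop`.
  obtain ⟨ℓ, -, hℓ⟩ := hcomp.ultrafilter_le_nhds' ((hyperfilter ℕ).map D) (by
    refine Ultrafilter.mem_map.2 (Eventually.of_forall fun k => ?_)
    simp only [mem_preimage, Metric.mem_closedBall, dist_zero_right]
    exact ((InnerProductSpace.toDual ℝ (Lp ℝ 2 μ)).norm_map (L k)).le.trans (hLn k))
  have hlim : ∀ φ : Lp ℝ 2 μ, Tendsto (fun k => D k φ) (hyperfilter ℕ : Filter ℕ) (𝓝 (ℓ φ)) :=
    fun φ => (WeakDual.eval_continuous φ).continuousAt.tendsto.comp hℓ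
  set G₀ : Lp ℝ 2 μ := (InnerProductSpace.toDual ℝ (Lp ℝ 2 μ)).symm (WeakDual.toStrongDual ℓ)
    with hG₀
  have hvm : MemLp v 2 μ := by
    obtain ⟨C, hC⟩ := isCompact_Icc.exists_bound_of_continuousOn hvc
    refine MemLp.of_bound (aestronglyMeasurable_of_continuousOn hvc) C ?_
    exact (ae_restrict_mem measurableSet_Ioo).mono fun x hx => hC x (Ioo_subset_Icc_self hx)
  refine ⟨G₀, ⟨?_, ?_, fun φ hφ => ?_⟩, hvm, Lp.memLp G₀⟩
  · exact IntegrableOn.locallyIntegrableOn (hvm.integrable one_le_two)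
  · exact IntegrableOn.locallyIntegrableOn ((Lp.memLp G₀).integrable one_le_two)
  have hφm : MemLp φ 2 μ := by
    obtain ⟨C, hC⟩ := hφ.exists_bound
    exact MemLp.of_bound hφ.continuous.aestronglyMeasurable C (Eventually.of_forall hC)
  have e1 : ∀ k, D k hφm.toLp = ∫ x in Ioo a b, G k x * φ x := fun k => by
    have : D k hφm.toLp = inner ℝ (L k) hφm.toLp := rfl
    rw [this, L2.inner_def]
    refine integral_congr_ae ?_
    filter_upwards [(hG k).coeFn_toLp, hφm.coeFn_toLp] with x h1 h2
    rw [h1, h2]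
    simp [mul_comm]
  have e2 : ℓ hφm.toLp = ∫ x in Ioo a b, G₀ x * φ x := by
    have : ℓ hφm.toLp = inner ℝ G₀ hφm.toLp := by
      rw [hG₀, InnerProductSpace.toDual_symm_apply]; rfl
    rw [this, L2.inner_def]
    refine integral_congr_ae ?_
    filter_upwards [hφm.coeFn_toLp] with x h2
    rw [h2]
    simp [mul_comm]
  have hlim2 := hlim hφm.toLp
  simp only [e1, e2] at hlim2
  have hlim3 : Tendsto (fun k => ∫ x in Ioo a b, F k x * deriv φ x) atTop
      (𝓝 (∫ x in Ioo a b, v x * deriv φ x)) := by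
    obtain ⟨C, hC⟩ := isCompact_Icc.exists_bound_of_continuousOn hvc
    obtain ⟨C', hC'⟩ := hφ.derivative.exists_bound
    refine tendsto_integral_filter_of_dominated_convergence (fun _ => (C + 1) * C')
      (Eventually.of_forall fun k => (aestronglyMeasurable_of_continuousOn (hF k)).mul
        hφ.derivative.continuous.aestronglyMeasurable) ?_ (integrable_const _) ?_
    · filter_upwards [Metric.tendstoUniformlyOn_iff.1 hv 1 one_pos] with k hk
      refine (ae_restrict_mem measurableSet_Ioo).mono fun x hx => ?_
      have hx' := Ioo_subset_Icc_self hx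
      have h1 := hk x hx'
      rw [Real.dist_eq, abs_sub_comm] at h1
      have h2 := hC x hx'
      rw [Real.norm_eq_abs] at h2
      rw [Real.norm_eq_abs, abs_mul]
      have h3 : |F k x| ≤ C + 1 := by
        have := abs_sub_abs_le_abs_sub (F k x) (v x)
        linarith
      exact mul_le_mul h3 (hC' x) (abs_nonneg _) ((abs_nonneg _).trans h3)
    · exact (ae_restrict_mem measurableSet_Ioo).mono fun x hx =>
        (hv.tendsto_at (Ioo_subset_Icc_self hx)).mul_const _
  have hlim4 : Tendsto (fun k => ∫ x in Ioo a b, F k x * deriv φ x) (hyperfilter ℕ : Filter ℕ)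
      (𝓝 (∫ x in Ioo a b, v x * deriv φ x)) :=
    hlim3.mono_left (Nat.hyperfilter_le_atTop)
  have := tendsto_nhds_unique hlim4 (hlim2.neg.congr fun k => ((h k).integral_mul_deriv hφ).symm)
  simpa using this

end Bounds

/-- A bounded equicontinuous family is relatively compact in `C([a, b])`. -/
theorem isCompact_closure_of_bounded {a b M E : ℝ} (A : Set C(Icc a b, ℝ))
    (hM : ∀ g ∈ A, ∀ x, |g x| ≤ M)
    (hE : ∀ g ∈ A, ∀ μ, 0 < μ → ∀ x y : Icc a b, |g y - g x| ≤ μ * |(y : ℝ) - x| + E / μ) :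
    IsCompact (closure A) := by
  set e := (ContinuousMap.isometryEquivBoundedOfCompact (Icc a b) ℝ).toHomeomorph with he
  rw [← e.isCompact_image, e.image_closure]
  refine BoundedContinuousFunction.arzela_ascoli (Metric.closedBall 0 M)
    (isCompact_closedBall _ _) _ ?_ ?_
  · rintro _ x ⟨g, hg, rfl⟩
    rw [mem_closedBall_zero_iff]
    exact hM g hg x
  · refine fun x₀ => Metric.equicontinuousAt_iff.2 fun η hη => ?_
    -- This makes `E / μ < η / 2`; the radius `η / (2 μ)` takes care of the other half.
    set μ := 2 * (|E| + 1) / η with hμ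
    have hμ0 : 0 < μ := by positivity
    refine ⟨η / (2 * μ), by positivity, fun x hx i => ?_⟩
    obtain ⟨_, g, hg, rfl⟩ := i
    have h1 := hE g hg μ hμ0 x₀ x
    rw [Subtype.dist_eq, Real.dist_eq, lt_div_iff₀ (by positivity)] at hx
    have h2 : E / μ < η / 2 := by
      rw [hμ, div_div_eq_mul_div, div_lt_div_iff₀ (by positivity) two_pos]
      nlinarith [le_abs_self E]
    change dist (g x₀) (g x) < η
    rw [dist_comm, Real.dist_eq]
    linarith

/-- All solutions start from `uin`, so `ux 0` is its weak derivative almost everywhere, and the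
initial energy does not depend on `ε`. Mass one converts the energy bound into a sup bound. -/
theorem exists_uniform_bounds {a b n : ℝ} (hab : a < b) {uin : ℝ → ℝ} (hH1 : MemH1 a b uin)
    (hmass : ∫ x in Ioo a b, uin x = 1) : ∃ E M : ℝ, 0 ≤ E ∧ 1 ≤ M ∧
      ∀ (ε : ℝ) (u ux uxx uxxx : ℝ → ℝ → ℝ), IsSolutionWith a b n ε uin u ux uxx uxxx →
        ∫⁻ x in Ioo a b, ENNReal.ofReal (1 / 2 * ux 0 x ^ 2) ≤ ENNReal.ofReal (E / 2) ∧
        ∀ t, 0 < t → ∀ x ∈ Icc a b, u t x ≤ M := by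
  obtain ⟨g, hg, -, hg2⟩ := hH1
  have hE0 : 0 ≤ ∫ x in Ioo a b, g x ^ 2 := integral_nonneg fun x => sq_nonneg _
  refine ⟨∫ x in Ioo a b, g x ^ 2, max 1 (1 / (b - a) + (b - a) + ∫ x in Ioo a b, g x ^ 2), hE0,
    le_max_left _ _, fun ε u ux uxx uxxx h => ?_⟩
  have h0 : ux 0 =ᵐ[volume.restrict (Ioo a b)] g :=
    (h.deriv_one 0 le_rfl).1.ae_eq hg fun x hx => h.initial x (Ioo_subset_Icc_self hx)
  have hE : ∫⁻ x in Ioo a b, ENNReal.ofReal (1 / 2 * ux 0 x ^ 2)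
      ≤ ENNReal.ofReal ((∫ x in Ioo a b, g x ^ 2) / 2) := by
    rw [div_eq_inv_mul (∫ x in Ioo a b, g x ^ 2), ← integral_const_mul, ofReal_integral_eq_lintegral_ofReal
      (hg2.integrable_sq.const_mul _) (Eventually.of_forall fun x => by
        simp only [Pi.zero_apply]; positivity)]
    refine (lintegral_congr_ae ?_).le
    filter_upwards [h0] with x hx
    rw [hx, one_div]
  refine ⟨hE, fun t ht x hx => le_max_of_le_right ?_⟩
  exact le_of_integral_eq_one hab (h.slice_continuousOn ht.le) (h.deriv_one t ht.le).1
    (h.deriv_one t ht.le).2 (h.integral_ux_sq_le hE0 ht hE) ((h.mass t ht).trans hmass) hx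

theorem IsSolutionWith.h1NormLE {a b n ε M E t : ℝ} {uin : ℝ → ℝ} {u ux uxx uxxx : ℝ → ℝ → ℝ}
    (h : IsSolutionWith a b n ε uin u ux uxx uxxx) (hab : a < b) (hE0 : 0 ≤ E) (ht : 0 < t)
    (hE : ∫⁻ x in Ioo a b, ENNReal.ofReal (1 / 2 * ux 0 x ^ 2) ≤ ENNReal.ofReal (E / 2))
    (hu : ∀ x ∈ Icc a b, u t x ≤ M) : H1NormLE a b (u t) √(M ^ 2 * (b - a) + E) := by
  have hba : 0 < b - a := sub_pos.2 hab
  have hw := h.slice_continuousOn ht.le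
  have hum : MemLp (u t) 2 (volume.restrict (Ioo a b)) := by
    refine MemLp.of_bound (aestronglyMeasurable_of_continuousOn hw) M ?_
    exact (ae_restrict_mem measurableSet_Ioo).mono fun x hx => by
      have hx' := Ioo_subset_Icc_self hx
      rw [Real.norm_of_nonneg (h.nonneg t ht.le x hx')]
      exact hu x hx'
  refine ⟨ux t, (h.deriv_one t ht.le).1, hum, (h.deriv_one t ht.le).2, ?_⟩
  rw [eLpNorm_two_sq hum, eLpNorm_two_sq (h.deriv_one t ht.le).2, Real.sq_sqrt (by positivity),
    ← ENNReal.ofReal_add (integral_nonneg fun x => sq_nonneg _)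
      (integral_nonneg fun x => sq_nonneg _)]
  refine ENNReal.ofReal_le_ofReal (add_le_add ?_ (h.integral_ux_sq_le hE0 ht hE))
  have h1 : ∫ x in Ioo a b, u t x ^ 2 ≤ ∫ x in Ioo a b, M ^ 2 :=
    setIntegral_mono_on hum.integrable_sq (integrable_const _) measurableSet_Ioo fun x hx => by
      have hx' := Ioo_subset_Icc_self hx
      exact pow_le_pow_left₀ (h.nonneg t ht.le x hx') (hu x hx') 2
  rwa [setIntegral_const, smul_eq_mul, measureReal_def, Real.volume_Ioo,
    ENNReal.toReal_ofReal hba.le, mul_comm] at h1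

theorem bounded_and_relatively_compact {a b n : ℝ} (hab : a < b) {uin : ℝ → ℝ}
    (hH1 : MemH1 a b uin) (hmass : ∫ x in Ioo a b, uin x = 1) {u : ℝ → ℝ → ℝ → ℝ}
    (hu : ∀ ε ∈ Ioo (0 : ℝ) 1, IsSolution a b n ε uin (u ε)) {t : ℝ} (ht : 0 < t) :
    (∃ C : ℝ, ∀ ε ∈ Ioo (0 : ℝ) 1, H1NormLE a b (u ε t) C) ∧
      IsCompact (closure
        {g : C(Icc a b, ℝ) | ∃ ε ∈ Ioo (0 : ℝ) 1, ∀ x : Icc a b, g x = u ε t x}) := by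
  obtain ⟨E, M, hE0, -, H⟩ := exists_uniform_bounds (n := n) hab hH1 hmass
  refine ⟨⟨√(M ^ 2 * (b - a) + E), fun ε hε => ?_⟩,
    isCompact_closure_of_bounded (M := M) (E := E) _ ?_ ?_⟩
  · obtain ⟨ux, uxx, uxxx, h⟩ := hu ε hε
    obtain ⟨hE, hM⟩ := H _ _ _ _ _ h
    exact h.h1NormLE hab hE0 ht hE (hM t ht)
  · rintro g ⟨ε, hε, hg⟩ x
    obtain ⟨ux, uxx, uxxx, h⟩ := hu ε hε
    rw [hg, abs_of_nonneg (h.nonneg t ht.le x x.2)]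
    exact (H _ _ _ _ _ h).2 t ht x x.2
  · rintro g ⟨ε, hε, hg⟩ μ hμ x y
    obtain ⟨ux, uxx, uxxx, h⟩ := hu ε hε
    rw [hg, hg]
    exact abs_sub_le_of_hasWeakDeriv hab (h.slice_continuousOn ht.le) (h.deriv_one t ht.le).1
      (h.deriv_one t ht.le).2 (h.integral_ux_sq_le hE0 ht (H _ _ _ _ _ h).1) hμ x.2 y.2

end ThinFilm

namespace ThinFilm

/-! ### Sequences of solutions -/

/-- A sequence of solutions with `ε → 0`, with uniform bounds. -/
structure SolutionSeq (a b n E M : ℝ) (uin : ℝ → ℝ) (e : ℕ → ℝ) (u ux uxx uxxx : ℕ → ℝ → ℝ → ℝ) :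
    Prop where
  hab : a < b
  hn0 : 0 < n
  hn3 : n < 3
  energy_nonneg : 0 ≤ E
  one_le : 1 ≤ M
  mem : ∀ k, e k ∈ Ioo (0 : ℝ) 1
  tendsto : Tendsto e atTop (𝓝 0)
  sol : ∀ k, IsSolutionWith a b n (e k) uin (u k) (ux k) (uxx k) (uxxx k)
  energy_le : ∀ k, ∫⁻ x in Ioo a b, ENNReal.ofReal (1 / 2 * ux k 0 x ^ 2) ≤ ENNReal.ofReal (E / 2)
  le : ∀ k t, 0 < t → ∀ x ∈ Icc a b, u k t x ≤ M

namespace SolutionSeq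

variable {a b n E M : ℝ} {uin : ℝ → ℝ} {e : ℕ → ℝ} {u ux uxx uxxx : ℕ → ℝ → ℝ → ℝ}

theorem subseq (h : SolutionSeq a b n E M uin e u ux uxx uxxx) {σ : ℕ → ℕ} (hσ : StrictMono σ) :
    SolutionSeq a b n E M uin (fun k => e (σ k)) (fun k => u (σ k)) (fun k => ux (σ k))
      (fun k => uxx (σ k)) (fun k => uxxx (σ k)) where
  hab := h.hab
  hn0 := h.hn0
  hn3 := h.hn3
  energy_nonneg := h.energy_nonneg
  one_le := h.one_le
  mem _ := h.mem _
  tendsto := h.tendsto.comp hσ.tendsto_atTop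
  sol _ := h.sol _
  energy_le _ := h.energy_le _
  le _ := h.le _

theorem tendsto_abs_log (h : SolutionSeq a b n E M uin e u ux uxx uxxx) :
    Tendsto (fun k => |Real.log (e k)|) atTop atTop :=
  tendsto_abs_atBot_atTop.comp (Real.tendsto_log_nhdsGT_zero.comp
    (tendsto_nhdsWithin_iff.2 ⟨h.tendsto, Eventually.of_forall fun k => (h.mem k).1⟩))

theorem tendsto_energy_div_log (h : SolutionSeq a b n E M uin e u ux uxx uxxx) :
    Tendsto (fun k => ENNReal.ofReal (E / 2) / ENNReal.ofReal |Real.log (e k)|) atTop (𝓝 0) := by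
  have h1 : Tendsto (fun k => ENNReal.ofReal ((E / 2) / |Real.log (e k)|)) atTop
      (𝓝 (ENNReal.ofReal 0)) := ENNReal.tendsto_ofReal (h.tendsto_abs_log.const_div_atTop _)
  rw [ENNReal.ofReal_zero] at h1
  exact h1.congr fun k => ENNReal.ofReal_div_of_pos (abs_log_pos (h.mem k))

theorem tendsto_const_div_log (h : SolutionSeq a b n E M uin e u ux uxx uxxx) (c : ℝ) :
    Tendsto (fun k => 1 + c / |Real.log (e k)|) atTop (𝓝 1) := by
  simpa using (h.tendsto_abs_log.const_div_atTop c).const_add 1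

theorem rho_nonneg (h : SolutionSeq a b n E M uin e u ux uxx uxxx) (k : ℕ) {t x : ℝ} (ht : 0 < t)
    (hx : x ∈ Icc a b) : 0 ≤ Beps n (e k) (u k t x) :=
  Beps_nonneg n (h.mem k).1 ((h.sol k).nonneg t ht.le x hx)

theorem rho_le (h : SolutionSeq a b n E M uin e u ux uxx uxxx) (k : ℕ) {t x : ℝ} (ht : 0 < t)
    (hx : x ∈ Icc a b) : Beps n (e k) (u k t x) ≤ 1 + (B n 1 + Real.log M) / |Real.log (e k)| :=
  Beps_le h.hn0 h.hn3 (h.mem k) h.one_le ((h.sol k).nonneg t ht.le x hx) (h.le k t ht x hx)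

theorem integrableOn_rho (h : SolutionSeq a b n E M uin e u ux uxx uxxx) (k : ℕ) {t : ℝ}
    (ht : 0 < t) : IntegrableOn (fun x => Beps n (e k) (u k t x)) (Ioo a b) := by
  refine Integrable.of_bound (C := 1 + (B n 1 + Real.log M) / |Real.log (e k)|) ?_ ?_
  · have hw := (aestronglyMeasurable_of_continuousOn ((h.sol k).slice_continuousOn ht.le))
    refine (((measurable_Beps_max h.hn0 h.hn3 (h.mem k).1).comp_aemeasurable
      hw.aemeasurable).aestronglyMeasurable).congr ?_
    refine (ae_restrict_mem measurableSet_Ioo).mono fun x hx => ?_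
    simp only [Function.comp_apply,
      max_eq_left ((h.sol k).nonneg t ht.le x (Ioo_subset_Icc_self hx))]
  · refine (ae_restrict_mem measurableSet_Ioo).mono fun x hx => ?_
    have hx' := Ioo_subset_Icc_self hx
    rw [Real.norm_of_nonneg (h.rho_nonneg k ht hx')]
    exact h.rho_le k ht hx'

/-- In the limit the density is at most one. -/
theorem le_of_tendsto_rho (h : SolutionSeq a b n E M uin e u ux uxx uxxx) {φ : ℝ → ℝ}
    (hφ : IsTest (Ioo a b) φ) (hφ0 : ∀ x, 0 ≤ φ x) {t R : ℝ} (ht : 0 < t)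
    (hR : Tendsto (fun k => ∫ x in Ioo a b, Beps n (e k) (u k t x) * φ x) atTop (𝓝 R)) :
    R ≤ ∫ x in Ioo a b, φ x := by
  have hφi : IntegrableOn φ (Ioo a b) :=
    ContinuousOn.integrableOn_Ioo hφ.continuous.continuousOn
  have h1 : Tendsto (fun k => (1 + (B n 1 + Real.log M) / |Real.log (e k)|)
      * ∫ x in Ioo a b, φ x) atTop (𝓝 (1 * ∫ x in Ioo a b, φ x)) :=
    (h.tendsto_const_div_log _).mul_const _
  rw [one_mul] at h1
  refine le_of_tendsto_of_tendsto' hR h1 fun k => ?_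
  rw [← integral_const_mul]
  refine setIntegral_mono_on (hφ.mul_integrableOn h.hab
    (h.integrableOn_rho k ht).locallyIntegrableOn) (hφi.const_mul _) measurableSet_Ioo fun x hx => ?_
  exact mul_le_mul_of_nonneg_right (h.rho_le k ht (Ioo_subset_Icc_self hx)) (hφ0 x)

end SolutionSeq

/-! ### Convergence of the densities at almost every time -/

/-- An `L¹` bound extends convergence from a uniformly dense family of test functions. -/
theorem tendsto_integral_mul_of_approx {a b K : ℝ} {w : ℕ → ℝ → ℝ} {φ : ℝ → ℝ}
    (hw : ∀ k, IntegrableOn (w k) (Ioo a b)) (hK : ∀ k, ∫ x in Ioo a b, |w k x| ≤ K)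
    (hφ : Continuous φ)
    (happ : ∀ η, 0 < η → ∃ ψ : ℝ → ℝ, Continuous ψ ∧ (∀ x ∈ Ioo a b, |φ x - ψ x| ≤ η) ∧
      Tendsto (fun k => ∫ x in Ioo a b, w k x * ψ x) atTop (𝓝 0)) :
    Tendsto (fun k => ∫ x in Ioo a b, w k x * φ x) atTop (𝓝 0) := by
  have hK0 : 0 ≤ K := (integral_nonneg fun x => abs_nonneg _).trans (hK 0)
  have hmul : ∀ (k : ℕ) (ψ : ℝ → ℝ), Continuous ψ →
      IntegrableOn (fun x => w k x * ψ x) (Ioo a b) := fun k ψ hψ => by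
    obtain ⟨C, hC⟩ := isCompact_Icc.exists_bound_of_continuousOn (hψ.continuousOn (s := Icc a b))
    exact (hw k).mul_bdd hψ.aestronglyMeasurable
      ((ae_restrict_mem measurableSet_Ioo).mono fun x hx => hC x (Ioo_subset_Icc_self hx))
  rw [Metric.tendsto_atTop']
  intro δ hδ
  obtain ⟨ψ, hψ, h1, h2⟩ := happ (δ / (2 * (K + 1))) (by positivity)
  obtain ⟨N, hN⟩ := Metric.tendsto_atTop'.1 h2 (δ / 2) (by positivity)
  refine ⟨N, fun k hk => ?_⟩
  have h3 := hN k hk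
  rw [dist_zero_right, Real.norm_eq_abs] at h3 ⊢
  have h4 : |(∫ x in Ioo a b, w k x * φ x) - ∫ x in Ioo a b, w k x * ψ x|
      ≤ δ / (2 * (K + 1)) * K := by
    rw [← integral_sub (hmul k φ hφ) (hmul k ψ hψ)]
    refine abs_integral_le_integral_abs.trans
      (le_trans ?_ (mul_le_mul_of_nonneg_left (hK k) (by positivity)))
    rw [← integral_const_mul]
    refine setIntegral_mono_on ((hmul k φ hφ).sub (hmul k ψ hψ)).abs ((hw k).abs.const_mul _)
      measurableSet_Ioo fun x hx => ?_
    rw [← mul_sub, abs_mul, mul_comm]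
    exact mul_le_mul_of_nonneg_right (h1 x hx) (abs_nonneg _)
  have h5 : δ / (2 * (K + 1)) * K ≤ δ / 2 := by
    rw [div_mul_eq_mul_div, div_le_div_iff₀ (by positivity) two_pos]
    nlinarith
  have h6 := abs_sub_abs_le_abs_sub (∫ x in Ioo a b, w k x * φ x) (∫ x in Ioo a b, w k x * ψ x)
  linarith

/-- A countable family of normalised test functions that is dense for uniform convergence. -/
theorem exists_countable_dense_test (a b : ℝ) : ∃ D : Set (ℝ → ℝ), D.Countable ∧
    (∀ φ ∈ D, IsTest (Ioo a b) φ ∧ ∀ x, |φ x| ≤ 1 ∧ |deriv φ x| ≤ 1) ∧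
    ∀ φ, IsTest (Ioo a b) φ → (∀ x, |φ x| ≤ 1 ∧ |deriv φ x| ≤ 1) → ∀ η, 0 < η →
      ∃ ψ ∈ D, ∀ x ∈ Ioo a b, |φ x - ψ x| ≤ η := by
  set N : Set (ℝ → ℝ) := {φ | IsTest (Ioo a b) φ ∧ ∀ x, |φ x| ≤ 1 ∧ |deriv φ x| ≤ 1} with hN
  set R : N → C(Icc a b, ℝ) := fun φ => ⟨fun x => φ.1 x, by
    have := φ.2.1.continuous; fun_prop⟩ with hR
  -- Any subset of the separable space `C([a, b])` contains a countable set dense in it; the family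
  -- thus consists of admissible test functions.
  obtain ⟨T, hTs, hTc, hTd⟩ :=
    (TopologicalSpace.IsSeparable.of_separableSpace (range R)).exists_countable_dense_subset
  have hpre : ∀ F : T, ∃ φ, R φ = F.1 := fun F => hTs F.2
  choose P hP using hpre
  have : Countable T := hTc.to_subtype
  refine ⟨range fun F => (P F).1, countable_range _, ?_, fun φ h1 h2 η hη => ?_⟩
  · rintro _ ⟨F, rfl⟩
    exact (P F).2
  · obtain ⟨F, hF, hd⟩ := Metric.mem_closure_iff.1 (hTd ⟨⟨φ, h1, h2⟩, rfl⟩) η hη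
    refine ⟨_, ⟨⟨F, hF⟩, rfl⟩, fun x hx => ?_⟩
    have h3 := (ContinuousMap.dist_apply_le_dist (f := R ⟨φ, h1, h2⟩) (g := F)
      ⟨x, Ioo_subset_Icc_self hx⟩).trans hd.le
    rw [← show R (P ⟨F, hF⟩) = F from hP ⟨F, hF⟩, Real.dist_eq] at h3
    exact h3

/-- `negSobolevNorm` tests only with functions normalised in this way. -/
theorem IsTest.exists_normalized {a b : ℝ} {φ : ℝ → ℝ} (hφ : IsTest (Ioo a b) φ) :
    ∃ C ψ, IsTest (Ioo a b) ψ ∧ (∀ x, |ψ x| ≤ 1 ∧ |deriv ψ x| ≤ 1) ∧ ∀ x, φ x = C * ψ x := by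
  obtain ⟨K, hK⟩ := hφ.exists_bound
  obtain ⟨K', hK'⟩ := hφ.derivative.exists_bound
  have h0 : 0 ≤ K := (abs_nonneg _).trans (hK 0)
  have h0' : 0 ≤ K' := (abs_nonneg _).trans (hK' 0)
  have hC : 0 < K + K' + 1 := by linarith
  refine ⟨K + K' + 1, _, hφ.const_mul (K + K' + 1)⁻¹, fun x => ?_, fun x => ?_⟩
  · rw [deriv_const_mul _ (hφ.differentiable x), abs_mul, abs_mul, abs_inv, abs_of_pos hC,
      inv_mul_le_iff₀ hC, inv_mul_le_iff₀ hC]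
    constructor <;> linarith [hK x, hK' x]
  · field_simp

/-- For a normalised test function the pairing is at most the `W^{-1,1}` norm, so it converges in
`L¹(0, S)`. A diagonal subsequence gives convergence at almost every time for a countable family,
and the uniform bound on `ρ^ε` extends it to all test functions, with an exceptional set independent
of the test function. -/
theorem SolutionSeq.exists_subseq_tendsto_rho {a b n E M : ℝ} {uin : ℝ → ℝ} {e : ℕ → ℝ}
    {u ux uxx uxxx : ℕ → ℝ → ℝ → ℝ} (h : SolutionSeq a b n E M uin e u ux uxx uxxx)
    {p : ℝ≥0∞} (hp : 1 ≤ p) {ρ : ℝ → ℝ → ℝ}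
    (hρ : ∀ S : ℝ, 0 < S → IntegrableOn (Function.uncurry ρ) (Ioo 0 S ×ˢ Ioo a b))
    (hconv : TendstoLpNegSobolev a b p (fun k t x => Beps n (e k) (u k t x)) ρ) :
    ∃ σ : ℕ → ℕ, StrictMono σ ∧ ∀ᵐ t ∂(volume.restrict (Ioi (0 : ℝ))),
      IntegrableOn (ρ t) (Ioo a b) ∧ ∀ φ, IsTest (Ioo a b) φ →
        Tendsto (fun k => ∫ x in Ioo a b, Beps n (e (σ k)) (u (σ k) t x) * φ x) atTop
          (𝓝 (∫ x in Ioo a b, ρ t x * φ x)) := by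
  obtain ⟨D, hDc, hD, hdense⟩ := exists_countable_dense_test a b
  have : Countable D := hDc.to_subtype
  have hρ' : ∀ S : ℝ, 0 < S → Integrable (Function.uncurry ρ)
      ((volume.restrict (Ioo 0 S)).prod (volume.restrict (Ioo a b))) := fun S hS => by
    rw [Measure.prod_restrict]; exact hρ S hS
  have hdiff : ∀ k (S : ℝ), 0 < S →
      Integrable (Function.uncurry fun t x => Beps n (e k) (u k t x) - ρ t x)
        ((volume.restrict (Ioo 0 S)).prod (volume.restrict (Ioo a b))) := fun k S hS =>
    ((h.sol k).integrable_rho h.hn0 h.hn3 (h.mem k) h.one_le (h.le k)).sub (hρ' S hS)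
  have hF : ∀ φ ∈ D, ∀ k (S : ℝ), 0 < S → IntegrableOn
      (fun t => ∫ x in Ioo a b, (Beps n (e k) (u k t x) - ρ t x) * φ x) (Ioo 0 S) :=
    fun φ hφ k S hS => integrable_integral_mul (hdiff k S hS) (hD φ hφ).1.continuous
      fun x => ((hD φ hφ).2 x).1
  have hlim : ∀ φ ∈ D, ∀ S : ℝ, 0 < S → Tendsto (fun k => ∫⁻ t in Ioo 0 S,
      ENNReal.ofReal |∫ x in Ioo a b, (Beps n (e k) (u k t x) - ρ t x) * φ x|) atTop (𝓝 0) := by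
    intro φ hφ S hS
    -- The constant of the embedding of `L^p` in `L¹` on a bounded time interval.
    have hc : (volume.restrict (Ioo 0 S)) univ ^ (1 / (1 : ℝ≥0∞).toReal - 1 / p.toReal) ≠ ⊤ := by
      refine (ENNReal.rpow_lt_top_of_nonneg ?_ ?_).ne
      · rcases eq_or_ne p ⊤ with rfl | hpt
        · simp
        · have := (ENNReal.toReal_le_toReal ENNReal.one_ne_top hpt).2 hp
          rw [ENNReal.toReal_one] at this
          rw [ENNReal.toReal_one, sub_nonneg, div_one, div_le_one (by linarith)]
          exact this
      · simp
    have h1 := ENNReal.Tendsto.mul_const (hconv S hS) (Or.inr hc)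
    rw [zero_mul] at h1
    refine tendsto_of_tendsto_of_tendsto_of_le_of_le tendsto_const_nhds h1 (fun _ => zero_le)
      fun k => ?_
    have h2 : ∫⁻ t in Ioo 0 S,
        ENNReal.ofReal |∫ x in Ioo a b, (Beps n (e k) (u k t x) - ρ t x) * φ x|
        = eLpNorm (fun t => ∫ x in Ioo a b, (Beps n (e k) (u k t x) - ρ t x) * φ x) 1
          (volume.restrict (Ioo 0 S)) := by
      rw [eLpNorm_one_eq_lintegral_enorm]
      exact lintegral_congr fun t => by rw [← Real.norm_eq_abs, ofReal_norm]
    dsimp only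
    rw [h2]
    refine (eLpNorm_le_eLpNorm_mul_rpow_measure_univ hp
      (hF φ hφ k S hS).aestronglyMeasurable).trans ?_
    gcongr
    refine eLpNorm_mono_enorm fun t => ?_
    rw [← ofReal_norm, Real.norm_eq_abs, enorm_eq_self]
    exact le_iSup₂ (f := fun (φ : ℝ → ℝ) (_ : φ ∈ {φ : ℝ → ℝ | IsTest (Ioo a b) φ ∧
      ∀ x, |φ x| ≤ 1 ∧ |deriv φ x| ≤ 1}) =>
        ENNReal.ofReal |∫ x in Ioo a b, (Beps n (e k) (u k t x) - ρ t x) * φ x|) φ (hD φ hφ)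
  obtain ⟨σ, hσ, hH⟩ := exists_subseq_ae_tendsto_zero (ι := ℕ × D)
    (fun i => volume.restrict (Ioo (0 : ℝ) (i.1 + 1)))
    (fun i k t => ENNReal.ofReal
      |∫ x in Ioo a b, (Beps n (e k) (u k t x) - ρ t x) * (i.2 : ℝ → ℝ) x|)
    (fun i k => ((hF i.2 i.2.2 k _ (by positivity)).abs).aestronglyMeasurable.aemeasurable.ennreal_ofReal)
    (fun i => hlim i.2 i.2.2 _ (by positivity))
  refine ⟨σ, hσ, ?_⟩
  have hint : ∀ N : ℕ, ∀ᵐ t, t ∈ Ioo (0 : ℝ) (N + 1) → IntegrableOn (ρ t) (Ioo a b) := fun N =>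
    (ae_restrict_iff' measurableSet_Ioo).1 (hρ' (N + 1) (by positivity)).prod_right_ae
  have hH' : ∀ i : ℕ × D, ∀ᵐ t, t ∈ Ioo (0 : ℝ) (i.1 + 1) → Tendsto (fun k => ENNReal.ofReal
      |∫ x in Ioo a b, (Beps n (e (σ k)) (u (σ k) t x) - ρ t x) * (i.2 : ℝ → ℝ) x|) atTop (𝓝 0) :=
    fun i => (ae_restrict_iff' measurableSet_Ioo).1 (hH i)
  rw [ae_restrict_iff' measurableSet_Ioi]
  filter_upwards [ae_all_iff.2 hint, ae_all_iff.2 hH'] with t h1 h2 ht0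
  have ht : 0 < t := ht0
  obtain ⟨N, hN⟩ := exists_nat_gt t
  have htN : t ∈ Ioo (0 : ℝ) (N + 1) := ⟨ht, by linarith⟩
  have hρt := h1 N htN
  refine ⟨hρt, fun φ hφ => ?_⟩
  obtain ⟨c, hc⟩ := (h.tendsto_const_div_log (B n 1 + Real.log M)).bddAbove_range
  have hr := fun k => h.integrableOn_rho (σ k) ht
  have hL1 : ∀ k, ∫ x in Ioo a b, |Beps n (e (σ k)) (u (σ k) t x) - ρ t x|
      ≤ ∫ x in Ioo a b, (c + |ρ t x|) := fun k => by
    refine setIntegral_mono_on ((hr k).sub hρt).abs ((integrable_const c).add hρt.abs)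
      measurableSet_Ioo fun x hx => ?_
    have h3 := h.rho_nonneg (σ k) ht (Ioo_subset_Icc_self hx)
    have h4 := (h.rho_le (σ k) ht (Ioo_subset_Icc_self hx)).trans (hc ⟨σ k, rfl⟩)
    refine (abs_sub _ _).trans ?_
    rw [abs_of_nonneg h3]
    linarith
  have key : ∀ ψ, IsTest (Ioo a b) ψ → (∀ x, |ψ x| ≤ 1 ∧ |deriv ψ x| ≤ 1) →
      Tendsto (fun k => ∫ x in Ioo a b, (Beps n (e (σ k)) (u (σ k) t x) - ρ t x) * ψ x) atTop
        (𝓝 0) := fun ψ hψ hψ1 => by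
    refine tendsto_integral_mul_of_approx (fun k => (hr k).sub hρt) hL1 hψ.continuous
      fun η hη => ?_
    obtain ⟨χ, hχ, hχ'⟩ := hdense ψ hψ hψ1 η hη
    refine ⟨χ, (hD χ hχ).1.continuous, hχ', ?_⟩
    have h5 := (ENNReal.tendsto_toReal ENNReal.zero_ne_top).comp (h2 (N, ⟨χ, hχ⟩) htN)
    refine (tendsto_zero_iff_abs_tendsto_zero _).2 (h5.congr fun k => ?_)
    simp only [Function.comp_apply]
    rw [ENNReal.toReal_ofReal (abs_nonneg _)]
  obtain ⟨C, ψ, hψ, hψ1, hCψ⟩ := hφ.exists_normalized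
  have h6 := ((key ψ hψ hψ1).const_mul C).add_const (∫ x in Ioo a b, ρ t x * φ x)
  rw [mul_zero, zero_add] at h6
  refine h6.congr fun k => ?_
  rw [← integral_const_mul, ← integral_add]
  · exact integral_congr_ae (Eventually.of_forall fun x => by simp only [hCψ]; ring)
  · exact (hψ.mul_integrableOn h.hab ((hr k).sub hρt).locallyIntegrableOn).const_mul C
  · exact hφ.mul_integrableOn h.hab hρt.locallyIntegrableOn

end ThinFilm

namespace ThinFilm

/-! ### Vanishing production after saturation -/

theorem IsTest.pow_four {U : Set ℝ} {ψ : ℝ → ℝ} (h : IsTest U ψ) : IsTest U (fun x => ψ x ^ 4) := by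
  simpa [← pow_succ'] using h.mul (h.smooth.pow 3)

/-- A countable family of test functions concentrated near every point. -/
theorem exists_countable_bumps (a b : ℝ) : ∃ W : Set (ℝ → ℝ), W.Countable ∧
    (∀ ψ ∈ W, IsTest (Ioo a b) ψ) ∧ ∀ y ∈ Ioo a b, ∀ r, 0 < r →
      ∃ ψ ∈ W, IsTest (Metric.ball y r ∩ Ioo a b) ψ ∧ ψ y ≠ 0 := by
  let ι := {q : ℚ × ℚ // 0 < (q.2 : ℝ) ∧ Metric.closedBall (q.1 : ℝ) q.2 ⊆ Ioo a b}
  let f : ∀ i : ι, ContDiffBump (i.1.1 : ℝ) := fun i =>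
    ⟨i.1.2 / 2, i.1.2, half_pos i.2.1, half_lt_self i.2.1⟩
  have ht : ∀ (i : ι) (U : Set ℝ), Metric.closedBall (i.1.1 : ℝ) i.1.2 ⊆ U → IsTest U (f i) :=
    fun i U hU => ⟨(f i).contDiff, (f i).hasCompactSupport, by rw [(f i).tsupport_eq]; exact hU⟩
  refine ⟨range fun i => (f i : ℝ → ℝ), countable_range _, ?_, fun y hy r hr => ?_⟩
  · rintro _ ⟨i, rfl⟩
    exact ht i _ i.2.2
  · obtain ⟨δ, hδ, hδs⟩ := Metric.isOpen_iff.1 (Metric.isOpen_ball.inter isOpen_Ioo) y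
      (⟨Metric.mem_ball_self hr, hy⟩ : y ∈ Metric.ball y r ∩ Ioo a b)
    obtain ⟨s, hs0, hsδ⟩ := exists_rat_btwn (half_pos hδ)
    obtain ⟨c, hc1, hc2⟩ := exists_rat_btwn (show y < y + s by linarith)
    have hcy : dist y c < s := by
      rw [Real.dist_eq, abs_sub_comm, abs_of_pos (by linarith)]; linarith
    have hsub : Metric.closedBall (c : ℝ) s ⊆ Metric.ball y r ∩ Ioo a b := by
      refine (fun x hx => hδs ?_)
      rw [Metric.mem_ball]
      have := dist_triangle x c y
      rw [dist_comm (c : ℝ) y] at this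
      linarith [Metric.mem_closedBall.1 hx]
    let i : ι := ⟨(c, s), hs0, hsub.trans inter_subset_right⟩
    exact ⟨f i, ⟨i, rfl⟩, ht i _ hsub, ((f i).pos_of_mem_ball (Metric.mem_ball.2 hcy)).ne'⟩

namespace SolutionSeq

variable {a b n E M : ℝ} {uin : ℝ → ℝ} {e : ℕ → ℝ} {u ux uxx uxxx : ℕ → ℝ → ℝ → ℝ}

theorem tendsto_lintegral_flux (h : SolutionSeq a b n E M uin e u ux uxx uxxx) {S : ℝ} (hS : 0 < S)
    {φ : ℝ → ℝ} (hφ : IsTest (Ioo a b) φ) :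
    Tendsto (fun k => ∫⁻ t in Ioo 0 S,
      ENNReal.ofReal |∫ x in Ioo a b, Rterm a b n (e k) (u k) (uxxx k) t x * φ x|) atTop (𝓝 0) := by
  obtain ⟨K, hK⟩ := hφ.exists_bound
  have hK0 : 0 ≤ K := (abs_nonneg _).trans (hK 0)
  have hba : 0 < b - a := sub_pos.2 h.hab
  have hM := h.one_le
  refine tendsto_zero_of_forall_le (C := K * (((2 + 18 / n ^ 2) * (1 + M)) * (b - a) * S))
    (K := fun η => K * η⁻¹) h.tendsto_energy_div_log fun η hη _ k => ?_
  refine ((h.sol k).lintegral_flux_le h.hn0 h.hn3 (h.mem k) h.one_le (h.le k) hS hη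
    (h.energy_le k) hK).trans_eq ?_
  rw [mul_add, ← mul_assoc, ← ENNReal.ofReal_mul hK0, ← ENNReal.ofReal_mul (by positivity),
    ← mul_assoc (ENNReal.ofReal K) (ENNReal.ofReal η⁻¹), ← ENNReal.ofReal_mul hK0]
  congr 2
  ring

theorem tendsto_lintegral_production_neg (h : SolutionSeq a b n E M uin e u ux uxx uxxx) {S : ℝ}
    (hS : 0 < S) {K : ℝ} {φ : ℝ → ℝ} (hφ : Weight a b K φ) :
    Tendsto (fun k => ∫⁻ t in Ioo 0 S, ENNReal.ofReal
      (-∫ x in Ioo a b, Tterm a b (u k) (ux k) (uxxx k) t x * φ x)) atTop (𝓝 0) := by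
  obtain ⟨C, hC, hlow⟩ := Slice.production_lower (K := K) (E := E) h.hab h.one_le
  refine tendsto_zero_of_forall_le (C := C * S) (K := fun d => C / d ^ 5) h.tendsto_energy_div_log
    fun d hd hd1 k => ?_
  refine ((h.sol k).lintegral_production_neg_le h.hab (h.mem k) (h.le k) hS h.energy_nonneg hC hd
    (h.energy_le k) hφ fun w p q z φ Sl hφ hw hE hp => ?_).trans_eq ?_
  · have h1 := hlow w p q z φ Sl hφ hw hE hp d hd hd1
    -- The quartic term has a sign and is dropped: here only a lower bound on the production is
    -- needed.
    have h2 : ∫ x in Ioo a b, deriv (dcap (d ^ 4)) (w x) * p x ^ 4 * φ x ≤ 0 :=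
      setIntegral_nonpos measurableSet_Ioo fun x _ =>
        mul_nonpos_of_nonpos_of_nonneg (mul_nonpos_of_nonpos_of_nonneg
          (deriv_dcap_nonpos (by positivity) _) (by positivity)) (hφ.nonneg x)
    linarith
  · rw [← ENNReal.ofReal_mul (by positivity)]
    congr 2
    ring

/-- The limit of `∫ ρ^ε ψ⁴` never exceeds `∫ ψ⁴`; a time with equality is a maximum, and
`ae_exists_rat_tendsto` applies with that value as `L`. -/
theorem ae_exists_rat (h : SolutionSeq a b n E M uin e u ux uxx uxxx) {ρ : ℝ → ℝ → ℝ}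
    (hρ : ∀ᵐ t ∂(volume.restrict (Ioi (0 : ℝ))), ∀ φ, IsTest (Ioo a b) φ →
        Tendsto (fun k => ∫ x in Ioo a b, Beps n (e k) (u k t x) * φ x) atTop
          (𝓝 (∫ x in Ioo a b, ρ t x * φ x)))
    {ψ : ℝ → ℝ} (hψ : IsTest (Ioo a b) ψ) :
    ∀ᵐ t, t ∈ Ioi (0 : ℝ) → ∫ x in Ioo a b, ρ t x * ψ x ^ 4 = ∫ x in Ioo a b, ψ x ^ 4 →
      ∃ q : ℚ × ℚ, 0 ≤ q.1 ∧ t ∈ Ioo (q.1 : ℝ) q.2 ∧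
        Tendsto (fun k => ∫⁻ s in Ioo (q.1 : ℝ) q.2, ENNReal.ofReal
          |∫ x in Ioo a b, Tterm a b (u k) (ux k) (uxxx k) s x * ψ x ^ 4|) atTop (𝓝 0) := by
  have hφ := hψ.pow_four
  obtain ⟨K, hK⟩ := hψ.exists_weight
  rw [ae_restrict_iff' measurableSet_Ioi] at hρ
  have key : ∀ N : ℕ, _ := fun N : ℕ => by
    have hT : (0 : ℝ) < N + 1 := by positivity
    have hev := fun k => (h.sol k).evolution h.hn0 h.hn3 (h.mem k) h.one_le (h.le k)
      (h.energy_le k) hT hφ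
    refine ae_exists_rat_tendsto (T := N + 1) (L := ∫ x in Ioo a b, ψ x ^ 4)
      (r' := fun t => ∫ x in Ioo a b, ρ t x * ψ x ^ 4) (fun k => (hev k).1) (fun k => (hev k).2.1)
      (fun k => (hev k).2.2) (h.tendsto_lintegral_production_neg hT hK)
      (h.tendsto_lintegral_flux hT hφ.derivative) ?_ ?_
    · filter_upwards [hρ] with t ht htT
      exact ht htT.1 _ hφ
    · filter_upwards [hρ] with t ht htT
      exact h.le_of_tendsto_rho hφ (fun x => by positivity) htT.1 (ht htT.1 _ hφ)
  filter_upwards [ae_all_iff.2 key] with t ht ht0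
  have ht0 : 0 < t := ht0
  obtain ⟨N, hN⟩ := exists_nat_gt t
  exact ht N ⟨ht0, by linarith⟩

/-- The index set consists of the pairs of a bump and a rational interval on which the production
already tends to zero in `L¹`. It is countable, so one subsequence gives convergence at almost every
time of each interval; the extra copy of `ℕ` carries the dissipation. -/
theorem exists_subseq_production (h : SolutionSeq a b n E M uin e u ux uxx uxxx) {ρ : ℝ → ℝ → ℝ}
    (hρ : ∀ᵐ t ∂(volume.restrict (Ioi (0 : ℝ))), ∀ φ, IsTest (Ioo a b) φ →
        Tendsto (fun k => ∫ x in Ioo a b, Beps n (e k) (u k t x) * φ x) atTop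
          (𝓝 (∫ x in Ioo a b, ρ t x * φ x)))
    {W : Set (ℝ → ℝ)} (hWc : W.Countable) (hW : ∀ ψ ∈ W, IsTest (Ioo a b) ψ) :
    ∃ σ : ℕ → ℕ, StrictMono σ ∧ ∀ᵐ t ∂(volume.restrict (Ioi (0 : ℝ))),
      Tendsto (fun k => dissipation a b n (e (σ k)) (u (σ k)) (uxxx (σ k)) t) atTop (𝓝 0) ∧
      ∀ ψ ∈ W, ∫ x in Ioo a b, ρ t x * ψ x ^ 4 = ∫ x in Ioo a b, ψ x ^ 4 →
        Tendsto (fun k => ∫ x in Ioo a b,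
          Tterm a b (u (σ k)) (ux (σ k)) (uxxx (σ k)) t x * ψ x ^ 4) atTop (𝓝 0) := by
  have : Countable W := hWc.to_subtype
  set f : (ℝ → ℝ) → ℕ → ℝ → ℝ := fun ψ k t =>
    ∫ x in Ioo a b, Tterm a b (u k) (ux k) (uxxx k) t x * ψ x ^ 4 with hf
  let ι := {i : W × (ℚ × ℚ) // 0 ≤ i.2.1 ∧ Tendsto (fun k =>
    ∫⁻ s in Ioo (i.2.1 : ℝ) i.2.2, ENNReal.ofReal |f i.1 k s|) atTop (𝓝 0)}
  let μ : ι ⊕ ℕ → Measure ℝ := Sum.elim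
    (fun i => volume.restrict (Ioo (i.1.2.1 : ℝ) i.1.2.2))
    (fun N => volume.restrict (Ioo (0 : ℝ) (N + 1)))
  let H : ι ⊕ ℕ → ℕ → ℝ → ℝ≥0∞ := Sum.elim (fun i k t => ENNReal.ofReal |f i.1.1 k t|)
    (fun _ k t => dissipation a b n (e k) (u k) (uxxx k) t)
  have hm : ∀ i k, AEMeasurable (H i k) (μ i) := by
    rintro (i | N) k
    · have hS : (0 : ℝ) < max (i.1.2.2 : ℝ) 1 := lt_max_of_lt_right one_pos
      have h1 := ((h.sol k).evolution h.hn0 h.hn3 (h.mem k) h.one_le (h.le k) (h.energy_le k) hS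
        (hW i.1.1 i.1.1.2).pow_four).1
      have h2 : Ioo (i.1.2.1 : ℝ) i.1.2.2 ⊆ Ioo 0 (max (i.1.2.2 : ℝ) 1) :=
        Ioo_subset_Ioo (by exact_mod_cast i.2.1) (le_max_left _ _)
      exact (h1.mono_set h2).abs.aestronglyMeasurable.aemeasurable.ennreal_ofReal
    · exact (h.sol k).aemeasurable_dissipation.mono_measure
        (Measure.restrict_mono Ioo_subset_Ioi_self le_rfl)
  have hl : ∀ i, Tendsto (fun k => ∫⁻ t, H i k t ∂μ i) atTop (𝓝 0) := by
    rintro (i | N)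
    · exact i.2.2
    · exact tendsto_of_tendsto_of_tendsto_of_le_of_le tendsto_const_nhds h.tendsto_energy_div_log
        (fun _ => zero_le) fun k =>
          (h.sol k).lintegral_dissipation_le (h.mem k) (by positivity) (h.energy_le k)
  obtain ⟨σ, hσ, hH⟩ := exists_subseq_ae_tendsto_zero μ H hm hl
  refine ⟨σ, hσ, (ae_restrict_iff' measurableSet_Ioi).2 ?_⟩
  have h1 : ∀ N : ℕ, ∀ᵐ t, t ∈ Ioo (0 : ℝ) (N + 1) →
      Tendsto (fun k => dissipation a b n (e (σ k)) (u (σ k)) (uxxx (σ k)) t) atTop (𝓝 0) :=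
    fun N => (ae_restrict_iff' measurableSet_Ioo).1 (hH (Sum.inr N))
  have h2 : ∀ i : ι, ∀ᵐ t, t ∈ Ioo (i.1.2.1 : ℝ) i.1.2.2 →
      Tendsto (fun k => ENNReal.ofReal |f i.1.1 (σ k) t|) atTop (𝓝 0) :=
    fun i => (ae_restrict_iff' measurableSet_Ioo).1 (hH (Sum.inl i))
  have h3 : ∀ ψ : W, _ := fun ψ : W => h.ae_exists_rat hρ (hW ψ ψ.2)
  filter_upwards [ae_all_iff.2 h1, ae_all_iff.2 h2, ae_all_iff.2 h3] with t k1 k2 k3 ht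
  have ht0 : 0 < t := ht
  refine ⟨?_, fun ψ hψ heq => ?_⟩
  · obtain ⟨N, hN⟩ := exists_nat_gt t
    exact k1 N ⟨ht0, by linarith⟩
  · obtain ⟨q, hq0, hqt, hq⟩ := k3 ⟨ψ, hψ⟩ ht heq
    have h5 := (ENNReal.tendsto_toReal ENNReal.zero_ne_top).comp
      (k2 ⟨(⟨ψ, hψ⟩, q), hq0, hq⟩ hqt)
    refine (tendsto_zero_iff_abs_tendsto_zero _).2 (h5.congr fun k => ?_)
    simp only [Function.comp_apply]
    rw [ENNReal.toReal_ofReal (abs_nonneg _)]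

end SolutionSeq

end ThinFilm

namespace ThinFilm

/-! ### Accumulation points at a fixed time -/

theorem LocallyQuadratic.contDiffOn {a b : ℝ} {v : ℝ → ℝ} (hq : LocallyQuadratic a b v)
    (hv : ContinuousOn v (Icc a b)) :
    ContDiffOn ℝ 3 v (posSet a b v) ∧ ∀ x ∈ posSet a b v, iteratedDeriv 3 v x = 0 := by
  have hloc : ∀ x ∈ posSet a b v, ∃ α β γ : ℝ, v =ᶠ[𝓝 x] fun x => α + β * x + γ * x ^ 2 :=
    fun x hx => by
    obtain ⟨δ, hδ, hs⟩ := Metric.isOpen_iff.1 (isOpen_posSet hv) x hx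
    have hs' : Icc (x - δ / 2) (x + δ / 2) ⊆ posSet a b v := fun y hy => hs <| by
      rw [Real.ball_eq_Ioo]; exact ⟨by linarith [hy.1], by linarith [hy.2]⟩
    have h1 := hs' (left_mem_Icc.2 (by linarith))
    have h2 := hs' (right_mem_Icc.2 (by linarith))
    obtain ⟨α, β, γ, h3, -⟩ := hq (x - δ / 2) (x + δ / 2) h1.1.1.le (by linarith) h2.1.2.le
      fun y hy => (hs' hy).2
    refine ⟨α, β, γ, ?_⟩
    filter_upwards [Icc_mem_nhds (by linarith : x - δ / 2 < x) (by linarith : x < x + δ / 2)]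
      with y hy using h3 y hy
  refine ⟨fun x hx => ?_, fun x hx => ?_⟩
  · obtain ⟨α, β, γ, h⟩ := hloc x hx
    have h1 : ContDiffAt ℝ 3 (fun x : ℝ => α + β * x + γ * x ^ 2) x := by fun_prop
    exact (h1.congr_of_eventuallyEq h).contDiffWithinAt
  · obtain ⟨α, β, γ, h⟩ := hloc x hx
    rw [h.iteratedDeriv_eq 3, iteratedDeriv_three_eq]
    have d1 : deriv (fun x : ℝ => α + β * x + γ * x ^ 2) = fun x => β + 2 * γ * x := by
      funext y
      have := (((hasDerivAt_id y).const_mul β).const_add α).add (((hasDerivAt_id y).pow 2).const_mul γ)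
      refine (this.congr_deriv ?_).deriv
      simp; ring
    have d2 : deriv (fun x : ℝ => β + 2 * γ * x) = fun _ => 2 * γ := by
      funext y
      simp
    rw [d1, d2, deriv_const]

/-- On an interval where a density below one has full mass it is seen as one by test functions. -/
theorem integral_mul_eq_of_saturated {a b c d : ℝ} (hac : a ≤ c) (hcd : c < d) (hdb : d ≤ b)
    {ρ : ℝ → ℝ} (hρ : IntegrableOn ρ (Ioo a b))
    (hle : ∀ χ, IsTest (Ioo a b) χ → (∀ x, 0 ≤ χ x) →
      ∫ x in Ioo a b, ρ x * χ x ≤ ∫ x in Ioo a b, χ x)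
    (hsat : ∫ x in Ioo c d, (1 - ρ x) = 0) {φ : ℝ → ℝ} (hφ : IsTest (Ioo c d) φ)
    (hφ0 : ∀ x, 0 ≤ φ x) : ∫ x in Ioo a b, ρ x * φ x = ∫ x in Ioo a b, φ x := by
  have hab : a < b := hac.trans_lt (hcd.trans_le hdb)
  have hsub : Ioo c d ⊆ Ioo a b := Ioo_subset_Ioo hac hdb
  have hg : IntegrableOn (fun x => 1 - ρ x) (Ioo a b) := (integrable_const 1).sub hρ
  have hconv : ∀ χ, IsTest (Ioo a b) χ → ∫ x in Ioo a b, (1 - ρ x) * χ x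
      = (∫ x in Ioo a b, χ x) - ∫ x in Ioo a b, ρ x * χ x := fun χ hχ => by
    rw [← integral_sub (ContinuousOn.integrableOn_Ioo hχ.continuous.continuousOn)
      (hχ.mul_integrableOn hab hρ.locallyIntegrableOn)]
    exact integral_congr_ae (Eventually.of_forall fun x => by ring)
  have hφ' := hφ.mono hsub
  refine le_antisymm (hle φ hφ' hφ0) ?_
  obtain ⟨C, hC⟩ := hφ.exists_bound
  have hC0 : 0 ≤ C := (abs_nonneg _).trans (hC 0)
  set R := (d - c) / 2 with hR
  have hR0 : 0 < R := by rw [hR]; linarith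
  have hs : ∀ j : ℕ, 0 < R / (j + 2) ∧ R / (j + 2) < R := fun j =>
    ⟨by positivity, by rw [div_lt_iff₀ (by positivity)]; nlinarith [(Nat.cast_nonneg j : (0 : ℝ) ≤ j)]⟩
  -- Cutoffs exhausting `(c, d)`, so that `∫ (1 - ρ) χ j` tends to the vanishing integral over `(c,
  -- d)`.
  let χ : ∀ _ : ℕ, ContDiffBump ((c + d) / 2) := fun j =>
    ⟨R - R / (j + 2), R - R / (j + 2) / 2, by linarith [(hs j).2], by linarith [(hs j).1]⟩
  have hχt : ∀ j, IsTest (Ioo c d) (χ j) := fun j => by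
    refine ⟨(χ j).contDiff, (χ j).hasCompactSupport, ?_⟩
    rw [(χ j).tsupport_eq, Real.closedBall_eq_Icc]
    have := (hs j).1
    refine Icc_subset_Ioo ?_ ?_ <;> simp only [χ] <;> linarith
  have hlim0 : Tendsto (fun j : ℕ => R / ((j : ℝ) + 2)) atTop (𝓝 0) :=
    (tendsto_atTop_add_const_right _ _ tendsto_natCast_atTop_atTop).const_div_atTop R
  have hone : ∀ l r, c < l → r < d → ∀ᶠ j in atTop, ∀ x ∈ Icc l r, χ j x = 1 := fun l r hl hr => by
    filter_upwards [hlim0.eventually (gt_mem_nhds (sub_pos.2 hl)),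
      hlim0.eventually (gt_mem_nhds (sub_pos.2 hr))] with j h1 h2 x hx
    refine (χ j).one_of_mem_closedBall ?_
    rw [Real.closedBall_eq_Icc]
    constructor <;> simp only [χ] <;> linarith [hx.1, hx.2]
  have hT : Tendsto (fun j => ∫ x in Ioo a b, (1 - ρ x) * χ j x) atTop (𝓝 0) := by
    have h1 : ∀ j, ∫ x in Ioo a b, (1 - ρ x) * χ j x = ∫ x in Ioo c d, (1 - ρ x) * χ j x :=
      fun j => setIntegral_eq_of_subset_of_forall_sdiff_eq_zero measurableSet_Ioo hsub fun x hx => by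
        rw [(hχt j).eq_zero hx.2, mul_zero]
    simp only [h1]
    rw [← hsat]
    have hg' := hg.mono_set hsub
    refine tendsto_integral_filter_of_dominated_convergence (fun x => |1 - ρ x|)
      (Eventually.of_forall fun j => hg'.aestronglyMeasurable.mul
        (hχt j).continuous.aestronglyMeasurable) (Eventually.of_forall fun j =>
        Eventually.of_forall fun x => ?_) hg'.abs
      ((ae_restrict_mem measurableSet_Ioo).mono fun x hx => ?_)
    · rw [norm_mul, Real.norm_eq_abs, Real.norm_of_nonneg (χ j).nonneg]
      exact mul_le_of_le_one_right (abs_nonneg _) (χ j).le_one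
    · refine tendsto_const_nhds.congr' ?_
      filter_upwards [hone x x hx.1 hx.2] with j hj
      rw [hj x (left_mem_Icc.2 le_rfl), mul_one]
  obtain ⟨l, r, hcl, -, hrd, h0⟩ := hφ.exists_Icc hcd
  have hev : ∀ᶠ j in atTop, ∫ x in Ioo a b, (1 - ρ x) * φ x
      ≤ C * ∫ x in Ioo a b, (1 - ρ x) * χ j x := by
    filter_upwards [hone l r hcl hrd] with j hj
    have ht := ((hχt j).mono hsub).const_mul C
    -- `C χ j - φ` is a non-negative test function once `χ j = 1` on the support of `φ`. Testing
    -- with it compares the two defects, so that no pointwise bound `ρ ≤ 1` is needed.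
    have h2 := hle _ (ht.sub hφ') fun x => by
      by_cases hx : x ∈ Ioo l r
      · rw [hj x (Ioo_subset_Icc_self hx)]
        linarith [hC x, le_abs_self (φ x)]
      · rw [h0 x hx, sub_zero]
        exact mul_nonneg hC0 (χ j).nonneg
    have h3 := hconv _ (ht.sub hφ')
    have h4 : ∫ x in Ioo a b, (1 - ρ x) * (C * χ j x - φ x)
        = C * (∫ x in Ioo a b, (1 - ρ x) * χ j x) - ∫ x in Ioo a b, (1 - ρ x) * φ x := by
      rw [← integral_const_mul, ← integral_sub]
      · exact integral_congr_ae (Eventually.of_forall fun x => by ring)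
      · exact (((hχt j).mono hsub).mul_integrableOn hab hg.locallyIntegrableOn).const_mul C
      · exact hφ'.mul_integrableOn hab hg.locallyIntegrableOn
    linarith
  have h5 := ge_of_tendsto (hT.const_mul C) hev
  rw [mul_zero, hconv φ hφ'] at h5
  linarith

namespace SolutionSeq

variable {a b n E M : ℝ} {uin : ℝ → ℝ} {e : ℕ → ℝ} {u ux uxx uxxx : ℕ → ℝ → ℝ → ℝ}

theorem tendsto_rho_one (h : SolutionSeq a b n E M uin e u ux uxx uxxx) {t x δ : ℝ} (ht : 0 < t)
    (hx : x ∈ Icc a b) (hδ : 0 < δ) (hu : ∀ᶠ k in atTop, δ ≤ u k t x) :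
    Tendsto (fun k => Beps n (e k) (u k t x)) atTop (𝓝 1) := by
  refine tendsto_of_tendsto_of_tendsto_of_le_of_le' (h.tendsto_const_div_log
    (Real.log δ - 1 / ((4 - n) * (3 - n)))) (h.tendsto_const_div_log (B n 1 + Real.log M)) ?_
    (Eventually.of_forall fun k => h.rho_le k ht hx)
  filter_upwards [hu, h.tendsto.eventually (ge_mem_nhds hδ)] with k h1 h2
  exact Beps_ge h.hn0 h.hn3 (h.mem k) h2 h1

/-- Near a point where `v > 0` the heights stay above a positive constant, so `ρ^ε → 1` pointwise;
comparing with the distributional limit gives `ρ = 1` almost everywhere on a ball. -/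
theorem posSet_subset_sigmaSet (h : SolutionSeq a b n E M uin e u ux uxx uxxx) {t : ℝ} (ht : 0 < t)
    {ρ v : ℝ → ℝ} (hρ : IntegrableOn ρ (Ioo a b))
    (hconv : ∀ φ, IsTest (Ioo a b) φ →
      Tendsto (fun k => ∫ x in Ioo a b, Beps n (e k) (u k t x) * φ x) atTop
        (𝓝 (∫ x in Ioo a b, ρ x * φ x)))
    (hv : TendstoUniformlyOn (fun k => u k t) v atTop (Icc a b)) :
    posSet a b v ⊆ SigmaSet a b ρ := by
  have hvc : ContinuousOn v (Icc a b) :=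
    hv.continuousOn (Frequently.of_forall fun k => (h.sol k).slice_continuousOn ht.le)
  intro x₀ hx₀
  obtain ⟨r, hr, hs⟩ := Metric.isOpen_iff.1 (isOpen_posSet hvc) x₀ hx₀
  have hball : Metric.ball x₀ r ⊆ Ioo a b := fun x hx => (hs hx).1
  have hone : ∀ x ∈ Metric.ball x₀ r, Tendsto (fun k => Beps n (e k) (u k t x)) atTop (𝓝 1) :=
    fun x hx => by
    have hxm := Ioo_subset_Icc_self (hball hx)
    refine h.tendsto_rho_one ht hxm (half_pos (hs hx).2) ?_
    exact (hv.tendsto_at hxm).eventually (le_mem_nhds (half_lt_self (hs hx).2))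
  have hae : ∀ᵐ x, x ∈ Metric.ball x₀ r → ρ x - 1 = 0 := by
    have hg : IntegrableOn (fun x => ρ x - 1) (Ioo a b) := hρ.sub (integrable_const 1)
    refine Metric.isOpen_ball.ae_eq_zero_of_integral_contDiff_smul_eq_zero
      (hg.mono_set hball).locallyIntegrableOn fun φ h1 h2 h3 => ?_
    have hφ : IsTest (Metric.ball x₀ r) φ := ⟨h1, h2, h3⟩
    have hφ' := hφ.mono hball
    have hlim : Tendsto (fun k => ∫ x in Ioo a b, Beps n (e k) (u k t x) * φ x) atTop
        (𝓝 (∫ x in Ioo a b, φ x)) := by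
      obtain ⟨c, hc⟩ := (h.tendsto_const_div_log (B n 1 + Real.log M)).bddAbove_range
      refine tendsto_integral_filter_of_dominated_convergence (fun x => c * |φ x|)
        (Eventually.of_forall fun k => (hφ'.mul_integrableOn h.hab
          (h.integrableOn_rho k ht).locallyIntegrableOn).aestronglyMeasurable)
        (Eventually.of_forall fun k => (ae_restrict_mem measurableSet_Ioo).mono fun x hx => ?_)
        ((ContinuousOn.integrableOn_Ioo hφ'.continuous.abs.continuousOn).const_mul c)
        (Eventually.of_forall fun x => ?_)
      · have hx' := Ioo_subset_Icc_self hx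
        rw [norm_mul, Real.norm_of_nonneg (h.rho_nonneg k ht hx'), Real.norm_eq_abs]
        exact mul_le_mul_of_nonneg_right ((h.rho_le k ht hx').trans (hc ⟨k, rfl⟩)) (abs_nonneg _)
      · by_cases hx : x ∈ Metric.ball x₀ r
        · simpa using (hone x hx).mul_const (φ x)
        · simp [hφ.eq_zero hx]
    have heq := tendsto_nhds_unique (hconv φ hφ') hlim
    rw [← setIntegral_eq_integral_of_forall_compl_eq_zero (s := Ioo a b)
      fun x hx => by rw [hφ'.eq_zero hx, zero_smul], ← sub_eq_zero.2 heq,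
      ← integral_sub (hφ'.mul_integrableOn h.hab hρ.locallyIntegrableOn)
        (ContinuousOn.integrableOn_Ioo hφ'.continuous.continuousOn)]
    exact integral_congr_ae (Eventually.of_forall fun x => by simp only [smul_eq_mul]; ring)
  refine ⟨hx₀.1, r, hr, ?_⟩
  rw [setIntegral_congr_ae (g := fun _ => (0 : ℝ)) (measurableSet_ball.inter measurableSet_Ioo)]
  · simp
  · filter_upwards [hae] with x hx hxm
    linarith [hx hxm.1]

/-- Stated for a sequence whose profiles converge uniformly at the time `t`, so that an accumulation
point is treated by passing to its own subsequence. -/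
theorem limit_properties (h : SolutionSeq a b n E M uin e u ux uxx uxxx) {t : ℝ} (ht : 0 < t)
    (hmass : ∫ x in Ioo a b, uin x = 1) {ρ v : ℝ → ℝ} (hρ : IntegrableOn ρ (Ioo a b))
    (hconv : ∀ φ, IsTest (Ioo a b) φ →
      Tendsto (fun k => ∫ x in Ioo a b, Beps n (e k) (u k t x) * φ x) atTop
        (𝓝 (∫ x in Ioo a b, ρ x * φ x)))
    (hslice : ∀ k, dissipation a b n (e k) (u k) (uxxx k) t < ⊤ ∧
      ∃ q, Slice a b (u k t) (ux k t) q ((posSet a b (u k t)).indicator (uxxx k t)) ∧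
      (∫ x in Ioo a b, u k t x ^ 3 * (posSet a b (u k t)).indicator (uxxx k t) x ^ 2)
        ≤ (dissipation a b n (e k) (u k) (uxxx k) t).toReal ∧
      ∀ φ, IsTest (Ioo a b) φ → ∫ x in Ioo a b, Tterm a b (u k) (ux k) (uxxx k) t x * φ x
        = production a b (u k t) (ux k t) q φ)
    (hdis : Tendsto (fun k => dissipation a b n (e k) (u k) (uxxx k) t) atTop (𝓝 0))
    {W : Set (ℝ → ℝ)} (hW : ∀ ψ ∈ W, IsTest (Ioo a b) ψ)
    (hWb : ∀ y ∈ Ioo a b, ∀ r, 0 < r →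
      ∃ ψ ∈ W, IsTest (Metric.ball y r ∩ Ioo a b) ψ ∧ ψ y ≠ 0)
    (hprod : ∀ ψ ∈ W, ∫ x in Ioo a b, ρ x * ψ x ^ 4 = ∫ x in Ioo a b, ψ x ^ 4 →
      Tendsto (fun k => ∫ x in Ioo a b, Tterm a b (u k) (ux k) (uxxx k) t x * ψ x ^ 4) atTop (𝓝 0))
    (hv : TendstoUniformlyOn (fun k => u k t) v atTop (Icc a b)) :
    (ContinuousOn v (Icc a b) ∧ MemH1 a b v) ∧
      (ContDiffOn ℝ 3 v (posSet a b v) ∧ ∀ x ∈ posSet a b v, iteratedDeriv 3 v x = 0) ∧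
      ∫ x in Ioo a b, v x = 1 ∧ posSet a b v ⊆ SigmaSet a b ρ ∧
      frontier (posSet a b v) ∩ SigmaSet a b ρ = ∅ := by
  have hwc := fun k => (h.sol k).slice_continuousOn ht.le
  have hvc : ContinuousOn v (Icc a b) := hv.continuousOn (Frequently.of_forall hwc)
  have hv0 : ∀ x ∈ Icc a b, 0 ≤ v x := fun x hx =>
    ge_of_tendsto' (hv.tendsto_at hx) fun k => (h.sol k).nonneg t ht.le x hx
  choose hfin q S hz hT using hslice
  have hE := fun k => (h.sol k).integral_ux_sq_le h.energy_nonneg ht (h.energy_le k)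
  have hD : Tendsto (fun k => ∫ x in Ioo a b,
      u k t x ^ 3 * (posSet a b (u k t)).indicator (uxxx k t) x ^ 2) atTop (𝓝 0) := by
    have h1 := (ENNReal.tendsto_toReal ENNReal.zero_ne_top).comp hdis
    refine tendsto_of_tendsto_of_tendsto_of_le_of_le tendsto_const_nhds h1 (fun k => ?_) hz
    exact setIntegral_nonneg measurableSet_Ioo fun x hx => mul_nonneg
      (pow_nonneg ((h.sol k).nonneg t ht.le x (Ioo_subset_Icc_self hx)) 3) (sq_nonneg _)
  refine ⟨⟨hvc, memH1_of_tendstoUniformlyOn hwc (fun k => ((h.sol k).deriv_one t ht.le).1)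
    (fun k => ((h.sol k).deriv_one t ht.le).2) hE hv⟩,
    (locallyQuadratic_of_limit S hD hv).contDiffOn hvc, ?_,
    h.posSet_subset_sigmaSet ht hρ hconv hv, ?_⟩
  · have h1 : Tendsto (fun k => ∫ x in Ioo a b, u k t x) atTop (𝓝 (∫ x in Ioo a b, v x)) := by
      refine tendsto_integral_filter_of_dominated_convergence (fun _ => M)
        (Eventually.of_forall fun k => aestronglyMeasurable_of_continuousOn (hwc k))
        (Eventually.of_forall fun k => (ae_restrict_mem measurableSet_Ioo).mono fun x hx => ?_)
        (integrable_const M) ((ae_restrict_mem measurableSet_Ioo).mono fun x hx =>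
          hv.tendsto_at (Ioo_subset_Icc_self hx))
      have hx' := Ioo_subset_Icc_self hx
      rw [Real.norm_of_nonneg ((h.sol k).nonneg t ht.le x hx')]
      exact h.le k t ht x hx'
    simp only [(h.sol _).mass t ht, hmass] at h1
    exact tendsto_nhds_unique h1 tendsto_const_nhds
  · refine eq_empty_of_forall_notMem fun x₀ hx₀ => ?_
    obtain ⟨hf, hxm, r, hr, hsat⟩ := hx₀
    -- A boundary point in `Σ(t)` yields the end point of a component inside the saturated ball. A
    -- bump at that point sees full density, so its production tends to zero, while the positive
    -- slope keeps it bounded below.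
    obtain ⟨y₀, hy₀, hvy₀, hend⟩ := exists_component_endpoint hvc hv0 hxm hf hr
    obtain ⟨δ, hδ, hδs⟩ := Metric.isOpen_iff.1 Metric.isOpen_ball y₀ hy₀.2
    obtain ⟨ψ, hψW, hψ, hψy⟩ := hWb y₀ hy₀.1 δ hδ
    have hset : Metric.ball x₀ r ∩ Ioo a b = Ioo (max (x₀ - r) a) (min (x₀ + r) b) := by
      rw [Real.ball_eq_Ioo, Ioo_inter_Ioo]
    have hψ4 : IsTest (Ioo (max (x₀ - r) a) (min (x₀ + r) b)) (fun x => ψ x ^ 4) := by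
      rw [← hset]
      exact (hψ.mono (inter_subset_inter_left _ hδs)).pow_four
    rw [hset] at hsat
    rw [inter_comm, hset] at hy₀
    have heq := integral_mul_eq_of_saturated (le_max_right _ _) (hy₀.1.trans hy₀.2)
      (min_le_right _ _) hρ (fun χ hχ hχ0 => h.le_of_tendsto_rho hχ hχ0 ht (hconv χ hχ)) hsat hψ4
      fun x => by positivity
    obtain ⟨K, hK⟩ := (hW ψ hψW).exists_weight
    obtain ⟨m, hm, hev⟩ := production_eventually_ge_of_endpoint h.hab h.one_le S
      (fun k => h.le k t ht) hE hD hv hK (Ioo_subset_Ioo (le_max_right _ _) (min_le_right _ _) hy₀)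
      hvy₀ (by positivity) hend
    have hlim := hprod ψ hψW heq
    simp only [hT _ _ hK.test] at hlim
    exact absurd (ge_of_tendsto hlim hev) (not_le.2 hm)

end SolutionSeq

end ThinFilm

/-! ### The main theorem. -/

theorem theorem2 (a b : ℝ) (hab : a < b) (n : ℝ) (hn0 : 0 < n) (hn3 : n < 3)
    (uin : ℝ → ℝ) (huin_cont : ContinuousOn uin (Icc a b))
    (huin_nonneg : ∀ x ∈ Icc a b, 0 ≤ uin x) (huin_H1 : ThinFilm.MemH1 a b uin)
    (huin_mass : ∫ x in Ioo a b, uin x = 1)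
    (u : ℝ → ℝ → ℝ → ℝ)
    (hu : ∀ ε ∈ Ioo (0 : ℝ) 1, ThinFilm.IsSolution a b n ε uin (u ε)) :
    (∀ t : ℝ, 0 < t →
      (∃ C : ℝ, ∀ ε ∈ Ioo (0 : ℝ) 1, ThinFilm.H1NormLE a b (u ε t) C) ∧
      IsCompact (closure
        {g : C(Icc a b, ℝ) | ∃ ε ∈ Ioo (0 : ℝ) 1, ∀ x : Icc a b, g x = u ε t x})) ∧
    (∀ (p : ℝ≥0∞), 1 ≤ p → p ≠ ⊤ →
      ∀ (εs : ℕ → ℝ), (∀ k, εs k ∈ Ioo (0 : ℝ) 1) → Tendsto εs atTop (𝓝 0) →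
      ∀ (ρ : ℝ → ℝ → ℝ),
        (∀ S : ℝ, 0 < S → IntegrableOn (Function.uncurry ρ) (Ioo 0 S ×ˢ Ioo a b)) →
        ThinFilm.TendstoLpNegSobolev a b p
          (fun k t x => ThinFilm.Beps n (εs k) (u (εs k) t x)) ρ →
      ∃ σ : ℕ → ℕ, StrictMono σ ∧
        ∀ᵐ t ∂(volume.restrict (Ioi (0 : ℝ))), ∀ v : ℝ → ℝ,
          ThinFilm.IsAccPoint a b (fun k => u (εs (σ k)) t) v →
            (ContinuousOn v (Icc a b) ∧ ThinFilm.MemH1 a b v) ∧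
            (ContDiffOn ℝ 3 v (ThinFilm.posSet a b v) ∧
              ∀ x ∈ ThinFilm.posSet a b v, iteratedDeriv 3 v x = 0) ∧
            ∫ x in Ioo a b, v x = 1 ∧
            ThinFilm.posSet a b v ⊆ ThinFilm.SigmaSet a b (ρ t) ∧
            frontier (ThinFilm.posSet a b v) ∩ ThinFilm.SigmaSet a b (ρ t) = ∅) := by
  refine ⟨fun t ht => ThinFilm.bounded_and_relatively_compact hab huin_H1 huin_mass hu ht, ?_⟩
  intro p hp _ εs hεs hlim ρ hρ hconv
  obtain ⟨E, M, hE0, hM1, hbd⟩ := ThinFilm.exists_uniform_bounds (n := n) hab huin_H1 huin_mass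
  choose ux uxx uxxx hsol using fun k => hu (εs k) (hεs k)
  have h : ThinFilm.SolutionSeq a b n E M uin εs (fun k => u (εs k)) ux uxx uxxx :=
    ⟨hab, hn0, hn3, hE0, hM1, hεs, hlim, hsol, fun k => (hbd _ _ _ _ _ (hsol k)).1,
      fun k => (hbd _ _ _ _ _ (hsol k)).2⟩
  obtain ⟨σ₁, hσ₁, h1⟩ := h.exists_subseq_tendsto_rho hp hρ hconv
  obtain ⟨W, hWc, hW, hWb⟩ := ThinFilm.exists_countable_bumps a b
  obtain ⟨σ₂, hσ₂, h2⟩ := (h.subseq hσ₁).exists_subseq_production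
    (h1.mono fun t ht => ht.2) hWc hW
  refine ⟨σ₁ ∘ σ₂, hσ₁.comp hσ₂, ?_⟩
  filter_upwards [h1, h2, ae_all_iff.2 fun k => (h.sol k).ae_slice hab (hεs k) (h.energy_le k),
    ae_restrict_mem measurableSet_Ioi] with t k1 k2 k3 ht v hv
  -- The subsequence `τ` depends on `t` and `v`. All almost-everywhere statements hold along `σ₁ ∘
  -- σ₂`, chosen beforehand, and pass to `τ` at the fixed time.
  obtain ⟨τ, hτ, hvτ⟩ := hv
  exact (h.subseq (hσ₁.comp (hσ₂.comp hτ))).limit_properties ht huin_mass k1.1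
    (fun φ hφ => (k1.2 φ hφ).comp (hσ₂.comp hτ).tendsto_atTop) (fun k => k3 _)
    (k2.1.comp hτ.tendsto_atTop) hW hWb
    (fun ψ hψ heq => (k2.2 ψ hψ heq).comp hτ.tendsto_atTop) hvτ
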